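/- **Setting.** Let $\pi_{XY}:Y\to X$ be a smooth fibre bundle of finite-dimensional manifolds with $\dim X=n+1$, let $\Sigma$ be a compact oriented $n$-manifold without boundary, and let $\tau:\Sigma\to X$ be a smooth embedding, with image $\Sigma_\tau$. Let $\mathcal G$ be a diffeological group (for instance a Lie group, or a group of diffeomorphisms or of bundle automorphisms), with Lie algebra $\mathfrak g=T_1\mathcal G$ and adjoint action $\mathrm{Ad}$. Let $\mathcal G$ act smoothly on $Y$ and on $X$, $\eta\mapsto\eta_Y,\eta_X$, with $\pi_{XY}\circ\eta_Y=\eta_X\circ\pi_{XY}$. For $\xi\in\mathfrak g$ write $\xi_Y$, $\xi_Z$, … for the infinitesimal generators of the actions. Let $\Lambda=\Lambda^{n+1}T^*Y$ with projection $\pi:\Lambda\to Y$, let $Z\subset\Lambda$ be the subbundle of those $z$ with $\mathbf i_v\mathbf i_wz=0$ for all vertical $v,w$, let $\pi_{YZ}=\pi|_Z$, and let $\Theta$ be the canonical form, $\Theta_z(u_0,\dots,u_n)=z(T\pi\,u_0,\dots,T\pi\,u_n)$. The lifted action is $\eta_Z(z)=(\eta_Y^{-1})^*z$; it preserves $Z$.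 Its covariant momentum map is $J$, $\langle J,\xi\rangle=\mathbf i_{\xi_Z}\Theta$. Let $\mathcal G_\tau=\{\eta\in\mathcal G:\eta_X(\Sigma_\tau)=\Sigma_\tau\}$, a group with the subspace diffeology, and let $\mathfrak g_\tau=T_1\mathcal G_\tau$, with its natural map to $\mathfrak g$. For $\eta\in\mathcal G_\tau$ let $\eta_\tau$ be the diffeomorphism of $\Sigma\cong\Sigma_\tau$ induced by $\eta_X$, and for $\xi\in\mathfrak g_\tau$ let $\xi_\tau$ be the generator of this action on $\Sigma$. Sections over $\Sigma_\tau$ are regarded as maps on $\Sigma$ covering $\tau$. Let * $\mathcal Y_\tau$ and $\mathcal Z_\tau$ be the sets of smooth sections of $Y$ and of $Z$ over $\Sigma_\tau$; * $T_\varphi\mathcal Y_\tau$ be the space of smooth vertical vector fields $V$ along $\varphi\in\mathcal Y_\tau$; * $T^*_\varphi\mathcal Y_\tau$ be the space of smooth sections $\pi$, covering $\varphi$, of the bundle with fibres $L(V_{\varphi(x)}Y,\Lambda^nT_x^*\Sigma)$, paired with $T_\varphi\mathcal Y_\tau$ by $\langle\pi,V\rangle=\int_\Sigma\pi(V)$;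 * $R_\tau:\mathcal Z_\tau\to T^*\mathcal Y_\tau$, $R_\tau(\sigma)=(\varphi,\pi)$, with $\varphi=\pi_{YZ}\circ\sigma$ and $\pi(V)=\varphi^*(\mathbf i_V\sigma)$. $\mathcal G_\tau$ acts on $\mathcal Y_\tau$ and $\mathcal Z_\tau$ by $\eta_{\mathcal Y_\tau}(\varphi)=\eta_Y\circ\varphi\circ\eta_\tau^{-1}$ and $\eta_{\mathcal Z_\tau}(\sigma)=\eta_Z\circ\sigma\circ\eta_\tau^{-1}$; put $\xi_{\mathcal Y_\tau}(\varphi)=\xi_Y\circ\varphi-T\varphi\circ\xi_\tau$. The energy-momentum map $E_\tau$ on $\mathcal Z_\tau$ is $\langle E_\tau(\sigma),\xi\rangle=\int_\Sigma\sigma^*\langle J,\xi\rangle$ for $\xi\in\mathfrak g$, and $J_\tau$ is its restriction to $\xi\in\mathfrak g_\tau$. **Corollary 7.6.** For such lifted actions the following hold. 1. For every $\sigma\in\mathcal Z_\tau$, $E_\tau(\sigma)$ is a linear functional on $\mathfrak g$, and for $\xi\in\mathfrak g$ and $\varphi=\pi_{YZ}\circ\sigma$, $$\langle E_\tau(\sigma),\xi\rangle=\int_{\Sigma}\varphi^*(\mathbf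 i_{\xi_Y}\sigma).$$ 2. There are unique maps $\eta_{T^*\mathcal Y_\tau}:T^*\mathcal Y_\tau\to T^*\mathcal Y_\tau$, $\eta\in\mathcal G_\tau$, with $\eta_{T^*\mathcal Y_\tau}(R_\tau(\sigma))=R_\tau(\eta_{\mathcal Z_\tau}(\sigma))$ for all $\sigma\in\mathcal Z_\tau$. They form an action of $\mathcal G_\tau$ covering its action on $\mathcal Y_\tau$, and whenever $\eta_\tau$ preserves the orientation of $\Sigma$ it is the usual cotangent action: $\eta_{T^*\mathcal Y_\tau}(\pi)=(\eta^{-1}_{\mathcal Y_\tau})^*\pi$, that is, $\langle\eta_{T^*\mathcal Y_\tau}(\pi),T\eta_{\mathcal Y_\tau}\cdot V\rangle=\langle\pi,V\rangle$ for all $\pi\in T^*_\varphi\mathcal Y_\tau$ and $V\in T_\varphi\mathcal Y_\tau$, where $T\eta_{\mathcal Y_\tau}\cdot V=T\eta_Y\circ V\circ\eta_\tau^{-1}$. 3. There is a unique map $\mathcal J_\tau$ on $T^*\mathcal Y_\tau$ with $\langle\mathcal J_\tau(R_\tau(\sigma)),\xi\rangle=\langle J_\tau(\sigma),\xi\rangle$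 for all $\sigma\in\mathcal Z_\tau$ and $\xi\in\mathfrak g_\tau$, and it is the standard one: $$\langle\mathcal J_\tau(\varphi,\pi),\xi\rangle=\langle\pi,\xi_{\mathcal Y_\tau}(\varphi)\rangle=\int_\Sigma\pi(\xi_{\mathcal Y_\tau}(\varphi)).$$ Moreover $J$, $J_\tau$ and $\mathcal J_\tau$ are $\mathrm{Ad}^*$-equivariant: $\langle J(z),\mathrm{Ad}_{\eta^{-1}}\xi\rangle=\eta_Z^*\langle J(\eta_Z(z)),\xi\rangle$ for all $\eta\in\mathcal G$, $\xi\in\mathfrak g$, $z\in Z$; and, for all $\xi\in\mathfrak g_\tau$ and all $\eta\in\mathcal G_\tau$ such that $\eta_\tau$ preserves the orientation of $\Sigma$, $\langle J_\tau(\sigma),\mathrm{Ad}_{\eta^{-1}}\xi\rangle=\langle J_\tau(\eta_{\mathcal Z_\tau}(\sigma)),\xi\rangle$ for $\sigma\in\mathcal Z_\tau$, and $\langle\mathcal J_\tau(p),\mathrm{Ad}_{\eta^{-1}}\xi\rangle=\langle\mathcal J_\tau(\eta_{T^*\mathcal Y_\tau}(p)),\xi\rangle$ for $p\in T^*\mathcal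 Y_\tau$. -/

import Mathlib

open Set Filter Topology Manifold Bundle
open scoped ContDiff

set_option linter.unusedSectionVars false

namespace FieldTheory

noncomputable section

section AlternatingBundle

variable {E : Type*} [NormedAddCommGroup E] [NormedSpace ℝ E]
  {E' : Type*} [NormedAddCommGroup E'] [NormedSpace ℝ E']

/-- A continuous linear left inverse of the inclusion of alternating maps in multilinear maps. -/
def altProj (E : Type*) [NormedAddCommGroup E] [NormedSpace ℝ E] (k : ℕ) :
    ContinuousMultilinearMap ℝ (fun _ : Fin k => E) ℝ →L[ℝ] (E [⋀^Fin k]→L[ℝ] ℝ) :=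
  ((k.factorial : ℝ)⁻¹) • LinearMap.mkContinuous
    { toFun := fun f => ContinuousMultilinearMap.alternatization f
      map_add' := fun f g => map_add _ f g
      map_smul' := fun c f => by
        ext v
        simp [ContinuousMultilinearMap.alternatization_apply_apply, Finset.mul_sum,
          mul_left_comm, Units.smul_def] }
    (k.factorial : ℝ) (fun f => by
      refine ContinuousAlternatingMap.opNorm_le_bound _ (by positivity) fun v => ?_
      simp only [LinearMap.coe_mk, AddHom.coe_mk,
        ContinuousMultilinearMap.alternatization_apply_apply]
      refine (norm_sum_le _ _).trans ?_
      refine (Finset.sum_le_card_nsmul _ _ (‖f‖ * ∏ i, ‖v i‖) fun σ _ => ?_).trans ?_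
      · have h1 : ‖Equiv.Perm.sign σ • f (v ∘ σ)‖ = ‖f (v ∘ σ)‖ := by
          rcases Int.units_eq_one_or (Equiv.Perm.sign σ) with h | h <;> simp [h]
        rw [h1]
        refine (f.le_opNorm _).trans_eq ?_
        congr 1
        exact Equiv.prod_comp σ (fun i => ‖v i‖)
      · simp [Fintype.card_perm, mul_assoc])

theorem altProj_apply (k : ℕ) (f : E [⋀^Fin k]→L[ℝ] ℝ) :
    altProj E k f.toContinuousMultilinearMap = f := by
  ext v
  have h : ∀ σ : Equiv.Perm (Fin k), Equiv.Perm.sign σ • f (v ∘ σ) = f v := fun σ => by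
    have := f.toAlternatingMap.map_perm v σ
    change f (v ∘ σ) = _ at this
    rw [this, smul_smul, Int.units_mul_self, one_smul]
    rfl
  have hk : (k.factorial : ℝ) ≠ 0 := by positivity
  change (k.factorial : ℝ)⁻¹ • (ContinuousMultilinearMap.alternatization
    f.toContinuousMultilinearMap) v = f v
  rw [ContinuousMultilinearMap.alternatization_apply_apply]
  change (k.factorial : ℝ)⁻¹ • (∑ σ : Equiv.Perm (Fin k), Equiv.Perm.sign σ • f (v ∘ σ)) = f v
  rw [Finset.sum_congr rfl (fun σ _ => h σ)]
  simp [Fintype.card_perm, hk]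

/-- Pull-back of alternating forms depends smoothly on the linear map. -/
theorem contDiff_compContinuousLinearMapCLM (k : ℕ) :
    ContDiff ℝ ∞ (ContinuousAlternatingMap.compContinuousLinearMapCLM :
      (E' →L[ℝ] E) → (E [⋀^Fin k]→L[ℝ] ℝ) →L[ℝ] (E' [⋀^Fin k]→L[ℝ] ℝ)) := by
  have h : (ContinuousAlternatingMap.compContinuousLinearMapCLM :
      (E' →L[ℝ] E) → (E [⋀^Fin k]→L[ℝ] ℝ) →L[ℝ] (E' [⋀^Fin k]→L[ℝ] ℝ)) =
      fun A => (altProj E' k).comp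
        ((ContinuousMultilinearMap.compContinuousLinearMapContinuousMultilinear ℝ
          (fun _ : Fin k => E') (fun _ => E) ℝ (fun _ => A)).comp
        (ContinuousAlternatingMap.toContinuousMultilinearMapCLM ℝ)) := by
    funext A
    ext1 f
    exact (altProj_apply k (f.compContinuousLinearMap A)).symm
  rw [h]
  refine contDiff_const.clm_comp (ContDiff.clm_comp ?_ contDiff_const)
  exact (ContinuousMultilinearMap.contDiff _).comp (contDiff_pi.2 fun _ => contDiff_id)

/-- Pull-back of alternating forms is jointly smooth in the form and the linear map. -/
theorem contDiff_compContinuousLinearMap (k : ℕ) :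
    ContDiff ℝ ∞ (fun q : (E [⋀^Fin k]→L[ℝ] ℝ) × (E' →L[ℝ] E) =>
      q.1.compContinuousLinearMap q.2) := by
  have h := ((contDiff_compContinuousLinearMapCLM (E := E) (E' := E') k).comp
    (contDiff_snd (E := E [⋀^Fin k]→L[ℝ] ℝ))).clm_apply contDiff_fst
  exact h

variable {H : Type*} [TopologicalSpace H] (I : ModelWithCorners ℝ E H)
  (M : Type*) [TopologicalSpace M] [ChartedSpace H M] [IsManifold I ∞ M] (k : ℕ)

/-- The vector bundle `Λᵏ T*M` of alternating `k`-forms on the tangent spaces of `M`. Its fibre at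
`x` is the space of alternating `k`-forms on `T_x M`. -/
def altCore : VectorBundleCore ℝ M (E [⋀^Fin k]→L[ℝ] ℝ) (atlas H M) where
  baseSet i := (tangentBundleCore I M).baseSet i
  isOpen_baseSet i := (tangentBundleCore I M).isOpen_baseSet i
  indexAt := (tangentBundleCore I M).indexAt
  mem_baseSet_at := (tangentBundleCore I M).mem_baseSet_at
  coordChange i j x := ContinuousAlternatingMap.compContinuousLinearMapCLM
    ((tangentBundleCore I M).coordChange j i x)
  coordChange_self i x hx f := by
    ext v
    change f _ = f v
    congr 1
    funext l
    exact (tangentBundleCore I M).coordChange_self i x hx (v l)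
  continuousOn_coordChange i j := by
    refine (contDiff_compContinuousLinearMapCLM k).continuous.comp_continuousOn ?_
    exact ((tangentBundleCore I M).continuousOn_coordChange j i).mono fun x hx => ⟨hx.2, hx.1⟩
  coordChange_comp i j l x hx f := by
    ext v
    change f _ = f _
    congr 1
    funext a
    exact (tangentBundleCore I M).coordChange_comp l j i x ⟨⟨hx.2, hx.1.2⟩, hx.1.1⟩ (v a)

instance : (altCore I M k).IsContMDiff I ∞ where
  contMDiffOn_coordChange i j := by
    have : IsManifold I (∞ + 1) M := by simpa using ‹IsManifold I ∞ M›
    have := tangentBundleCore.isContMDiff (I := I) (M := M) (n := ∞)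
    have h := (tangentBundleCore I M).contMDiffOn_coordChange (n := ∞) I j i
    have h2 := (contDiff_compContinuousLinearMapCLM (E := E) (E' := E) k).contMDiff
    exact h2.comp_contMDiffOn (h.mono fun x hx => ⟨hx.2, hx.1⟩)

/-- The total space of `Λᵏ T*M`: pairs `⟨x, α⟩` with `α` an alternating `k`-form on `T_x M`. It is
a smooth manifold, modelled on `I.prod 𝓘(ℝ, E [⋀^Fin k]→L[ℝ] ℝ)`. -/
abbrev Lam : Type _ := TotalSpace (E [⋀^Fin k]→L[ℝ] ℝ) (altCore I M k).Fiber

/-- The model with corners of the manifold `Λᵏ T*M`. -/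
abbrev lamModel : ModelWithCorners ℝ (E × (E [⋀^Fin k]→L[ℝ] ℝ))
    (ModelProd H (E [⋀^Fin k]→L[ℝ] ℝ)) :=
  I.prod 𝓘(ℝ, E [⋀^Fin k]→L[ℝ] ℝ)

variable {I M k}

/-- The alternating form on `T_x M` carried by a point of `Λᵏ T*M` over `x`. -/
def Lam.form (z : Lam I M k) : TangentSpace I z.proj [⋀^Fin k]→L[ℝ] ℝ := z.2

/-- The point of `Λᵏ T*M` given by a form on a tangent space. -/
def Lam.mk (x : M) (α : TangentSpace I x [⋀^Fin k]→L[ℝ] ℝ) : Lam I M k := ⟨x, α⟩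

end AlternatingBundle

section FormCalculus

variable {E : Type*} [NormedAddCommGroup E] [NormedSpace ℝ E]
  {H : Type*} [TopologicalSpace H] {I : ModelWithCorners ℝ E H}
  {M : Type*} [TopologicalSpace M] [ChartedSpace H M] [IsManifold I ∞ M]
  {E' : Type*} [NormedAddCommGroup E'] [NormedSpace ℝ E']
  {H' : Type*} [TopologicalSpace H'] {I' : ModelWithCorners ℝ E' H'}
  {M' : Type*} [TopologicalSpace M'] [ChartedSpace H' M'] [IsManifold I' ∞ M']
  {EN : Type*} [NormedAddCommGroup EN] [NormedSpace ℝ EN]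
  {HN : Type*} [TopologicalSpace HN] {J : ModelWithCorners ℝ EN HN}
  {N : Type*} [TopologicalSpace N] [ChartedSpace HN N]
  {k : ℕ}

/-- The interior product `i_v α`. -/
def interior {x : M} (v : TangentSpace I x) (α : TangentSpace I x [⋀^Fin (k + 1)]→L[ℝ] ℝ) :
    TangentSpace I x [⋀^Fin k]→L[ℝ] ℝ :=
  ContinuousAlternatingMap.curryLeft (E := E) α v

/-- A family of `k`-forms on the tangent spaces of `M` (a differential `k`-form, not necessarily
smooth). -/
abbrev Form (I : ModelWithCorners ℝ E H) (M : Type*) [TopologicalSpace M] [ChartedSpace H M]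
    (k : ℕ) : Type _ :=
  ∀ x : M, TangentSpace I x [⋀^Fin k]→L[ℝ] ℝ

/-- Smoothness of a differential form: it is a smooth section of `Λᵏ T*M`. -/
def Form.IsSmooth (α : Form I M k) : Prop :=
  ContMDiff I (lamModel I k) ∞ (fun x => Lam.mk x (α x))

theorem contMDiffAt_lam {s : N → Lam I M k} {x₀ : N} :
    ContMDiffAt J (lamModel I k) ∞ s x₀ ↔
      ContMDiffAt J I ∞ (fun x => (s x).proj) x₀ ∧
      ContMDiffAt J 𝓘(ℝ, E [⋀^Fin k]→L[ℝ] ℝ) ∞ (fun x =>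
        ContinuousAlternatingMap.compContinuousLinearMap (M := E) (M' := E) (s x).form
          ((tangentBundleCore I M).coordChange (achart H (s x₀).proj) (achart H (s x).proj)
            (s x).proj)) x₀ :=
  contMDiffAt_totalSpace

theorem contMDiffAt_field {b : N → M} {V : ∀ x, TangentSpace I (b x)} {x₀ : N} :
    ContMDiffAt J I.tangent ∞ (fun x => (⟨b x, V x⟩ : TangentBundle I M)) x₀ ↔
      ContMDiffAt J I ∞ b x₀ ∧
      ContMDiffAt J 𝓘(ℝ, E) ∞ (fun x =>
        (tangentBundleCore I M).coordChange (achart H (b x)) (achart H (b x₀)) (b x) (V x)) x₀ :=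
  contMDiffAt_totalSpace

theorem eventually_mem_chart {b : N → M} {x₀ : N} (hb : ContinuousAt b x₀) :
    ∀ᶠ x in 𝓝 x₀, b x ∈ (chartAt H (b x₀)).source :=
  hb ((chartAt H (b x₀)).open_source.mem_nhds (mem_chart_source H (b x₀)))

/-- Pulling back a smooth family of forms along a smooth family of linear maps is smooth. -/
theorem contMDiffAt_pullForm {s : N → Lam I M k} {b' : N → M'} {x₀ : N}
    {A : ∀ x, TangentSpace I' (b' x) →L[ℝ] TangentSpace I (s x).proj}
    (hs : ContMDiffAt J (lamModel I k) ∞ s x₀) (hb' : ContMDiffAt J I' ∞ b' x₀)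
    (hA : ContMDiffAt J 𝓘(ℝ, E' →L[ℝ] E) ∞
      (inTangentCoordinates I' I b' (fun x => (s x).proj) A x₀) x₀) :
    ContMDiffAt J (lamModel I' k) ∞
      (fun x => Lam.mk (b' x) ((s x).form.compContinuousLinearMap (A x))) x₀ := by
  rw [contMDiffAt_lam] at hs ⊢
  refine ⟨hb', ?_⟩
  have h := (contDiff_compContinuousLinearMap (E := E) (E' := E') k).contMDiff.contMDiffAt.comp x₀
    (hs.2.prodMk_space hA)
  refine h.congr_of_eventuallyEq ?_
  filter_upwards [eventually_mem_chart (H := H) hs.1.continuousAt,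
    eventually_mem_chart (H := H') hb'.continuousAt]
    with x h1 h2
  ext v
  change (s x).form _ = (s x).form _
  congr 1
  funext a
  have h3 := DFunLike.congr_fun (inTangentCoordinates_eq (I := I') (I' := I) b'
    (fun x => (s x).proj) A h2 h1) (v a)
  have h4 := (tangentBundleCore I M).coordChange_comp (achart H (s x).proj) (achart H (s x₀).proj)
    (achart H (s x).proj) (s x).proj ⟨⟨mem_chart_source H _, h1⟩, mem_chart_source H _⟩
    (A x ((tangentBundleCore I' M').coordChange (achart H' (b' x₀)) (achart H' (b' x)) (b' x) (v a)))
  have h5 := (tangentBundleCore I M).coordChange_self (achart H (s x).proj) (s x).proj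
    (mem_chart_source H _)
    (A x ((tangentBundleCore I' M').coordChange (achart H' (b' x₀)) (achart H' (b' x)) (b' x) (v a)))
  change A x _ = (tangentBundleCore I M).coordChange _ _ _
    (inTangentCoordinates I' I b' (fun x => (s x).proj) A x₀ x (v a))
  exact ((congrArg _ h3).trans (h4.trans h5)).symm

/-- Interior products of smooth families of forms with smooth families of vectors are smooth. -/
theorem contMDiffAt_interior {s : N → Lam I M (k + 1)} {V : ∀ x, TangentSpace I (s x).proj} {x₀ : N}
    (hs : ContMDiffAt J (lamModel I (k + 1)) ∞ s x₀)
    (hV : ContMDiffAt J I.tangent ∞ (fun x => (⟨(s x).proj, V x⟩ : TangentBundle I M)) x₀) :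
    ContMDiffAt J (lamModel I k) ∞
      (fun x => Lam.mk (s x).proj (interior (V x) (s x).form)) x₀ := by
  rw [contMDiffAt_lam] at hs ⊢
  rw [contMDiffAt_field] at hV
  refine ⟨hs.1, ?_⟩
  have hL : ContDiff ℝ ∞ (ContinuousAlternatingMap.curryLeftLI (𝕜 := ℝ) (E := E) (F := ℝ)
    (n := k)) := by
    exact LinearIsometry.contDiff _
  have h1 := hL.contMDiff.contMDiffAt.comp x₀ hs.2
  have h := h1.clm_apply hV.2
  refine h.congr_of_eventuallyEq ?_
  filter_upwards [eventually_mem_chart (H := H) hs.1.continuousAt] with x h1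
  ext v
  change (s x).form _ = (s x).form _
  congr 1
  funext a
  refine Fin.cases ?_ (fun a => ?_) a
  · have h4 := (tangentBundleCore I M).coordChange_comp (achart H (s x).proj)
      (achart H (s x₀).proj) (achart H (s x).proj) (s x).proj
      ⟨⟨mem_chart_source H _, h1⟩, mem_chart_source H _⟩ (V x)
    have h5 := (tangentBundleCore I M).coordChange_self (achart H (s x).proj) (s x).proj
      (mem_chart_source H _) (V x)
    exact (h4.trans h5).symm
  · rfl

end FormCalculus

section SmoothGroups

open Diffeology

/-- A diffeological group: a group with a diffeology for which multiplication and inversion are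
smooth. Finite- and infinite-dimensional Lie groups are diffeological groups (the plots being the
smooth maps from `ℝᵏ`), as are groups of diffeomorphisms and their subgroups. -/
class DiffeologicalGroup (G : Type*) [Group G] [DiffeologicalSpace G] : Prop where
  mul : ∀ {k : ℕ} {p q : EuclideanSpace ℝ (Fin k) → G}, IsPlot p → IsPlot q →
    IsPlot (fun u => p u * q u)
  inv : ∀ {k : ℕ} {p : EuclideanSpace ℝ (Fin k) → G}, IsPlot p → IsPlot (fun u => (p u)⁻¹)

variable (G : Type*) [Group G] [DiffeologicalSpace G]
  {G' : Type*} [Group G'] [DiffeologicalSpace G']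

/-- The plots `ℝᵏ → G` centred at the identity. -/
def PlotAtOne (k : ℕ) : Type _ :=
  {p : EuclideanSpace ℝ (Fin k) → G // IsPlot p ∧ p 0 = 1}

/-- Generators of the tangent space at the identity: a plot `p` centred at the identity and a
vector `v`, representing the velocity `Dp(0) v`. -/
abbrev VelocityGen : Type _ := Σ k : ℕ, PlotAtOne G k × EuclideanSpace ℝ (Fin k)

variable {G}

/-- A plot centred at the identity reparametrised by a smooth map fixing the origin. -/
def PlotAtOne.reparam {k l : ℕ} (p : PlotAtOne G k)
    (f : EuclideanSpace ℝ (Fin l) → EuclideanSpace ℝ (Fin k)) (hf : ContDiff ℝ ∞ f)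
    (hf0 : f 0 = 0) : PlotAtOne G l :=
  ⟨p.1 ∘ f, isPlot_reparam p.2.1 hf, by simp [hf0, p.2.2]⟩

variable (G)

/-- The relations between velocities: linearity in the vector, and the chain rule
`D(p ∘ f)(0) v = Dp(0) (Df(0) v)`. -/
inductive VelocityRel : (VelocityGen G →₀ ℝ) → Prop
  | add {k : ℕ} (p : PlotAtOne G k) (v w : EuclideanSpace ℝ (Fin k)) :
      VelocityRel (Finsupp.single ⟨k, p, v + w⟩ 1 - Finsupp.single ⟨k, p, v⟩ 1 -
        Finsupp.single ⟨k, p, w⟩ 1)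
  | smul {k : ℕ} (p : PlotAtOne G k) (a : ℝ) (v : EuclideanSpace ℝ (Fin k)) :
      VelocityRel (Finsupp.single ⟨k, p, a • v⟩ 1 - Finsupp.single ⟨k, p, v⟩ a)
  | reparam {k l : ℕ} (p : PlotAtOne G k)
      (f : EuclideanSpace ℝ (Fin l) → EuclideanSpace ℝ (Fin k)) (hf : ContDiff ℝ ∞ f)
      (hf0 : f 0 = 0) (v : EuclideanSpace ℝ (Fin l)) :
      VelocityRel (Finsupp.single ⟨l, p.reparam f hf hf0, v⟩ 1 -
        Finsupp.single ⟨k, p, fderiv ℝ f 0 v⟩ 1)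

/-- The (vector space underlying the) Lie algebra `𝔤 = T₁G`: the tangent space of the diffeological
group `G` at the identity, that is, the colimit of the vector spaces `T₀ℝᵏ` over all plots
`ℝᵏ → G` centred at the identity. For a Lie group it is the usual tangent space. -/
abbrev LieAlg : Type _ :=
  (VelocityGen G →₀ ℝ) ⧸ Submodule.span ℝ {r : VelocityGen G →₀ ℝ | VelocityRel G r}

variable {G}

/-- The velocity `Dp(0) v ∈ T₁G` of a plot centred at the identity. -/
def LieAlg.mk {k : ℕ} (p : PlotAtOne G k) (v : EuclideanSpace ℝ (Fin k)) : LieAlg G :=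
  Submodule.Quotient.mk (Finsupp.single ⟨k, p, v⟩ 1)

/-- Linear maps out of `T₁G` are given by values on velocities that respect the relations. -/
def LieAlg.lift {W : Type*} [AddCommGroup W] [Module ℝ W]
    (f : ∀ k : ℕ, PlotAtOne G k → EuclideanSpace ℝ (Fin k) → W)
    (hadd : ∀ k p v w, f k p (v + w) = f k p v + f k p w)
    (hsmul : ∀ k p (a : ℝ) v, f k p (a • v) = a • f k p v)
    (hrep : ∀ k l (p : PlotAtOne G k) (g : EuclideanSpace ℝ (Fin l) → EuclideanSpace ℝ (Fin k))
      (hg : ContDiff ℝ ∞ g) (hg0 : g 0 = 0) v,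
      f l (p.reparam g hg hg0) v = f k p (fderiv ℝ g 0 v)) : LieAlg G →ₗ[ℝ] W :=
  Submodule.liftQ _ (Finsupp.linearCombination ℝ fun q : VelocityGen G => f q.1 q.2.1 q.2.2) <| by
    rw [Submodule.span_le]
    rintro r (⟨p, v, w⟩ | ⟨p, a, v⟩ | ⟨p, g, hg, hg0, v⟩)
    · simp [hadd]
    · simp [hsmul]
    · simp [hrep]

theorem LieAlg.lift_mk {W : Type*} [AddCommGroup W] [Module ℝ W]
    (f : ∀ k : ℕ, PlotAtOne G k → EuclideanSpace ℝ (Fin k) → W) (hadd hsmul hrep)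
    {k : ℕ} (p : PlotAtOne G k) (v : EuclideanSpace ℝ (Fin k)) :
    LieAlg.lift f hadd hsmul hrep (LieAlg.mk p v) = f k p v := by
  simp [LieAlg.lift, LieAlg.mk]

theorem LieAlg.hom_ext {W : Type*} [AddCommGroup W] [Module ℝ W] {f g : LieAlg G →ₗ[ℝ] W}
    (h : ∀ k (p : PlotAtOne G k) v, f (LieAlg.mk p v) = g (LieAlg.mk p v)) : f = g := by
  refine Submodule.linearMap_qext _ (Finsupp.lhom_ext' fun q => LinearMap.ext_ring ?_)
  exact h q.1 q.2.1 q.2.2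

theorem LieAlg.mk_add {k : ℕ} (p : PlotAtOne G k) (v w : EuclideanSpace ℝ (Fin k)) :
    LieAlg.mk p (v + w) = LieAlg.mk p v + LieAlg.mk p w := by
  have h := (Submodule.Quotient.mk_eq_zero _).2 (Submodule.subset_span (R := ℝ)
    (show _ ∈ {r | VelocityRel G r} from VelocityRel.add p v w))
  rw [Submodule.Quotient.mk_sub, Submodule.Quotient.mk_sub, sub_sub, sub_eq_zero] at h
  exact h

theorem LieAlg.mk_smul {k : ℕ} (p : PlotAtOne G k) (a : ℝ) (v : EuclideanSpace ℝ (Fin k)) :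
    LieAlg.mk p (a • v) = a • LieAlg.mk p v := by
  have h := (Submodule.Quotient.eq _).2 (Submodule.subset_span (R := ℝ)
    (show _ ∈ {r | VelocityRel G r} from VelocityRel.smul p a v))
  refine h.trans ?_
  rw [LieAlg.mk, ← Submodule.Quotient.mk_smul, Finsupp.smul_single, smul_eq_mul, mul_one]

/-- A smooth homomorphism maps plots centred at the identity to such plots. -/
def PlotAtOne.map (φ : G →* G') (hφ : DSmooth φ) {k : ℕ} (p : PlotAtOne G k) : PlotAtOne G' k :=
  ⟨φ ∘ p.1, hφ _ _ p.2.1, by simp [p.2.2]⟩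

/-- The tangent map `T₁φ : T₁G → T₁G'` of a smooth homomorphism. -/
def LieAlg.map (φ : G →* G') (hφ : DSmooth φ) : LieAlg G →ₗ[ℝ] LieAlg G' :=
  LieAlg.lift (fun _ p v => LieAlg.mk (p.map φ hφ) v)
    (fun _ p v w => LieAlg.mk_add (p.map φ hφ) v w)
    (fun _ p a v => LieAlg.mk_smul (p.map φ hφ) a v)
    (fun _ _ p g hg hg0 v => (Submodule.Quotient.eq _).2 (Submodule.subset_span (R := ℝ)
        (show _ ∈ {r | VelocityRel G' r} from VelocityRel.reparam (p.map φ hφ) g hg hg0 v)))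

theorem LieAlg.map_mk (φ : G →* G') (hφ : DSmooth φ) {k : ℕ} (p : PlotAtOne G k)
    (v : EuclideanSpace ℝ (Fin k)) :
    LieAlg.map φ hφ (LieAlg.mk p v) = LieAlg.mk (p.map φ hφ) v := LieAlg.lift_mk ..

theorem LieAlg.map_id (h : DSmooth (MonoidHom.id G)) (ξ : LieAlg G) :
    LieAlg.map (MonoidHom.id G) h ξ = ξ := by
  have h1 : LieAlg.map (MonoidHom.id G) h = LinearMap.id :=
    LieAlg.hom_ext fun k p v => LieAlg.map_mk _ _ _ _
  rw [h1, LinearMap.id_apply]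

/-- The adjoint representation: `Ad_η` is the tangent map of the conjugation `γ ↦ η γ η⁻¹`. -/
def Ad [DiffeologicalGroup G] (η : G) : LieAlg G →ₗ[ℝ] LieAlg G :=
  LieAlg.map (MulAut.conj η).toMonoidHom fun _ _ hp =>
    DiffeologicalGroup.mul (DiffeologicalGroup.mul isPlot_const hp) isPlot_const

/-- The subspace diffeology on a subgroup: the plots are the plots of the group with values in the
subgroup. -/
instance subgroupDiffeology (K : Subgroup G) : DiffeologicalSpace K where
  plots k := {p | IsPlot (fun u => (p u : G))}
  constant_plots _ := isPlot_const
  plot_reparam hp hf := isPlot_reparam hp hf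
  locality {k p} hp := DiffeologicalSpace.locality fun x => by
    obtain ⟨u, hu, hxu, h⟩ := hp x
    exact ⟨u, hu, hxu, fun {m f} hfu hf => h hfu hf⟩

theorem dSmooth_subtype (K : Subgroup G) : DSmooth K.subtype := fun _ _ hp => hp

instance (K : Subgroup G) [DiffeologicalGroup G] : DiffeologicalGroup K where
  mul {_ p q} hp hq := DiffeologicalGroup.mul (p := fun u => (p u : G))
    (q := fun u => (q u : G)) hp hq
  inv {_ p} hp := DiffeologicalGroup.inv (p := fun u => (p u : G)) hp

end SmoothGroups

section SmoothActions

open Diffeology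

variable {G : Type*} [Group G] [DiffeologicalSpace G]
  {E : Type*} [NormedAddCommGroup E] [NormedSpace ℝ E]
  {H : Type*} [TopologicalSpace H] (I : ModelWithCorners ℝ E H)
  {M : Type*} [TopologicalSpace M] [ChartedSpace H M]
  {G' : Type*} [Group G'] [DiffeologicalSpace G']
  {E' : Type*} [NormedAddCommGroup E'] [NormedSpace ℝ E']
  {H' : Type*} [TopologicalSpace H'] {I' : ModelWithCorners ℝ E' H'}
  {M' : Type*} [TopologicalSpace M'] [ChartedSpace H' M']

/-- A smooth left action `(η, m) ↦ a η m` of a diffeological group on a manifold: an action such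
that `(u, m) ↦ a (p u) m` is smooth for every plot `p`. -/
structure IsSmoothAction (a : G → M → M) : Prop where
  one : ∀ m, a 1 m = m
  mul : ∀ η ζ m, a (η * ζ) m = a η (a ζ m)
  smooth : ∀ (k : ℕ) (p : EuclideanSpace ℝ (Fin k) → G), IsPlot p →
    ContMDiff ((𝓘(ℝ, EuclideanSpace ℝ (Fin k))).prod I) I ∞
      (fun q : EuclideanSpace ℝ (Fin k) × M => a (p q.1) q.2)

variable {I} {a : G → M → M} {a' : G' → M' → M'}

theorem IsSmoothAction.inv_left (h : IsSmoothAction I a) (η : G) (m : M) : a η⁻¹ (a η m) = m := by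
  rw [← h.mul, inv_mul_cancel, h.one]

theorem IsSmoothAction.inv_right (h : IsSmoothAction I a) (η : G) (m : M) : a η (a η⁻¹ m) = m := by
  rw [← h.mul, mul_inv_cancel, h.one]

theorem IsSmoothAction.contMDiff (h : IsSmoothAction I a) (η : G) : ContMDiff I I ∞ (a η) := by
  have h1 := h.smooth 0 (fun _ => η) isPlot_const
  exact h1.comp (contMDiff_const.prodMk contMDiff_id : ContMDiff I
    ((𝓘(ℝ, EuclideanSpace ℝ (Fin 0))).prod I) ∞ fun m => ((0 : EuclideanSpace ℝ (Fin 0)), m))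

theorem IsSmoothAction.contMDiff_orbit (h : IsSmoothAction I a) {k : ℕ}
    {p : EuclideanSpace ℝ (Fin k) → G} (hp : IsPlot p) (m : M) :
    ContMDiff 𝓘(ℝ, EuclideanSpace ℝ (Fin k)) I ∞ (fun u => a (p u) m) :=
  (h.smooth k p hp).comp (contMDiff_id.prodMk contMDiff_const)

/-- The restriction of a smooth action to a subgroup is smooth. -/
theorem IsSmoothAction.restrict (h : IsSmoothAction I a) (K : Subgroup G) :
    IsSmoothAction I (fun (η : K) m => a η m) :=
  ⟨h.one, fun η ζ m => h.mul η ζ m, fun k p hp => h.smooth k (fun u => (p u : G)) hp⟩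

/-- The infinitesimal generator of a smooth action: `ξ ↦ ξ_M(m)`, where for the velocity
`ξ = Dp(0) v` of a plot `p` centred at the identity, `ξ_M(m)` is the derivative at `0` of
`u ↦ p(u) · m` in the direction `v`. -/
def generator (h : IsSmoothAction I a) (m : M) : LieAlg G →ₗ[ℝ] TangentSpace I m :=
  LieAlg.lift
    (fun k p v => (mfderiv 𝓘(ℝ, EuclideanSpace ℝ (Fin k)) I (fun u => a (p.1 u) m) 0 v : E))
    (fun k p v w => map_add (mfderiv 𝓘(ℝ, EuclideanSpace ℝ (Fin k)) I (fun u => a (p.1 u) m) 0) v w)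
    (fun k p c v => map_smul (mfderiv 𝓘(ℝ, EuclideanSpace ℝ (Fin k)) I
      (fun u => a (p.1 u) m) 0) c v)
    (fun k l p g hg hg0 v => by
      have h1 : MDifferentiableAt 𝓘(ℝ, EuclideanSpace ℝ (Fin k)) I (fun u => a (p.1 u) m) (g 0) :=
        (h.contMDiff_orbit p.2.1 m).mdifferentiableAt (by simp)
      have h2 : MDifferentiableAt 𝓘(ℝ, EuclideanSpace ℝ (Fin l)) 𝓘(ℝ, EuclideanSpace ℝ (Fin k))
          g 0 := hg.contMDiff.mdifferentiableAt (by simp)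
      have h3 := mfderiv_comp_apply (0 : EuclideanSpace ℝ (Fin l)) h1 h2 v
      rw [mfderiv_eq_fderiv] at h3
      refine Eq.trans h3 ?_
      rw [hg0]
      rfl)

theorem generator_mk (h : IsSmoothAction I a) (m : M) {k : ℕ} (p : PlotAtOne G k)
    (v : EuclideanSpace ℝ (Fin k)) :
    generator h m (LieAlg.mk p v) =
      (mfderiv 𝓘(ℝ, EuclideanSpace ℝ (Fin k)) I (fun u => a (p.1 u) m) 0 v : E) :=
  LieAlg.lift_mk (W := E) ..

/-- Equivariant maps intertwine infinitesimal generators. -/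
theorem mfderiv_generator (h : IsSmoothAction I a) (h' : IsSmoothAction I' a') (φ : G →* G')
    (hφ : DSmooth φ) {f : M → M'} (hf : ∀ η m, f (a η m) = a' (φ η) (f m)) {m : M}
    (hfm : MDifferentiableAt I I' f m) (ξ : LieAlg G) :
    mfderiv I I' f m (generator h m ξ) = generator h' (f m) (LieAlg.map φ hφ ξ) := by
  suffices hs : (mfderiv I I' f m : TangentSpace I m →ₗ[ℝ] TangentSpace I' (f m)) ∘ₗ
      generator h m = generator h' (f m) ∘ₗ LieAlg.map φ hφ from DFunLike.congr_fun hs ξ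
  refine LieAlg.hom_ext fun k p v => ?_
  have h0 : a (p.1 0) m = m := by rw [p.2.2, h.one]
  have h1 : MDifferentiableAt 𝓘(ℝ, EuclideanSpace ℝ (Fin k)) I (fun u => a (p.1 u) m) 0 :=
    (h.contMDiff_orbit p.2.1 m).mdifferentiableAt (by simp)
  have h2 := mfderiv_comp_apply_of_eq (0 : EuclideanSpace ℝ (Fin k)) hfm h1 h0 v
  rw [LinearMap.comp_apply, LinearMap.comp_apply, LieAlg.map_mk, generator_mk, generator_mk]
  refine Eq.trans ?_ (h2.symm.trans ?_)
  · rw [h0]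
    rfl
  · have h3 : (f ∘ fun u => a (p.1 u) m) = fun u => a' ((p.map φ hφ).1 u) (f m) :=
      funext fun u => hf _ _
    rw [h3]

end SmoothActions

section LiftedActions

open Diffeology

variable {G : Type*} [Group G] [DiffeologicalSpace G]
  {E : Type*} [NormedAddCommGroup E] [NormedSpace ℝ E]
  {H : Type*} [TopologicalSpace H] {I : ModelWithCorners ℝ E H}
  {M : Type*} [TopologicalSpace M] [ChartedSpace H M] [IsManifold I ∞ M]
  {EN : Type*} [NormedAddCommGroup EN] [NormedSpace ℝ EN]
  {HN : Type*} [TopologicalSpace HN] {J : ModelWithCorners ℝ EN HN}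
  {N : Type*} [TopologicalSpace N] [ChartedSpace HN N]
  {a : G → M → M}

/-- Linear combinations of smooth vector fields along a map are smooth. -/
theorem contMDiff_field_add_smul {b : N → M} {V W : ∀ x, TangentSpace I (b x)} (c : ℝ)
    (hV : ContMDiff J I.tangent ∞ (fun x => (⟨b x, V x⟩ : TangentBundle I M)))
    (hW : ContMDiff J I.tangent ∞ (fun x => (⟨b x, W x⟩ : TangentBundle I M))) :
    ContMDiff J I.tangent ∞ (fun x => (⟨b x, c • V x + W x⟩ : TangentBundle I M)) := by
  intro x₀
  have h1 := contMDiffAt_field.1 (hV x₀)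
  have h2 := contMDiffAt_field.1 (hW x₀)
  refine contMDiffAt_field.2 ⟨h1.1, ?_⟩
  have h3 := ((contMDiffAt_const : ContMDiffAt J 𝓘(ℝ, ℝ) ∞ (fun _ : N => c) x₀).smul h1.2).add h2.2
  refine h3.congr_of_eventuallyEq (Eventually.of_forall fun x => ?_)
  exact (map_add _ _ _).trans (congrArg (· + _) (map_smul _ _ _))

variable [IsManifold J ∞ N]

/-- The infinitesimal generators of a smooth action are smooth vector fields. -/
theorem contMDiff_generator (h : IsSmoothAction I a) {b : N → M} (hb : ContMDiff J I ∞ b)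
    (ξ : LieAlg G) :
    ContMDiff J I.tangent ∞ (fun x => (⟨b x, generator h (b x) ξ⟩ : TangentBundle I M)) := by
  have hzero : ContMDiff J I.tangent ∞ (fun x => (⟨b x, 0⟩ : TangentBundle I M)) := by
    intro x₀
    refine contMDiffAt_field.2 ⟨hb x₀, ?_⟩
    refine (contMDiffAt_const (c := (0 : E))).congr_of_eventuallyEq
      (Eventually.of_forall fun x => map_zero _)
  have hmk : ∀ (k : ℕ) (p : PlotAtOne G k) (v : EuclideanSpace ℝ (Fin k)),
      ContMDiff J I.tangent ∞
        (fun x => (⟨b x, generator h (b x) (LieAlg.mk p v)⟩ : TangentBundle I M)) := by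
    intro k p v x₀
    refine contMDiffAt_field.2 ⟨hb x₀, ?_⟩
    have hp0 : ∀ m, a (p.1 0) m = m := fun m => by rw [p.2.2, h.one]
    have h1 : ContMDiffAt (J.prod 𝓘(ℝ, EuclideanSpace ℝ (Fin k))) I ∞
        (Function.uncurry fun (x : N) (u : EuclideanSpace ℝ (Fin k)) => a (p.1 u) (b x))
        (x₀, 0) :=
      ((h.smooth k p.1 p.2.1).comp (contMDiff_snd.prodMk (hb.comp contMDiff_fst))) _
    have h2 := ContMDiffAt.mfderiv (m := ∞) _ (fun _ => (0 : EuclideanSpace ℝ (Fin k))) h1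
      contMDiffAt_const (by simp)
    have h3 := h2.clm_apply (contMDiffAt_const (c := v))
    have e : (fun x => a (p.1 0) (b x)) = b := funext fun x => hp0 _
    replace h3 : ContMDiffAt J 𝓘(ℝ, E) ∞ (fun x => inTangentCoordinates
        𝓘(ℝ, EuclideanSpace ℝ (Fin k)) I (fun _ => (0 : EuclideanSpace ℝ (Fin k))) b
        (fun x => (mfderiv 𝓘(ℝ, EuclideanSpace ℝ (Fin k)) I (fun u => a (p.1 u) (b x)) 0 :
          EuclideanSpace ℝ (Fin k) →L[ℝ] E)) x₀ x v) x₀ :=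
      Eq.mp (congrArg (fun g => ContMDiffAt J 𝓘(ℝ, E) ∞ (fun x => inTangentCoordinates
        𝓘(ℝ, EuclideanSpace ℝ (Fin k)) I (fun _ => (0 : EuclideanSpace ℝ (Fin k))) g
        (fun x => (mfderiv 𝓘(ℝ, EuclideanSpace ℝ (Fin k)) I (fun u => a (p.1 u) (b x)) 0 :
          EuclideanSpace ℝ (Fin k) →L[ℝ] E)) x₀ x v) x₀) e) h3
    refine h3.congr_of_eventuallyEq ?_
    filter_upwards [eventually_mem_chart (H := H) (hb x₀).continuousAt] with x hx
    have h4 := DFunLike.congr_fun (inTangentCoordinates_eq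
      (I := 𝓘(ℝ, EuclideanSpace ℝ (Fin k))) (I' := I)
      (fun _ : N => (0 : EuclideanSpace ℝ (Fin k))) b
      (fun x => (mfderiv 𝓘(ℝ, EuclideanSpace ℝ (Fin k)) I (fun u => a (p.1 u) (b x)) 0 :
          EuclideanSpace ℝ (Fin k) →L[ℝ] E)) (x₀ := x₀) (mem_chart_source _ _) hx) v
    have h5 := (tangentBundleCore 𝓘(ℝ, EuclideanSpace ℝ (Fin k))
      (EuclideanSpace ℝ (Fin k))).coordChange_self (achart _ (0 : EuclideanSpace ℝ (Fin k))) 0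
      (mem_chart_source _ _) v
    have h6 := congrArg (fun w => (tangentBundleCore I M).coordChange (achart H (b x))
      (achart H (b x₀)) (b x) ((mfderiv 𝓘(ℝ, EuclideanSpace ℝ (Fin k)) I
        (fun u => a (p.1 u) (b x)) 0 : EuclideanSpace ℝ (Fin k) →L[ℝ] E) w)) h5
    have h7 := congrArg (fun w : E => (tangentBundleCore I M).coordChange (achart H (b x))
      (achart H (b x₀)) (b x) w) (generator_mk h (b x) p v)
    exact h7.trans (h6.symm.trans h4.symm)
  obtain ⟨l, rfl⟩ := Submodule.Quotient.mk_surjective _ ξ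
  induction l using Finsupp.induction_linear with
  | zero => simpa using hzero
  | add f g hf hg =>
    have := contMDiff_field_add_smul 1 hf hg
    simpa using this
  | single q c =>
    have h1 := contMDiff_field_add_smul c (hmk q.1 q.2.1 q.2.2) hzero
    have h2 : (Submodule.Quotient.mk (Finsupp.single q c) : LieAlg G) =
        c • LieAlg.mk q.2.1 q.2.2 := by
      rw [LieAlg.mk, ← Submodule.Quotient.mk_smul, Finsupp.smul_single, smul_eq_mul, mul_one]
    simpa [h2] using h1

theorem Lam.ext' {k : ℕ} {z w : Lam I M k} (h : z.proj = w.proj)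
    (h' : (z.form : E [⋀^Fin k]→L[ℝ] ℝ) = w.form) : z = w := by
  obtain ⟨x, α⟩ := z
  obtain ⟨y, β⟩ := w
  obtain rfl : x = y := h
  exact congrArg (TotalSpace.mk x) h'

/-- The canonical lift of an action on `M` to the bundle `Λᵏ T*M`, by push-forward of forms:
`η · α = (η⁻¹)^* α`. -/
def liftAction (I : ModelWithCorners ℝ E H) [IsManifold I ∞ M] (k : ℕ) (a : G → M → M) (η : G)
    (z : Lam I M k) : Lam I M k :=
  Lam.mk (a η z.proj) (ContinuousAlternatingMap.compContinuousLinearMap (M := E) (M' := E) z.form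
    (mfderiv I I (a η⁻¹) (a η z.proj)))

/-- The lift of a smooth action to `Λᵏ T*M` is a smooth action. -/
theorem IsSmoothAction.lift [DiffeologicalGroup G] (h : IsSmoothAction I a) (k : ℕ) :
    IsSmoothAction (lamModel I k) (liftAction I k a) where
  one z := by
    refine Lam.ext' (h.one _) ?_
    have h1 : a (1 : G)⁻¹ = id := funext fun m => by rw [inv_one, h.one]; rfl
    have h2 : (mfderiv I I (a (1 : G)⁻¹) (a 1 z.proj) : E →L[ℝ] E) =
        ContinuousLinearMap.id ℝ E := by
      rw [h1]
      exact mfderiv_id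
    exact (congrArg (ContinuousAlternatingMap.compContinuousLinearMap (M := E) (M' := E) z.form)
      h2).trans (by ext; rfl)
  mul η ζ z := by
    refine Lam.ext' (h.mul _ _ _) ?_
    have h1 : a (η * ζ)⁻¹ = a ζ⁻¹ ∘ a η⁻¹ := funext fun m => by
      rw [mul_inv_rev, h.mul]; rfl
    have h2 := mfderiv_comp_of_eq (x := a η (a ζ z.proj)) (y := a ζ z.proj)
      ((h.contMDiff ζ⁻¹).mdifferentiableAt (by simp))
      ((h.contMDiff η⁻¹).mdifferentiableAt (by simp)) (h.inv_left η _)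
    have h3 : (mfderiv I I (a (η * ζ)⁻¹) (a (η * ζ) z.proj) : E →L[ℝ] E) =
        (mfderiv I I (a ζ⁻¹) (a ζ z.proj) : E →L[ℝ] E).comp
          (mfderiv I I (a η⁻¹) (a η (a ζ z.proj)) : E →L[ℝ] E) := by
      rw [h1, h.mul]
      refine h2.trans ?_
      rw [h.inv_left]
    exact (congrArg (ContinuousAlternatingMap.compContinuousLinearMap (M := E) (M' := E) z.form)
      h3).trans (by ext; rfl)
  smooth l p hp := by
    intro q₀
    have hinv : IsPlot (fun u => (p u)⁻¹) := DiffeologicalGroup.inv hp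
    have hs : ContMDiff (𝓘(ℝ, EuclideanSpace ℝ (Fin l)).prod (lamModel I k)) (lamModel I k) ∞
        (fun q : EuclideanSpace ℝ (Fin l) × Lam I M k => q.2) := contMDiff_snd
    have hpr : ContMDiff (𝓘(ℝ, EuclideanSpace ℝ (Fin l)).prod (lamModel I k)) I ∞
        (fun q : EuclideanSpace ℝ (Fin l) × Lam I M k => q.2.proj) :=
      (contMDiff_proj _).comp hs
    have hb : ContMDiff (𝓘(ℝ, EuclideanSpace ℝ (Fin l)).prod (lamModel I k)) I ∞
        (fun q : EuclideanSpace ℝ (Fin l) × Lam I M k => a (p q.1) q.2.proj) :=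
      (h.smooth l p hp).comp (contMDiff_fst.prodMk hpr)
    have h1 : ContMDiffAt ((𝓘(ℝ, EuclideanSpace ℝ (Fin l)).prod (lamModel I k)).prod I) I ∞
        (Function.uncurry fun (q : EuclideanSpace ℝ (Fin l) × Lam I M k) (m : M) =>
          a (p q.1)⁻¹ m) (q₀, a (p q₀.1) q₀.2.proj) :=
      ((h.smooth l _ hinv).comp ((contMDiff_fst.comp contMDiff_fst).prodMk contMDiff_snd)) _
    have h2 := ContMDiffAt.mfderiv (m := ∞) _ (fun q : EuclideanSpace ℝ (Fin l) × Lam I M k =>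
      a (p q.1) q.2.proj) h1 (hb q₀) (by simp)
    have e : (fun q : EuclideanSpace ℝ (Fin l) × Lam I M k =>
        a (p q.1)⁻¹ (a (p q.1) q.2.proj)) = fun q => q.2.proj := funext fun q => h.inv_left _ _
    have h3 := Eq.mp (congrArg (fun g => ContMDiffAt (𝓘(ℝ, EuclideanSpace ℝ (Fin l)).prod
      (lamModel I k)) 𝓘(ℝ, E →L[ℝ] E) ∞ (inTangentCoordinates I I
        (fun q : EuclideanSpace ℝ (Fin l) × Lam I M k => a (p q.1) q.2.proj) g
        (fun q => (mfderiv I I (a (p q.1)⁻¹) (a (p q.1) q.2.proj) : E →L[ℝ] E)) q₀) q₀) e) h2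
    exact contMDiffAt_pullForm (hs q₀) (hb q₀) h3

end LiftedActions

section Integration

variable {n : ℕ} {S : Type*} [TopologicalSpace S] [ChartedSpace (EuclideanSpace ℝ (Fin n)) S]

/-- `S` is oriented: it is given by an oriented atlas, all of whose transition maps have positive
Jacobian determinant. -/
class OrientedAtlas (n : ℕ) (S : Type*) [TopologicalSpace S]
    [ChartedSpace (EuclideanSpace ℝ (Fin n)) S] : Prop where
  det_pos : ∀ e ∈ atlas (EuclideanSpace ℝ (Fin n)) S, ∀ e' ∈ atlas (EuclideanSpace ℝ (Fin n)) S,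
    ∀ x ∈ e.source ∩ e'.source, 0 < (fderiv ℝ (e' ∘ e.symm) (e x)).det

/-- A smooth self-map of an oriented manifold preserves the orientation: its differentials,
expressed in the (oriented) preferred charts, have positive determinant. -/
def OrientationPreserving (n : ℕ) {S : Type*} [TopologicalSpace S]
    [ChartedSpace (EuclideanSpace ℝ (Fin n)) S] (f : S → S) : Prop :=
  ∀ x, 0 < (mfderiv (𝓡 n) (𝓡 n) f x :
    EuclideanSpace ℝ (Fin n) →L[ℝ] EuclideanSpace ℝ (Fin n)).det

/-- The pull-back at `x` of a form at `f x`. -/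
def pullback {E : Type*} [NormedAddCommGroup E] [NormedSpace ℝ E]
    {H : Type*} [TopologicalSpace H] {I : ModelWithCorners ℝ E H}
    {M : Type*} [TopologicalSpace M] [ChartedSpace H M]
    {E' : Type*} [NormedAddCommGroup E'] [NormedSpace ℝ E']
    {H' : Type*} [TopologicalSpace H'] {I' : ModelWithCorners ℝ E' H'}
    {M' : Type*} [TopologicalSpace M'] [ChartedSpace H' M'] {k : ℕ}
    (f : M → M') (x : M) (α : TangentSpace I' (f x) [⋀^Fin k]→L[ℝ] ℝ) :
    TangentSpace I x [⋀^Fin k]→L[ℝ] ℝ :=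
  α.compContinuousLinearMap (mfderiv I I' f x)

variable [IsManifold (𝓡 n) ∞ S] [CompactSpace S] [T2Space S]

/-- A smooth partition of unity subordinate to the domains of the preferred charts. -/
def chartPartition (n : ℕ) (S : Type*) [TopologicalSpace S]
    [ChartedSpace (EuclideanSpace ℝ (Fin n)) S] [IsManifold (𝓡 n) ∞ S] [CompactSpace S]
    [T2Space S] : SmoothPartitionOfUnity S (𝓡 n) S univ :=
  Classical.choose (SmoothPartitionOfUnity.exists_isSubordinate_chartAt_source (𝓡 n) S)

/-- The integral `∫_S α` of an `n`-form over a compact oriented `n`-manifold: the sum over the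
charts of the Lebesgue integrals of the coefficients of `ρᵢ α`, for `ρ` a smooth partition of unity
subordinate to the charts (which are oriented). -/
def formIntegral (α : Form (𝓡 n) S n) : ℝ :=
  ∑ᶠ i : S, ∫ y in (extChartAt (𝓡 n) i).target,
    chartPartition n S i ((extChartAt (𝓡 n) i).symm y) *
      pullback (I := 𝓡 n) (extChartAt (𝓡 n) i).symm y (α ((extChartAt (𝓡 n) i).symm y))
        (fun j => EuclideanSpace.single j (1 : ℝ))

end Integration

/-- The data of a field theory on which a group acts by an action lifted from the configuration
bundle, together with a Cauchy surface: a smooth fibre bundle `proj : Y → X` with typical fibre `F`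
over an `(n + 1)`-dimensional manifold, an embedding `τ` of the `n`-manifold `S` in `X`, and smooth
actions of a diffeological group `G` on `X` and `Y`, the latter by bundle automorphisms covering the
former. -/
structure LiftedTheory (n m d : ℕ) (S X Y F G : Type*)
    [TopologicalSpace S] [ChartedSpace (EuclideanSpace ℝ (Fin n)) S]
    [TopologicalSpace X] [ChartedSpace (EuclideanSpace ℝ (Fin (n + 1))) X]
    [TopologicalSpace Y] [ChartedSpace (EuclideanSpace ℝ (Fin m)) Y]
    [TopologicalSpace F] [ChartedSpace (EuclideanSpace ℝ (Fin d)) F]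
    [Group G] [DiffeologicalSpace G] where
  /-- The projection `π_{XY}`. -/
  proj : Y → X
  contMDiff_proj : ContMDiff (𝓡 m) (𝓡 (n + 1)) ∞ proj
  locally_trivial : ∀ x : X, ∃ e : Trivialization F proj, x ∈ e.baseSet ∧
    ContMDiffOn (𝓡 m) ((𝓡 (n + 1)).prod (𝓡 d)) ∞ e e.source ∧
    ContMDiffOn ((𝓡 (n + 1)).prod (𝓡 d)) (𝓡 m) ∞ e.toOpenPartialHomeomorph.symm e.target
  /-- The embedding of the model Cauchy surface `S`. -/
  τ : S → X
  isSmoothEmbedding : IsSmoothEmbedding (𝓡 n) (𝓡 (n + 1)) ∞ τ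
  /-- The action `η ↦ η_X`. -/
  actX : G → X → X
  isSmoothAction_actX : IsSmoothAction (𝓡 (n + 1)) actX
  /-- The action `η ↦ η_Y`. -/
  actY : G → Y → Y
  isSmoothAction_actY : IsSmoothAction (𝓡 m) actY
  proj_actY : ∀ η y, proj (actY η y) = actX η (proj y)

namespace LiftedTheory

variable {n m d : ℕ} {S X Y F G : Type*}
  [TopologicalSpace S] [ChartedSpace (EuclideanSpace ℝ (Fin n)) S]
  [TopologicalSpace X] [ChartedSpace (EuclideanSpace ℝ (Fin (n + 1))) X]
  [TopologicalSpace Y] [ChartedSpace (EuclideanSpace ℝ (Fin m)) Y]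
  [TopologicalSpace F] [ChartedSpace (EuclideanSpace ℝ (Fin d)) F]
  [Group G] [DiffeologicalSpace G]
  (D : LiftedTheory n m d S X Y F G)

/-! ### The subgroup stabilising the Cauchy surface -/

/-- The subgroup `𝒢_τ` of the transformations that stabilise the image of `τ`. -/
def stab : Subgroup G where
  carrier := {η | D.actX η '' range D.τ = range D.τ}
  one_mem' := by
    have h : D.actX 1 = id := funext D.isSmoothAction_actX.one
    simp [h]
  mul_mem' {η ζ} hη hζ := by
    have h : D.actX (η * ζ) = D.actX η ∘ D.actX ζ := funext (D.isSmoothAction_actX.mul η ζ)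
    change _ = _ at hη hζ
    change _ = _
    rw [h, image_comp, hζ, hη]
  inv_mem' {η} hη := by
    change _ = _ at hη
    change _ = _
    conv_lhs => rw [← hη]
    rw [← image_comp]
    have h : D.actX η⁻¹ ∘ D.actX η = id := funext (D.isSmoothAction_actX.inv_left η)
    rw [h, image_id]

theorem exists_actS (η : D.stab) (x : S) : ∃ x', D.τ x' = D.actX η (D.τ x) := by
  have h : D.actX η '' range D.τ = range D.τ := η.2
  have h2 : D.actX η (D.τ x) ∈ D.actX η '' range D.τ := mem_image_of_mem _ (mem_range_self x)
  rw [h] at h2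
  exact h2

/-- The diffeomorphism `η_τ` of the Cauchy surface induced by `η ∈ 𝒢_τ`, as a map of the model
surface `S`: it is the restriction of `η_X`, that is, `τ (η_τ x) = η_X (τ x)`. -/
def actS (η : D.stab) (x : S) : S := Classical.choose (D.exists_actS η x)

theorem τ_actS (η : D.stab) (x : S) : D.τ (D.actS η x) = D.actX η (D.τ x) :=
  Classical.choose_spec (D.exists_actS η x)

variable [IsManifold (𝓡 n) ∞ S] [IsManifold (𝓡 (n + 1)) ∞ X] [IsManifold (𝓡 m) ∞ Y]

theorem isSmoothAction_actS : IsSmoothAction (𝓡 n) D.actS where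
  one x := D.isSmoothEmbedding.isEmbedding.injective <| by
    rw [D.τ_actS]
    exact D.isSmoothAction_actX.one _
  mul η ζ x := D.isSmoothEmbedding.isEmbedding.injective <| by
    rw [D.τ_actS, D.τ_actS, D.τ_actS]
    exact D.isSmoothAction_actX.mul _ _ _
  smooth k p hp := by
    have h : ContMDiff (𝓘(ℝ, EuclideanSpace ℝ (Fin k)).prod (𝓡 n)) (𝓡 (n + 1)) ∞
        (fun q : EuclideanSpace ℝ (Fin k) × S => D.τ (D.actS (p q.1) q.2)) := by
      simp_rw [D.τ_actS]
      exact (D.isSmoothAction_actX.smooth k (fun u => (p u : G)) hp).comp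
        (contMDiff_fst.prodMk (D.isSmoothEmbedding.contMDiff.comp contMDiff_snd))
    have hc : Continuous (fun q : EuclideanSpace ℝ (Fin k) × S => D.actS (p q.1) q.2) :=
      D.isSmoothEmbedding.isEmbedding.continuous_iff.2 h.continuous
    intro q
    obtain ⟨F', _, _, hF⟩ := D.isSmoothEmbedding.isImmersion
    exact (ContMDiffAt.iff_comp_isImmersionAtOfComplement (hF _)).2 ⟨hc.continuousAt, h q⟩

/-! ### The multisymplectic bundle `Z` and the covariant momentum map -/

/-- The vertical tangent space `V_y Y`. -/
def vert (y : Y) : Submodule ℝ (TangentSpace (𝓡 m) y) :=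
  LinearMap.ker (mfderiv (𝓡 m) (𝓡 (n + 1)) D.proj y).toLinearMap

/-- The bundle `Z ⊆ Λⁿ⁺¹ T*Y` of the `(n + 1)`-forms `z` with `i_v i_w z = 0` for all vertical
`v`, `w`, i.e. of the forms that vanish whenever two of their arguments are vertical. -/
def Z : Set (Lam (𝓡 m) Y (n + 1)) :=
  {z | ∀ (u : Fin (n + 1) → TangentSpace (𝓡 m) z.proj) (i j : Fin (n + 1)), i ≠ j →
    u i ∈ D.vert z.proj → u j ∈ D.vert z.proj → z.form u = 0}

variable (n Y) in
/-- The canonical `(n + 1)`-form `Θ` on `Λⁿ⁺¹ T*Y`, `Θ_z(u₁, …) = z(Tπ u₁, …)`, where `π` is the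
projection to `Y`. Its restriction to `Z` is the canonical form of the multisymplectic manifold
`Z`. -/
def Θ : Form (lamModel (𝓡 m) (n + 1)) (Lam (𝓡 m) Y (n + 1)) (n + 1) := fun z =>
  pullback (I := lamModel (𝓡 m) (n + 1)) (I' := 𝓡 m)
    (fun w : Lam (𝓡 m) Y (n + 1) => w.proj) z z.form

/-- The lifted action `η ↦ η_Z`, `η_Z(z) = (η_Y⁻¹)^* z` (on the ambient bundle `Λⁿ⁺¹ T*Y`). -/
def actZ (η : G) (z : Lam (𝓡 m) Y (n + 1)) : Lam (𝓡 m) Y (n + 1) :=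
  liftAction (𝓡 m) (n + 1) D.actY η z

variable [DiffeologicalGroup G]

theorem isSmoothAction_actZ : IsSmoothAction (lamModel (𝓡 m) (n + 1)) D.actZ :=
  D.isSmoothAction_actY.lift (n + 1)

theorem mfderiv_actY_mem_vert (η : G) {y : Y} {v : TangentSpace (𝓡 m) y} (hv : v ∈ D.vert y) :
    mfderiv (𝓡 m) (𝓡 m) (D.actY η) y v ∈ D.vert (D.actY η y) := by
  have h1 := mfderiv_comp_apply y
    ((D.contMDiff_proj.mdifferentiable (by simp)) (D.actY η y))
    ((D.isSmoothAction_actY.contMDiff η).mdifferentiableAt (by simp)) v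
  have h2 := mfderiv_comp_apply y
    ((D.isSmoothAction_actX.contMDiff η).mdifferentiable (by simp) (D.proj y))
    (D.contMDiff_proj.mdifferentiable (by simp) y) v
  have h3 : D.proj ∘ D.actY η = D.actX η ∘ D.proj := funext (D.proj_actY η)
  have h4 : mfderiv (𝓡 m) (𝓡 (n + 1)) D.proj y v = 0 := hv
  rw [h3, h2, h4, map_zero] at h1
  exact h1.symm

/-- The lifted action preserves `Z`. -/
theorem actZ_mem (η : G) {z : Lam (𝓡 m) Y (n + 1)} (hz : z ∈ D.Z) : D.actZ η z ∈ D.Z := by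
  intro u i j hij hi hj
  have key : ∀ w : TangentSpace (𝓡 m) (D.actY η z.proj), w ∈ D.vert (D.actY η z.proj) →
      (mfderiv (𝓡 m) (𝓡 m) (D.actY η⁻¹) (D.actY η z.proj) w : EuclideanSpace ℝ (Fin m)) ∈
        D.vert z.proj := fun w hw => by
    have h := D.mfderiv_actY_mem_vert η⁻¹ hw
    rw [D.isSmoothAction_actY.inv_left] at h
    exact h
  exact hz (fun l => (mfderiv (𝓡 m) (𝓡 m) (D.actY η⁻¹) (D.actY η z.proj) (u l) :
    EuclideanSpace ℝ (Fin m))) i j hij (key _ hi) (key _ hj)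

/-- The (special) covariant momentum map `J` of the lifted action, `⟨J(z), ξ⟩ = (i_{ξ_Z} Θ)(z)`:
a linear map from the Lie algebra to the `n`-forms at `z`. -/
def J (z : Lam (𝓡 m) Y (n + 1)) :
    LieAlg G →ₗ[ℝ] TangentSpace (lamModel (𝓡 m) (n + 1)) z [⋀^Fin n]→L[ℝ] ℝ where
  toFun ξ := interior (generator D.isSmoothAction_actZ z ξ) (Θ n Y z)
  map_add' ξ ζ := by
    rw [map_add]
    exact map_add (ContinuousAlternatingMap.curryLeft
      (E := EuclideanSpace ℝ (Fin m) × (EuclideanSpace ℝ (Fin m) [⋀^Fin (n + 1)]→L[ℝ] ℝ))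
      (Θ n Y z)) _ _
  map_smul' c ξ := by
    rw [map_smul]
    exact map_smul (ContinuousAlternatingMap.curryLeft
      (E := EuclideanSpace ℝ (Fin m) × (EuclideanSpace ℝ (Fin m) [⋀^Fin (n + 1)]→L[ℝ] ℝ))
      (Θ n Y z)) _ _

/-! ### Spaces of fields on the Cauchy surface -/

/-- The `τ`-configuration space `𝒴_τ`: the smooth sections of `Y` over the Cauchy surface, given as
maps `φ : S → Y` covering the embedding `τ`. -/
structure Config where
  val : S → Y
  smooth : ContMDiff (𝓡 n) (𝓡 m) ∞ val
  proj_val : ∀ x, D.proj (val x) = D.τ x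

/-- The space `𝒵_τ` of smooth sections of `Z` over the Cauchy surface. -/
structure MultiField where
  val : S → Lam (𝓡 m) Y (n + 1)
  smooth : ContMDiff (𝓡 n) (lamModel (𝓡 m) (n + 1)) ∞ val
  mem : ∀ x, val x ∈ D.Z
  proj_val : ∀ x, D.proj (val x).proj = D.τ x

variable {D}

/-- The section `φ = π_{YZ} ∘ σ` underlying `σ`. -/
def MultiField.base (σ : D.MultiField) : D.Config where
  val x := (σ.val x).proj
  smooth := (Bundle.contMDiff_proj _).comp σ.smooth
  proj_val := σ.proj_val

/-- The tangent space `T_φ 𝒴_τ`: the smooth vertical vector fields along `φ`. -/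
structure Tan (φ : D.Config) where
  val : ∀ x, D.vert (φ.val x)
  smooth : ContMDiff (𝓡 n) (𝓡 m).tangent ∞
    (fun x => (⟨φ.val x, (val x : TangentSpace (𝓡 m) (φ.val x))⟩ : TangentBundle (𝓡 m) Y))

/-- The smooth cotangent space `T^*_φ 𝒴_τ`: the smooth sections `ϖ`, covering `φ`, of the bundle
with fibres `L(V_{φ(x)} Y, Λⁿ T_x^*S)`. Smoothness means that `ϖ(V)` is a smooth form for every
smooth vertical vector field `V` along `φ`. -/
structure Cot (φ : D.Config) where
  val : ∀ x, D.vert (φ.val x) →ₗ[ℝ] TangentSpace (𝓡 n) x [⋀^Fin n]→L[ℝ] ℝ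
  smooth : ∀ V : Tan φ, Form.IsSmooth (I := 𝓡 n) (fun x => val x (V.val x))

variable (D) in
/-- The `τ`-phase space `T^*𝒴_τ`, of pairs `(φ, ϖ)` with `ϖ ∈ T^*_φ 𝒴_τ`. -/
abbrev Phase : Type _ := Σ φ : D.Config, Cot φ

theorem contMDiff_pullback_interior (σ : D.MultiField)
    {V : ∀ x, TangentSpace (𝓡 m) (σ.base.val x)}
    (hV : ContMDiff (𝓡 n) (𝓡 m).tangent ∞
      (fun x => (⟨σ.base.val x, V x⟩ : TangentBundle (𝓡 m) Y))) :
    Form.IsSmooth (I := 𝓡 n)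
      (fun x => pullback (I := 𝓡 n) σ.base.val x (interior (V x) (σ.val x).form)) := by
  intro x₀
  have h1 := contMDiffAt_interior (V := V) (σ.smooth x₀) (hV x₀)
  exact contMDiffAt_pullForm h1 contMDiffAt_id
    ((σ.base.smooth x₀).mfderiv_const (m := ∞) (by simp))

/-- The map `R_τ` on the fibres: `⟨R_τ(σ)(x), v⟩ = φ^* i_v σ(x)`, so that
`⟨R_τ(σ), V⟩ = ∫ φ^* (i_V σ)`. -/
def MultiField.momentum (σ : D.MultiField) : Cot σ.base where
  val x :=
    { toFun := fun v => pullback (I := 𝓡 n) σ.base.val x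
        (interior (v : TangentSpace (𝓡 m) (σ.base.val x)) (σ.val x).form)
      map_add' := fun v w => by
        have h : interior ((v + w : D.vert (σ.base.val x)) : TangentSpace (𝓡 m) (σ.base.val x))
            (σ.val x).form = interior (v : TangentSpace (𝓡 m) (σ.base.val x)) (σ.val x).form +
              interior (w : TangentSpace (𝓡 m) (σ.base.val x)) (σ.val x).form :=
          map_add (ContinuousAlternatingMap.curryLeft (E := EuclideanSpace ℝ (Fin m))
            (σ.val x).form) _ _
        rw [h]
        rfl
      map_smul' := fun c v => by
        have h : interior ((c • v : D.vert (σ.base.val x)) : TangentSpace (𝓡 m) (σ.base.val x))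
            (σ.val x).form = c • interior (v : TangentSpace (𝓡 m) (σ.base.val x)) (σ.val x).form :=
          map_smul (ContinuousAlternatingMap.curryLeft (E := EuclideanSpace ℝ (Fin m))
            (σ.val x).form) _ _
        rw [h]
        rfl }
  smooth V := contMDiff_pullback_interior σ V.smooth

/-- The reduction map `R_τ : 𝒵_τ → T^*𝒴_τ`. -/
def MultiField.reduce (σ : D.MultiField) : D.Phase := ⟨σ.base, σ.momentum⟩

/-! ### Induced actions of `𝒢_τ` -/

/-- The action of `η ∈ 𝒢_τ` on `𝒴_τ`, `η_{𝒴_τ}(φ) = η_Y ∘ φ ∘ η_τ⁻¹`. -/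
def actConfig (η : D.stab) (φ : D.Config) : D.Config where
  val x := D.actY η (φ.val (D.actS η⁻¹ x))
  smooth := (D.isSmoothAction_actY.contMDiff (η : G)).comp
    (φ.smooth.comp (D.isSmoothAction_actS.contMDiff η⁻¹))
  proj_val x := by
    rw [D.proj_actY, φ.proj_val, ← D.τ_actS, D.isSmoothAction_actS.inv_right]

/-- The action of `η ∈ 𝒢_τ` on `𝒵_τ`, `η_{𝒵_τ}(σ) = η_Z ∘ σ ∘ η_τ⁻¹`. -/
def actMulti (η : D.stab) (σ : D.MultiField) : D.MultiField where
  val x := D.actZ η (σ.val (D.actS η⁻¹ x))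
  smooth := (D.isSmoothAction_actZ.contMDiff (η : G)).comp
    (σ.smooth.comp (D.isSmoothAction_actS.contMDiff η⁻¹))
  mem _ := D.actZ_mem η (σ.mem _)
  proj_val := (actConfig η σ.base).proj_val

/-- The tangent map `T_φ 𝒴_τ → T_{η_{𝒴_τ}(φ)} 𝒴_τ` of `η_{𝒴_τ}`, `V ↦ Tη_Y ∘ V ∘ η_τ⁻¹`. -/
def tanMap (η : D.stab) {φ : D.Config} (V : Tan φ) : Tan (actConfig η φ) where
  val x := ⟨mfderiv (𝓡 m) (𝓡 m) (D.actY η) (φ.val (D.actS η⁻¹ x)) (V.val (D.actS η⁻¹ x)),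
    D.mfderiv_actY_mem_vert η (V.val _).2⟩
  smooth := ((D.isSmoothAction_actY.contMDiff (η : G)).contMDiff_tangentMap (by simp)).comp
    (V.smooth.comp (D.isSmoothAction_actS.contMDiff η⁻¹))

/-! ### Infinitesimal generators -/

variable (D)

/-- The inclusion `𝔤_τ → 𝔤` of the Lie algebra of `𝒢_τ`. -/
def incl : LieAlg D.stab →ₗ[ℝ] LieAlg G := LieAlg.map D.stab.subtype (dSmooth_subtype _)

/-- The infinitesimal generator `ξ_Y` of the action on `Y`. -/
def genY (ξ : LieAlg G) (y : Y) : TangentSpace (𝓡 m) y := generator D.isSmoothAction_actY y ξ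

/-- The infinitesimal generator `ξ_τ` of the action `η ↦ η_τ` of `𝒢_τ` on the Cauchy surface. -/
def genS (ξ : LieAlg D.stab) (x : S) : TangentSpace (𝓡 n) x := generator D.isSmoothAction_actS x ξ

variable {D}

/-- The infinitesimal generator `ξ_{𝒴_τ}(φ) = ξ_Y ∘ φ - Tφ ∘ ξ_τ` of the action of `𝒢_τ` on
`𝒴_τ`. -/
def genConfig (ξ : LieAlg D.stab) (φ : D.Config) : Tan φ where
  val x := ⟨D.genY (D.incl ξ) (φ.val x) - mfderiv (𝓡 n) (𝓡 m) φ.val x (D.genS ξ x), by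
    have h1 := mfderiv_generator D.isSmoothAction_actY D.isSmoothAction_actX (MonoidHom.id G)
      (fun _ _ hp => hp) D.proj_actY (D.contMDiff_proj.mdifferentiable (by simp) (φ.val x))
      (D.incl ξ)
    have h2 := mfderiv_generator D.isSmoothAction_actS D.isSmoothAction_actX D.stab.subtype
      (dSmooth_subtype _) D.τ_actS
      (D.isSmoothEmbedding.contMDiff.mdifferentiable (by simp) x) ξ
    have h3 := mfderiv_comp_apply x (D.contMDiff_proj.mdifferentiable (by simp) (φ.val x))
      (φ.smooth.mdifferentiable (by simp) x) (D.genS ξ x)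
    have h4 : D.proj ∘ φ.val = D.τ := funext φ.proj_val
    replace h1 := h1.trans (congrArg _ (LieAlg.map_id _ _))
    rw [h4] at h3
    have h5 : ∀ x' : X, D.τ x = x' → (generator D.isSmoothAction_actX (D.τ x) (D.incl ξ) :
        EuclideanSpace ℝ (Fin (n + 1))) = generator D.isSmoothAction_actX x' (D.incl ξ) := by
      rintro _ rfl
      rfl
    change mfderiv (𝓡 m) (𝓡 (n + 1)) D.proj (φ.val x) _ = 0
    refine (map_sub _ _ _).trans (sub_eq_zero.2 ?_)
    exact h1.trans ((h5 _ (φ.proj_val x).symm).symm.trans (h2.symm.trans h3))⟩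
  smooth := by
    have h1 := contMDiff_generator D.isSmoothAction_actY φ.smooth (D.incl ξ)
    have h2 := contMDiff_generator D.isSmoothAction_actS (contMDiff_id (M := S)) ξ
    have h3 := (φ.smooth.contMDiff_tangentMap (m := ∞) (by simp)).comp h2
    have h4 := contMDiff_field_add_smul (b := φ.val)
      (V := fun x => mfderiv (𝓡 n) (𝓡 m) φ.val x (D.genS ξ x)) (-1) h3 h1
    refine h4.congr fun x => ?_
    congr 1
    change _ - _ = (-1 : ℝ) • _ + _
    rw [neg_one_smul, neg_add_eq_sub]
    rfl

/-! ### Energy-momentum and momentum maps -/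

variable [CompactSpace S] [T2Space S]

/-- The pairing `⟨ϖ, V⟩ = ∫ ϖ(V)` of `T^*_φ 𝒴_τ` with `T_φ 𝒴_τ`. -/
def Cot.pair {φ : D.Config} (ϖ : Cot φ) (V : Tan φ) : ℝ :=
  formIntegral fun x => ϖ.val x (V.val x)

/-- The energy-momentum map, `⟨E_τ(σ), ξ⟩ = ∫ σ^* ⟨J, ξ⟩`. -/
def energyMomentum (σ : D.MultiField) (ξ : LieAlg G) : ℝ :=
  formIntegral fun x => pullback (I := 𝓡 n) σ.val x (D.J (σ.val x) ξ)

/-- The momentum map `J_τ` of the action of `𝒢_τ` on `𝒵_τ`, the restriction of `E_τ` to `𝔤_τ`. -/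
def momentumMap (σ : D.MultiField) (ξ : LieAlg D.stab) : ℝ :=
  energyMomentum σ (D.incl ξ)

end LiftedTheory

end

end FieldTheory

open FieldTheory FieldTheory.LiftedTheory

/-! The generator of the lifted action on `Z` projects to the generator on `Y`, so the canonical
form gives `⟨J(z), ξ⟩ = π^*(i_{ξ_Y} z)` (`J_eq`). Pulling back along `σ` and using `π ∘ σ = φ` gives
the formula for `E_τ` (`pullback_J`). Linearity in `ξ` then follows from linearity of the integral
on smooth forms.

The map `R_τ` is surjective (`reduce_surjective`), which gives uniqueness of everything induced on
`T^*𝒴_τ`. Near a point, choose a retraction of `Y` onto the Cauchy surface and fibre coordinates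
measured relative to `φ`. With `Q` the differential of the retraction, `θ^a` those of the relative
fibre coordinates and `e_a` the dual vertical frame, the form `∑ θ^a ∧ Q^*ϖ(e_a)` lies in `Z` and
has momentum `ϖ`. The forms with a given momentum are a convex subset of each fibre, so the local
solutions glue by a partition of unity.

Existence of the induced maps needs that `R_τ(η_{𝒵_τ}(σ))` depends on `σ` only through `R_τ(σ)`.
This holds because the lifted action is push-forward of forms (`momentum_actMulti`), and the
resulting formula is the cotangent action. For `J_τ`, the generators `ξ_Y` and `ξ_Y - Tφ ∘ ξ_τ`
differ by a vector tangent to the section. Its contribution is the interior product of a form of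
degree `n + 1` pulled back to an `n`-manifold, hence zero. Thus `J_τ(σ)` is the pairing of `R_τ(σ)`
with `ξ_{𝒴_τ}` (`momentumMap_eq_pair`).

Equivariance of `J` follows from `T(η_Y⁻¹) ξ_Y = (Ad_{η⁻¹} ξ)_Y` (`mfderiv_generator_Ad`).
Equivariance of the integrated maps and invariance of the pairing need in addition that integrals
are unchanged by orientation-preserving diffeomorphisms (`formIntegral_pullback`), which is the only
use of orientation. -/

namespace FieldTheory

noncomputable section

/-! ### Pull-backs of smooth forms -/

section FormPullback

variable {E : Type*} [NormedAddCommGroup E] [NormedSpace ℝ E]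
  {H : Type*} [TopologicalSpace H] {I : ModelWithCorners ℝ E H}
  {M : Type*} [TopologicalSpace M] [ChartedSpace H M] [IsManifold I ∞ M]
  {EN : Type*} [NormedAddCommGroup EN] [NormedSpace ℝ EN]
  {HN : Type*} [TopologicalSpace HN] {J : ModelWithCorners ℝ EN HN}
  {N : Type*} [TopologicalSpace N] [ChartedSpace HN N] [IsManifold J ∞ N]
  {k : ℕ}

/-- The pull-back of a smooth form by a smooth map is smooth. -/
theorem contMDiffAt_pullback {f : N → M} {x₀ : N} {α : Form I M k} (hf : ContMDiffAt J I ∞ f x₀)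
    (hα : ContMDiffAt I (lamModel I k) ∞ (fun x => Lam.mk x (α x)) (f x₀)) :
    ContMDiffAt J (lamModel J k) ∞
      (fun x => Lam.mk x (pullback (I := J) f x (α (f x)))) x₀ :=
  contMDiffAt_pullForm (s := fun x => Lam.mk (f x) (α (f x))) (b' := id)
    (A := fun x => mfderiv J I f x) (hα.comp x₀ hf) contMDiffAt_id
    (hf.mfderiv_const (m := ∞) (by simp))

theorem continuous_alternating_eval (v : Fin k → E) :
    Continuous fun f : E [⋀^Fin k]→L[ℝ] ℝ => f v :=
  (ContinuousAlternatingMap.apply ℝ E ℝ v).continuous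

/-- The coefficients of a smooth form on a normed space are continuous. -/
theorem continuousAt_form_apply {α : Form 𝓘(ℝ, E) E k} {y : E} (v : Fin k → E)
    (hα : ContMDiffAt 𝓘(ℝ, E) (lamModel 𝓘(ℝ, E) k) ∞ (fun x => Lam.mk x (α x)) y) :
    ContinuousAt (fun x => α x v) y := by
  have h := (contMDiffAt_lam.1 hα).2.continuousAt
  have h2 := (continuous_alternating_eval v).continuousAt.comp h
  refine h2.congr (Eventually.of_forall fun x => ?_)
  change α x _ = α x v
  congr 1
  funext a
  -- On a vector space the coordinate changes of the tangent bundle are identities, so the local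
  -- representative of the form is the form itself.
  exact congrArg (fun A : E →L[ℝ] E => A (v a)) (tangentBundleCore_coordChange_model_space x y x)

end FormPullback

/-! ### The integral of a form as a finite sum of integrable chart terms -/

section ChartIntegral

variable {n : ℕ} {S : Type*} [TopologicalSpace S] [ChartedSpace (EuclideanSpace ℝ (Fin n)) S]

/-- The coefficient of a top-degree form in the preferred chart at `i`. -/
def chartCoeff (α : Form (𝓡 n) S n) (i : S) (y : EuclideanSpace ℝ (Fin n)) : ℝ :=
  pullback (I := 𝓡 n) (extChartAt (𝓡 n) i).symm y (α ((extChartAt (𝓡 n) i).symm y))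
    (fun j => EuclideanSpace.single j (1 : ℝ))

variable [IsManifold (𝓡 n) ∞ S]

theorem contMDiffAt_extChartAt_symm {i : S} {y : EuclideanSpace ℝ (Fin n)}
    (hy : y ∈ (extChartAt (𝓡 n) i).target) :
    ContMDiffAt 𝓘(ℝ, EuclideanSpace ℝ (Fin n)) (𝓡 n) ∞ (extChartAt (𝓡 n) i).symm y :=
  (contMDiffOn_extChartAt_symm i).contMDiffAt ((isOpen_extChartAt_target i).mem_nhds hy)

theorem continuousOn_chartCoeff {α : Form (𝓡 n) S n} (hα : Form.IsSmooth α) (i : S) :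
    ContinuousOn (chartCoeff α i) (extChartAt (𝓡 n) i).target := fun _ hy =>
  (continuousAt_form_apply _ (contMDiffAt_pullback (contMDiffAt_extChartAt_symm hy)
    (hα _))).continuousWithinAt

theorem chartCoeff_add_smul (c : ℝ) (α β : Form (𝓡 n) S n) (i : S)
    (y : EuclideanSpace ℝ (Fin n)) :
    chartCoeff (fun x => c • α x + β x) i y = c * chartCoeff α i y + chartCoeff β i y := rfl

variable [CompactSpace S] [T2Space S]

theorem tsupport_chartPartition_subset (i : S) :
    tsupport (chartPartition n S i) ⊆ (extChartAt (𝓡 n) i).source := by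
  rw [extChartAt_source]
  exact Classical.choose_spec (SmoothPartitionOfUnity.exists_isSubordinate_chartAt_source (𝓡 n) S) i

theorem finite_support_chartPartition :
    {i : S | (Function.support (chartPartition n S i)).Nonempty}.Finite :=
  (chartPartition n S).locallyFinite.finite_nonempty_of_compact

variable (n S) in
/-- The finitely many indices of the charts that contribute to integrals. -/
def chartIndices : Finset S := (finite_support_chartPartition (n := n) (S := S)).toFinset

theorem chartPartition_eq_zero {i : S} (hi : i ∉ chartIndices n S) (x : S) :
    chartPartition n S i x = 0 := by
  by_contra h
  exact hi ((finite_support_chartPartition (n := n) (S := S)).mem_toFinset.2 ⟨x, h⟩)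

theorem sum_chartPartition (x : S) : ∑ i ∈ chartIndices n S, chartPartition n S i x = 1 := by
  rw [← (chartPartition n S).sum_eq_one (mem_univ x)]
  refine (finsum_eq_sum_of_support_subset _ fun i hi => ?_).symm
  by_contra h
  exact hi (chartPartition_eq_zero h x)

/-- Compactness leaves only finitely many nonzero partition functions. The index set does not depend
on the form, so sums for different forms can be added and interchanged. -/
theorem formIntegral_eq_sum (α : Form (𝓡 n) S n) :
    formIntegral α = ∑ i ∈ chartIndices n S, ∫ y in (extChartAt (𝓡 n) i).target,
      chartPartition n S i ((extChartAt (𝓡 n) i).symm y) * chartCoeff α i y := by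
  refine finsum_eq_sum_of_support_subset _ fun i hi => ?_
  by_contra h
  refine hi ?_
  simp [chartPartition_eq_zero h]

/-- A continuous function on a chart, cut off by a function whose support is closed in the
manifold and contained in the domain of the chart, is integrable. -/
theorem integrableOn_chart {i : S} {ρ : S → ℝ} (hρ : Continuous ρ)
    (hs : tsupport ρ ⊆ (extChartAt (𝓡 n) i).source) {c : EuclideanSpace ℝ (Fin n) → ℝ}
    (hc : ContinuousOn c (extChartAt (𝓡 n) i).target) :
    MeasureTheory.IntegrableOn (fun y => ρ ((extChartAt (𝓡 n) i).symm y) * c y)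
      (extChartAt (𝓡 n) i).target := by
  set e := extChartAt (𝓡 n) i
  -- Since `S` is compact, the support and its image in the chart are compact. The integrand is
  -- continuous on that image and zero on the rest of the chart.
  have hK : IsCompact (e '' tsupport ρ) :=
    (isClosed_tsupport ρ).isCompact.image_of_continuousOn ((continuousOn_extChartAt i).mono hs)
  have hKt : e '' tsupport ρ ⊆ e.target := by
    rintro _ ⟨x, hx, rfl⟩
    exact e.map_source (hs hx)
  have h1 : MeasureTheory.IntegrableOn (fun y => ρ (e.symm y) * c y) (e '' tsupport ρ) :=
    (((hρ.comp_continuousOn (continuousOn_extChartAt_symm i)).mul hc).mono hKt).integrableOn_compact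
      hK
  refine h1.of_forall_sdiff_eq_zero (isOpen_extChartAt_target i).measurableSet fun y hy => ?_
  have h2 : e.symm y ∉ tsupport ρ := fun h => hy.2 ⟨_, h, e.right_inv hy.1⟩
  rw [image_eq_zero_of_notMem_tsupport h2, zero_mul]

theorem integrableOn_chartPartition {α : Form (𝓡 n) S n} (hα : Form.IsSmooth α) (i : S) :
    MeasureTheory.IntegrableOn
      (fun y => chartPartition n S i ((extChartAt (𝓡 n) i).symm y) * chartCoeff α i y)
      (extChartAt (𝓡 n) i).target :=
  integrableOn_chart (chartPartition n S i).contMDiff.continuous (tsupport_chartPartition_subset i)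
    (continuousOn_chartCoeff hα i)

/-- The integral of forms is linear. -/
theorem formIntegral_add_smul (c : ℝ) {α β : Form (𝓡 n) S n} (hα : Form.IsSmooth α)
    (hβ : Form.IsSmooth β) :
    formIntegral (fun x => c • α x + β x) = c * formIntegral α + formIntegral β := by
  simp_rw [formIntegral_eq_sum, Finset.mul_sum]
  rw [← Finset.sum_add_distrib]
  refine Finset.sum_congr rfl fun i _ => ?_
  -- Smoothness of the two forms enters here, as integrability of both summands.
  rw [← MeasureTheory.integral_const_mul, ← MeasureTheory.integral_add
    ((integrableOn_chartPartition hα i).const_mul c) (integrableOn_chartPartition hβ i)]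
  refine MeasureTheory.integral_congr_ae (Eventually.of_forall fun y => ?_)
  simp only [chartCoeff_add_smul]
  ring

end ChartIntegral

/-! ### Invariance of the integral under orientation-preserving diffeomorphisms -/

section ChangeOfVariables

variable {n : ℕ} {S : Type*} [TopologicalSpace S] [ChartedSpace (EuclideanSpace ℝ (Fin n)) S]

/-- Alternating forms of top degree are multiples of the determinant of a basis, so composing with
an endomorphism multiplies them by its determinant. -/
theorem alternating_comp_single (β : EuclideanSpace ℝ (Fin n) [⋀^Fin n]→L[ℝ] ℝ)
    (B : EuclideanSpace ℝ (Fin n) →L[ℝ] EuclideanSpace ℝ (Fin n)) :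
    β (fun j => B (EuclideanSpace.single j (1 : ℝ))) =
      B.det * β (fun j => EuclideanSpace.single j (1 : ℝ)) := by
  let e := (EuclideanSpace.basisFun (Fin n) ℝ).toBasis
  have he : (e : Fin n → EuclideanSpace ℝ (Fin n)) = fun j => EuclideanSpace.single j (1 : ℝ) := by
    funext j
    simp [e]
  have h := β.toAlternatingMap.eq_smul_basis_det e
  have h1 : ∀ v, β v = β e * e.det v := fun v => DFunLike.congr_fun h v
  have h2 := e.det_comp (B : EuclideanSpace ℝ (Fin n) →ₗ[ℝ] EuclideanSpace ℝ (Fin n)) e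
  have h3 : (fun j => B (EuclideanSpace.single j (1 : ℝ))) =
      (B : EuclideanSpace ℝ (Fin n) →ₗ[ℝ] EuclideanSpace ℝ (Fin n)) ∘ e := by
    rw [he]
    rfl
  rw [h3, ← he, h1, h2, e.det_self, mul_one, mul_comm]

variable [IsManifold (𝓡 n) ∞ S]

/-- A map in the preferred charts at `i` and `j`. -/
def inCharts (f : S → S) (i j : S) (y : EuclideanSpace ℝ (Fin n)) : EuclideanSpace ℝ (Fin n) :=
  extChartAt (𝓡 n) j (f ((extChartAt (𝓡 n) i).symm y))

/-- The domain of the expression of a map in the preferred charts at `i` and `j`. -/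
def chartDomain (f : S → S) (i j : S) : Set (EuclideanSpace ℝ (Fin n)) :=
  (extChartAt (𝓡 n) i).target ∩ {y | f ((extChartAt (𝓡 n) i).symm y) ∈ (extChartAt (𝓡 n) j).source}

variable {f g : S → S} {i j : S} {y : EuclideanSpace ℝ (Fin n)}

theorem isOpen_chartDomain (hf : Continuous f) (i j : S) :
    IsOpen (chartDomain (n := n) f i j) :=
  (hf.comp_continuousOn (continuousOn_extChartAt_symm i)).isOpen_inter_preimage
    (isOpen_extChartAt_target i) (isOpen_extChartAt_source j)

/-- The derivative is kept as a product of three factors because the signs of their determinants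
have different sources: the two charts and `f`. -/
theorem hasMFDerivAt_inCharts (hf : ContMDiff (𝓡 n) (𝓡 n) ∞ f) (hy : y ∈ chartDomain f i j) :
    HasMFDerivAt 𝓘(ℝ, EuclideanSpace ℝ (Fin n)) 𝓘(ℝ, EuclideanSpace ℝ (Fin n)) (inCharts f i j) y
      ((mfderiv (𝓡 n) 𝓘(ℝ, EuclideanSpace ℝ (Fin n)) (extChartAt (𝓡 n) j)
        (f ((extChartAt (𝓡 n) i).symm y))).comp
      ((mfderiv (𝓡 n) (𝓡 n) f ((extChartAt (𝓡 n) i).symm y)).comp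
        (mfderiv 𝓘(ℝ, EuclideanSpace ℝ (Fin n)) (𝓡 n) (extChartAt (𝓡 n) i).symm y))) := by
  have h1 : MDifferentiableAt 𝓘(ℝ, EuclideanSpace ℝ (Fin n)) (𝓡 n) (extChartAt (𝓡 n) i).symm y :=
    (contMDiffAt_extChartAt_symm hy.1).mdifferentiableAt (by simp)
  have h2 : MDifferentiableAt (𝓡 n) (𝓡 n) f ((extChartAt (𝓡 n) i).symm y) :=
    hf.mdifferentiableAt (by simp)
  have h3 : MDifferentiableAt (𝓡 n) 𝓘(ℝ, EuclideanSpace ℝ (Fin n)) (extChartAt (𝓡 n) j)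
      (f ((extChartAt (𝓡 n) i).symm y)) := by
    have h := hy.2
    rw [mem_ofPred_eq, extChartAt_source] at h
    exact mdifferentiableAt_extChartAt h
  exact h3.hasMFDerivAt.comp y (h2.hasMFDerivAt.comp y h1.hasMFDerivAt)

theorem differentiableAt_inCharts (hf : ContMDiff (𝓡 n) (𝓡 n) ∞ f) (hy : y ∈ chartDomain f i j) :
    DifferentiableAt ℝ (inCharts f i j) y :=
  (hasMFDerivAt_inCharts hf hy).mdifferentiableAt.differentiableAt

/-- The coefficient of a pull-back is the coefficient times the Jacobian determinant. -/
theorem chartCoeff_pullback (hf : ContMDiff (𝓡 n) (𝓡 n) ∞ f) (α : Form (𝓡 n) S n)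
    (hy : y ∈ chartDomain f i j) :
    chartCoeff (fun x => pullback (I := 𝓡 n) f x (α (f x))) i y =
      (fderiv ℝ (inCharts f i j) y).det * chartCoeff α j (inCharts f i j y) := by
  have hx : (extChartAt (𝓡 n) j).symm (inCharts f i j y) = f ((extChartAt (𝓡 n) i).symm y) :=
    (extChartAt (𝓡 n) j).left_inv hy.2
  have ht : inCharts f i j y ∈ (extChartAt (𝓡 n) j).target := (extChartAt (𝓡 n) j).map_source hy.2
  have h1 := mfderiv_comp_apply y
    ((contMDiffAt_extChartAt_symm ht).mdifferentiableAt (by simp))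
    (hasMFDerivAt_inCharts hf hy).mdifferentiableAt
  have h2 := mfderiv_comp_apply y
    (hf.mdifferentiableAt (by simp) (x := (extChartAt (𝓡 n) i).symm y))
    ((contMDiffAt_extChartAt_symm hy.1).mdifferentiableAt (by simp))
  -- Both composites parametrise the image of `f`; equality of their derivatives is what brings out
  -- the Jacobian of `inCharts f i j`.
  have h3 : (extChartAt (𝓡 n) j).symm ∘ inCharts f i j =ᶠ[𝓝 y]
      f ∘ (extChartAt (𝓡 n) i).symm := by
    filter_upwards [(isOpen_chartDomain hf.continuous i j).mem_nhds hy] with z hz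
    exact (extChartAt (𝓡 n) j).left_inv hz.2
  have h4 := h3.mfderiv_eq (I := 𝓘(ℝ, EuclideanSpace ℝ (Fin n))) (I' := 𝓡 n)
  have h5 := alternating_comp_single
    (pullback (I := 𝓡 n) (extChartAt (𝓡 n) j).symm (inCharts f i j y)
      (α ((extChartAt (𝓡 n) j).symm (inCharts f i j y)))) (fderiv ℝ (inCharts f i j) y)
  refine Eq.trans ?_ h5
  -- The two base points are only propositionally equal, so `α` is transported along the equation
  -- before its arguments are compared.
  have h6 : ∀ x', x' = f ((extChartAt (𝓡 n) i).symm y) → ∀ v w : Fin n → EuclideanSpace ℝ (Fin n),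
      v = w → α (f ((extChartAt (𝓡 n) i).symm y)) v = α x' w := by
    rintro _ rfl _ _ rfl
    rfl
  refine h6 _ hx _ _ (funext fun k => ?_)
  have h7 := congrArg (fun A : EuclideanSpace ℝ (Fin n) →L[ℝ] EuclideanSpace ℝ (Fin n) =>
    A (EuclideanSpace.single k (1 : ℝ))) h4
  rw [mfderiv_eq_fderiv] at h1
  exact (h2 _).symm.trans (h7.symm.trans (h1 _))

/-- The differential at `p` is computed in the preferred chart at `p`, so the differential of
another chart is that of a transition map, to which `OrientedAtlas.det_pos` applies. -/
theorem mfderiv_extChartAt_eq_fderiv (j p : S) (hp : p ∈ (extChartAt (𝓡 n) j).source) :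
    (mfderiv (𝓡 n) 𝓘(ℝ, EuclideanSpace ℝ (Fin n)) (extChartAt (𝓡 n) j) p :
      EuclideanSpace ℝ (Fin n) →L[ℝ] EuclideanSpace ℝ (Fin n)) =
      fderiv ℝ (chartAt (EuclideanSpace ℝ (Fin n)) j ∘ (chartAt (EuclideanSpace ℝ (Fin n)) p).symm)
        (chartAt (EuclideanSpace ℝ (Fin n)) p p) := by
  rw [extChartAt_source] at hp
  refine (mdifferentiableAt_extChartAt hp).mfderiv.trans ?_
  simp only [modelWithCornersSelf_coe, range_id, fderivWithin_univ]
  rfl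

theorem mfderiv_extChartAt_symm_eq_fderiv (hy : y ∈ (extChartAt (𝓡 n) i).target) :
    (mfderiv 𝓘(ℝ, EuclideanSpace ℝ (Fin n)) (𝓡 n) (extChartAt (𝓡 n) i).symm y :
      EuclideanSpace ℝ (Fin n) →L[ℝ] EuclideanSpace ℝ (Fin n)) =
      fderiv ℝ (chartAt (EuclideanSpace ℝ (Fin n)) ((extChartAt (𝓡 n) i).symm y) ∘
        (chartAt (EuclideanSpace ℝ (Fin n)) i).symm) y := by
  refine ((contMDiffAt_extChartAt_symm hy).mdifferentiableAt (by simp)).mfderiv.trans ?_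
  simp only [modelWithCornersSelf_coe, range_id, fderivWithin_univ]
  rfl

/-- All three factors of the derivative have positive determinant: the outer ones are differentials
of transition maps of the oriented atlas, the middle one is the differential of `f`. -/
theorem det_fderiv_inCharts_pos [OrientedAtlas n S] (hf : ContMDiff (𝓡 n) (𝓡 n) ∞ f)
    (ho : OrientationPreserving n f) (hy : y ∈ chartDomain f i j) :
    0 < (fderiv ℝ (inCharts f i j) y).det := by
  have h := (hasMFDerivAt_inCharts hf hy).mfderiv
  rw [mfderiv_eq_fderiv] at h
  set x := (extChartAt (𝓡 n) i).symm y
  have hx : x ∈ (extChartAt (𝓡 n) i).source := (extChartAt (𝓡 n) i).map_target hy.1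
  have hxy : chartAt (EuclideanSpace ℝ (Fin n)) i x = y := (extChartAt (𝓡 n) i).right_inv hy.1
  have h1 := mfderiv_extChartAt_eq_fderiv j (f x) hy.2
  have h2 := mfderiv_extChartAt_symm_eq_fderiv hy.1
  have h3 := OrientedAtlas.det_pos (n := n) _ (chart_mem_atlas (EuclideanSpace ℝ (Fin n)) (f x)) _
    (chart_mem_atlas (EuclideanSpace ℝ (Fin n)) j) (f x)
    ⟨mem_chart_source _ _, by simpa [x] using hy.2⟩
  have h4 := OrientedAtlas.det_pos (n := n) _ (chart_mem_atlas (EuclideanSpace ℝ (Fin n)) i) _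
    (chart_mem_atlas (EuclideanSpace ℝ (Fin n)) x) x
    ⟨by simpa using hx, mem_chart_source _ _⟩
  rw [hxy] at h4
  have h5 : (fderiv ℝ (inCharts f i j) y).det = _ := congrArg
    (fun A : EuclideanSpace ℝ (Fin n) →L[ℝ] EuclideanSpace ℝ (Fin n) => A.det) h
  rw [← h1] at h3
  rw [← h2] at h4
  have h6 : ∀ A B C : EuclideanSpace ℝ (Fin n) →L[ℝ] EuclideanSpace ℝ (Fin n),
      (A.comp (B.comp C)).det = A.det * (B.det * C.det) := fun A B C => by
    simp [ContinuousLinearMap.det, LinearMap.det_comp]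
  rw [h5]
  refine lt_of_lt_of_eq (mul_pos h3 (mul_pos (ho x) h4)) (h6 _ _ _).symm

/-- The chart expressions of `f` and of its inverse `g` are mutually inverse; this identifies the
region on the other side of the change of variables. -/
theorem image_inCharts (hgf : Function.LeftInverse g f) (hfg : Function.RightInverse g f) (i j : S) :
    inCharts f i j '' chartDomain (n := n) f i j = chartDomain g j i := by
  ext z
  constructor
  · rintro ⟨y, hy, rfl⟩
    refine ⟨(extChartAt (𝓡 n) j).map_source hy.2, ?_⟩
    have h : (extChartAt (𝓡 n) j).symm (inCharts f i j y) = f ((extChartAt (𝓡 n) i).symm y) :=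
      (extChartAt (𝓡 n) j).left_inv hy.2
    rw [mem_ofPred_eq, h, hgf]
    exact (extChartAt (𝓡 n) i).map_target hy.1
  · rintro ⟨h1, h2⟩
    have h3 : (extChartAt (𝓡 n) i).symm (inCharts g j i z) = g ((extChartAt (𝓡 n) j).symm z) :=
      (extChartAt (𝓡 n) i).left_inv h2
    refine ⟨inCharts g j i z, ⟨(extChartAt (𝓡 n) i).map_source h2, ?_⟩, ?_⟩
    · rw [mem_ofPred_eq, h3, hfg]
      exact (extChartAt (𝓡 n) j).map_target h1
    · rw [inCharts, h3, hfg]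
      exact (extChartAt (𝓡 n) j).right_inv h1

theorem injOn_inCharts (hf : Function.Injective f) (i j : S) :
    InjOn (inCharts f i j) (chartDomain (n := n) f i j) := fun y hy z hz h => by
  have h1 := (extChartAt (𝓡 n) j).injOn hy.2 hz.2 h
  exact (extChartAt (𝓡 n) i).symm.injOn hy.1 hz.1 (hf h1)

/-- Change of variables in a pair of charts. -/
theorem integral_chartDomain_pullback [OrientedAtlas n S] (hf : ContMDiff (𝓡 n) (𝓡 n) ∞ f)
    (ho : OrientationPreserving n f) (hgf : Function.LeftInverse g f)
    (hfg : Function.RightInverse g f) (α : Form (𝓡 n) S n) (ρ : S → ℝ) (i j : S) :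
    ∫ y in chartDomain f i j, ρ ((extChartAt (𝓡 n) i).symm y) *
      chartCoeff (fun x => pullback (I := 𝓡 n) f x (α (f x))) i y =
    ∫ z in chartDomain g j i, ρ (g ((extChartAt (𝓡 n) j).symm z)) * chartCoeff α j z := by
  have hm := (isOpen_chartDomain (n := n) hf.continuous i j).measurableSet
  rw [← image_inCharts hgf hfg, MeasureTheory.integral_image_eq_integral_abs_det_fderiv_smul _ hm
    (fun y hy => (differentiableAt_inCharts hf hy).hasFDerivAt.hasFDerivWithinAt)
    (injOn_inCharts hgf.injective i j)]
  refine MeasureTheory.setIntegral_congr_fun hm fun y hy => ?_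
  have h : (extChartAt (𝓡 n) j).symm (inCharts f i j y) = f ((extChartAt (𝓡 n) i).symm y) :=
    (extChartAt (𝓡 n) j).left_inv hy.2
  simp only [h, hgf _]
  -- The substitution formula produces the absolute value of the Jacobian, the pull-back of the form
  -- the Jacobian itself; orientation makes them equal.
  rw [chartCoeff_pullback hf α hy, abs_of_pos (det_fderiv_inCharts_pos hf ho hy), smul_eq_mul]
  ring

variable [CompactSpace S] [T2Space S]

/-- The cut-off at `j`, composed with `f`, vanishes at points that `f` does not send into the chart
at `j`, so only the region where both charts are available contributes. -/
theorem integral_chart_eq_integral_chartDomain (f : S → S) (i j : S) (ρ : S → ℝ)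
    (c : EuclideanSpace ℝ (Fin n) → ℝ) :
    ∫ y in (extChartAt (𝓡 n) i).target, ρ ((extChartAt (𝓡 n) i).symm y) *
      chartPartition n S j (f ((extChartAt (𝓡 n) i).symm y)) * c y =
    ∫ y in chartDomain f i j, ρ ((extChartAt (𝓡 n) i).symm y) *
      chartPartition n S j (f ((extChartAt (𝓡 n) i).symm y)) * c y := by
  refine MeasureTheory.setIntegral_eq_of_subset_of_forall_sdiff_eq_zero
    (isOpen_extChartAt_target i).measurableSet inter_subset_left fun y hy => ?_
  have h : f ((extChartAt (𝓡 n) i).symm y) ∉ tsupport (chartPartition n S j) := fun h =>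
    hy.2 ⟨hy.1, tsupport_chartPartition_subset j h⟩
  rw [image_eq_zero_of_notMem_tsupport h, mul_zero, zero_mul]

theorem integrableOn_chartPartition_mul {α : Form (𝓡 n) S n} (hα : Form.IsSmooth α) {ρ : S → ℝ}
    (hρ : Continuous ρ) (i : S) :
    MeasureTheory.IntegrableOn (fun y => chartPartition n S i ((extChartAt (𝓡 n) i).symm y) *
      ρ ((extChartAt (𝓡 n) i).symm y) * chartCoeff α i y) (extChartAt (𝓡 n) i).target :=
  integrableOn_chart (ρ := fun x => chartPartition n S i x * ρ x)
    ((chartPartition n S i).contMDiff.continuous.mul hρ)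
    ((tsupport_mul_subset_left (f := chartPartition n S i)).trans
      (tsupport_chartPartition_subset i)) (continuousOn_chartCoeff hα i)

/-- The integral of a form in a chart can be split with any partition of unity. -/
theorem integral_chart_eq_sum {α : Form (𝓡 n) S n} (hα : Form.IsSmooth α) (hf : Continuous f)
    (i : S) :
    ∫ y in (extChartAt (𝓡 n) i).target,
      chartPartition n S i ((extChartAt (𝓡 n) i).symm y) * chartCoeff α i y =
    ∑ j ∈ chartIndices n S, ∫ y in (extChartAt (𝓡 n) i).target,
      chartPartition n S i ((extChartAt (𝓡 n) i).symm y) *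
        chartPartition n S j (f ((extChartAt (𝓡 n) i).symm y)) * chartCoeff α i y := by
  have h := MeasureTheory.integral_finsetSum (chartIndices n S) fun j _ =>
    integrableOn_chartPartition_mul hα ((chartPartition n S j).contMDiff.continuous.comp hf) i
  refine Eq.trans ?_ h
  refine MeasureTheory.integral_congr_ae (Eventually.of_forall fun y => ?_)
  dsimp only [Function.comp_apply]
  rw [← Finset.sum_mul, ← Finset.mul_sum, sum_chartPartition, mul_one]

/-- The integral of forms is invariant under orientation-preserving diffeomorphisms. -/
theorem formIntegral_pullback [OrientedAtlas n S] (hf : ContMDiff (𝓡 n) (𝓡 n) ∞ f)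
    (hg : ContMDiff (𝓡 n) (𝓡 n) ∞ g) (ho : OrientationPreserving n f)
    (hgf : Function.LeftInverse g f) (hfg : Function.RightInverse g f) {α : Form (𝓡 n) S n}
    (hα : Form.IsSmooth α) :
    formIntegral (fun x => pullback (I := 𝓡 n) f x (α (f x))) = formIntegral α := by
  have hfα : Form.IsSmooth (fun x => pullback (I := 𝓡 n) f x (α (f x))) := fun x =>
    contMDiffAt_pullback (hf x) (hα _)
  -- With `ρ` the chart partition, both sides become double sums over pairs of charts, with weights
  -- `ρ_i · (ρ_j ∘ f)` on the left and `ρ_j · (ρ_i ∘ g)` on the right. These correspond under `f`,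
  -- so the terms match pair by pair.
  rw [formIntegral_eq_sum, formIntegral_eq_sum,
    Finset.sum_congr rfl fun i _ => integral_chart_eq_sum hfα hf.continuous i,
    Finset.sum_congr rfl fun i _ => integral_chart_eq_sum hα hg.continuous i, Finset.sum_comm]
  refine Finset.sum_congr rfl fun j _ => Finset.sum_congr rfl fun i _ => ?_
  rw [integral_chart_eq_integral_chartDomain f i j,
    integral_chart_eq_integral_chartDomain g j i]
  refine (integral_chartDomain_pullback hf ho hgf hfg α
    (fun x => chartPartition n S i x * chartPartition n S j (f x)) i j).trans ?_
  refine MeasureTheory.integral_congr_ae (Eventually.of_forall fun z => ?_)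
  dsimp only
  rw [hfg, mul_comm (chartPartition n S i _)]

end ChangeOfVariables

/-! ### Smooth families of vectors, forms and wedge products -/

section SmoothFamilies

variable {E : Type*} [NormedAddCommGroup E] [NormedSpace ℝ E]
  {H : Type*} [TopologicalSpace H] {I : ModelWithCorners ℝ E H}
  {M : Type*} [TopologicalSpace M] [ChartedSpace H M] [IsManifold I ∞ M]
  {E' : Type*} [NormedAddCommGroup E'] [NormedSpace ℝ E']
  {H' : Type*} [TopologicalSpace H'] {I' : ModelWithCorners ℝ E' H'}
  {M' : Type*} [TopologicalSpace M'] [ChartedSpace H' M'] [IsManifold I' ∞ M']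
  {EN : Type*} [NormedAddCommGroup EN] [NormedSpace ℝ EN]
  {HN : Type*} [TopologicalSpace HN] {J : ModelWithCorners ℝ EN HN}
  {N : Type*} [TopologicalSpace N] [ChartedSpace HN N] [IsManifold J ∞ N]
  {k : ℕ}

/-- Base maps such as the retraction composed with `φ` are known only near a point. The base point
occurs in the type of the fibre, so the replacement is made by transport. -/
theorem inTangentCoordinates_congr {f : N → M} {g g' : N → M'} {A : N → E →L[ℝ] E'} {x₀ : N}
    (h : g =ᶠ[𝓝 x₀] g') :
    inTangentCoordinates I I' f g A x₀ =ᶠ[𝓝 x₀] inTangentCoordinates I I' f g' A x₀ := by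
  have key : ∀ p p' q q' : M', p = p' → q = q' → ∀ x,
      ContinuousLinearMap.inCoordinates E (TangentSpace I) E' (TangentSpace I') (f x₀) (f x) p q
        (A x) =
      ContinuousLinearMap.inCoordinates E (TangentSpace I) E' (TangentSpace I') (f x₀) (f x) p' q'
        (A x) := by
    rintro _ _ _ _ rfl rfl _
    rfl
  filter_upwards [h] with x hx
  exact key _ _ _ _ h.self_of_nhds hx x

/-- Velocities of a smooth family of maps form a smooth vector field along their base points. -/
theorem contMDiffAt_field_mfderiv {f : N → E' → M} {g : N → E'} {b : N → M} {x₀ : N}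
    (hf : ContMDiffAt (J.prod 𝓘(ℝ, E')) I ∞ (Function.uncurry f) (x₀, g x₀))
    (hg : ContMDiffAt J 𝓘(ℝ, E') ∞ g x₀) (hb : (fun x => f x (g x)) =ᶠ[𝓝 x₀] b) (v : E') :
    ContMDiffAt J I.tangent ∞
      (fun x => (⟨b x, (mfderiv 𝓘(ℝ, E') I (f x) (g x) v : E)⟩ : TangentBundle I M)) x₀ := by
  have hb' : ContMDiffAt J I ∞ b x₀ :=
    (ContMDiffAt.comp x₀ (g := Function.uncurry f) (f := fun x => (x, g x)) hf
      (contMDiffAt_id.prodMk hg)).congr_of_eventuallyEq hb.symm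
  refine contMDiffAt_field.2 ⟨hb', ?_⟩
  have h2 := (ContMDiffAt.mfderiv (m := ∞) f g hf hg (by simp)).congr_of_eventuallyEq
    (inTangentCoordinates_congr hb).symm
  refine (h2.clm_apply (contMDiffAt_const (c := v))).congr_of_eventuallyEq ?_
  filter_upwards [eventually_mem_chart (H := H) hb'.continuousAt] with x hx
  have h4 := DFunLike.congr_fun (inTangentCoordinates_eq (I := 𝓘(ℝ, E')) (I' := I) g b
    (fun x => (mfderiv 𝓘(ℝ, E') I (f x) (g x) : E' →L[ℝ] E)) (x₀ := x₀) (x := x)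
    (mem_univ (g x)) hx) v
  have h5 := (tangentBundleCore 𝓘(ℝ, E') E').coordChange_self (achart E' (g x)) (g x)
    (mem_chart_source _ _) v
  have h6 := congrArg (fun w => (tangentBundleCore I M).coordChange (achart H (b x))
    (achart H (b x₀)) (b x) ((mfderiv 𝓘(ℝ, E') I (f x) (g x) : E' →L[ℝ] E) w)) h5
  exact h6.symm.trans h4.symm

theorem contMDiffAt_field_smul {b : N → M} {V : ∀ x, TangentSpace I (b x)} {ρ : N → ℝ} {x₀ : N}
    (hρ : ContMDiffAt J 𝓘(ℝ, ℝ) ∞ ρ x₀)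
    (hV : ContMDiffAt J I.tangent ∞ (fun x => (⟨b x, V x⟩ : TangentBundle I M)) x₀) :
    ContMDiffAt J I.tangent ∞ (fun x => (⟨b x, ρ x • V x⟩ : TangentBundle I M)) x₀ := by
  have h1 := contMDiffAt_field.1 hV
  refine contMDiffAt_field.2 ⟨h1.1, ?_⟩
  exact (hρ.smul h1.2).congr_of_eventuallyEq (Eventually.of_forall fun x => map_smul _ _ _)

theorem contMDiffAt_field_zero {b : N → M} {x₀ : N} (hb : ContMDiffAt J I ∞ b x₀) :
    ContMDiffAt J I.tangent ∞ (fun x => (⟨b x, 0⟩ : TangentBundle I M)) x₀ :=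
  contMDiffAt_field.2 ⟨hb, (contMDiffAt_const (c := (0 : E))).congr_of_eventuallyEq
    (Eventually.of_forall fun _ => map_zero _)⟩

theorem contMDiffAt_lam_sum {ι : Type*} (t : Finset ι) {b : N → M}
    {s : ι → ∀ x, TangentSpace I (b x) [⋀^Fin k]→L[ℝ] ℝ} {x₀ : N} (hb : ContMDiffAt J I ∞ b x₀)
    (hs : ∀ i ∈ t, ContMDiffAt J (lamModel I k) ∞ (fun x => Lam.mk (b x) (s i x)) x₀) :
    ContMDiffAt J (lamModel I k) ∞ (fun x => Lam.mk (b x) (∑ i ∈ t, s i x)) x₀ := by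
  refine contMDiffAt_lam.2 ⟨hb, ?_⟩
  refine (ContMDiffAt.sum fun i hi => (contMDiffAt_lam.1 (hs i hi)).2).congr_of_eventuallyEq
    (Eventually.of_forall fun x => ?_)
  ext v
  exact (ContinuousAlternatingMap.sum_apply (M := E) _ _).trans
    (ContinuousAlternatingMap.sum_apply (M := E) (fun i =>
      ContinuousAlternatingMap.compContinuousLinearMap (M := E) (M' := E) (s i x)
        ((tangentBundleCore I M).coordChange (achart H (b x₀)) (achart H (b x)) (b x))) v).symm

/-- The wedge product of a covector and an alternating form. -/
def wedge (θ : E →L[ℝ] ℝ) (α : E [⋀^Fin k]→L[ℝ] ℝ) : E [⋀^Fin (k + 1)]→L[ℝ] ℝ :=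
  ContinuousAlternatingMap.alternatizeUncurryFin (θ.smulRight α)

theorem wedge_apply (θ : E →L[ℝ] ℝ) (α : E [⋀^Fin k]→L[ℝ] ℝ) (v : Fin (k + 1) → E) :
    wedge θ α v = ∑ i : Fin (k + 1), (-1) ^ (i : ℕ) • (θ (v i) * α (i.removeNth v)) := by
  rw [wedge, ContinuousAlternatingMap.alternatizeUncurryFin_apply]
  rfl

theorem contDiff_wedge :
    ContDiff ℝ ∞ (fun q : (E →L[ℝ] ℝ) × (E [⋀^Fin k]→L[ℝ] ℝ) => wedge q.1 q.2) := by
  exact (ContinuousAlternatingMap.alternatizeUncurryFinCLM ℝ E ℝ).contDiff.comp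
    (contDiff_fst.smulRight contDiff_snd)

/-- Wedge products of smooth families of covectors and forms are smooth. -/
theorem contMDiffAt_wedge {b : N → M} {θ : ∀ x, TangentSpace I (b x) →L[ℝ] ℝ}
    {α : ∀ x, TangentSpace I (b x) [⋀^Fin k]→L[ℝ] ℝ} {c : N → ℝ} {x₀ : N}
    (hθ : ContMDiffAt J 𝓘(ℝ, E →L[ℝ] ℝ) ∞ (inTangentCoordinates I 𝓘(ℝ, ℝ) b c θ x₀) x₀)
    (hα : ContMDiffAt J (lamModel I k) ∞ (fun x => Lam.mk (b x) (α x)) x₀) :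
    ContMDiffAt J (lamModel I (k + 1)) ∞
      (fun x => (Lam.mk (b x) (wedge (E := E) (θ x) (α x)) : Lam I M (k + 1))) x₀ := by
  rw [contMDiffAt_lam] at hα
  refine (contMDiffAt_lam (s := fun x => (Lam.mk (b x) (wedge (E := E) (θ x) (α x)) : Lam I M (k + 1)))).2 ?_
  refine ⟨hα.1, ?_⟩
  have h := (contDiff_wedge (E := E) (k := k)).contMDiff.contMDiffAt.comp x₀ (hθ.prodMk_space hα.2)
  refine h.congr_of_eventuallyEq ?_
  filter_upwards [eventually_mem_chart (H := H) hα.1.continuousAt] with x hx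
  have h1 := inTangentCoordinates_eq (I := I) (I' := 𝓘(ℝ, ℝ)) b c θ hx (mem_chart_source ℝ (c x))
  -- The coordinate change on the target `ℝ` is the identity, so the choice of `c` does not matter
  -- and only the coordinate change on `M` remains.
  have h2 : (inTangentCoordinates I 𝓘(ℝ, ℝ) b c θ x₀ x : E →L[ℝ] ℝ) =
      (θ x : E →L[ℝ] ℝ).comp
        ((tangentBundleCore I M).coordChange (achart H (b x₀)) (achart H (b x)) (b x)) := by
    ext v
    refine (DFunLike.congr_fun h1 v).trans ?_
    exact (tangentBundleCore 𝓘(ℝ, ℝ) ℝ).coordChange_self (achart ℝ (c x)) (c x)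
      (mem_chart_source _ _) _
  ext v
  simp only [Function.comp_apply]
  rw [h2, wedge_apply]
  exact wedge_apply _ _ _

end SmoothFamilies

/-! ### Local retractions and fibre coordinates -/

section LocalCoordinates

/-- A smooth embedding has a smooth left inverse near every point. -/
theorem exists_local_leftInverse {n l : ℕ} {S X : Type*}
    [TopologicalSpace S] [ChartedSpace (EuclideanSpace ℝ (Fin n)) S] [IsManifold (𝓡 n) ∞ S]
    [TopologicalSpace X] [ChartedSpace (EuclideanSpace ℝ (Fin l)) X] [IsManifold (𝓡 l) ∞ X]
    {τ : S → X} (h : IsSmoothEmbedding (𝓡 n) (𝓡 l) ∞ τ) (x₀ : S) :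
    ∃ (g : X → S) (W : Set X), IsOpen W ∧ τ x₀ ∈ W ∧ ContMDiffOn (𝓡 l) (𝓡 n) ∞ g W ∧
      ∀ᶠ x in 𝓝 x₀, g (τ x) = x := by
  obtain ⟨F', _, _, hF⟩ := h.isImmersion
  have hi := hF x₀
  set e := hi.domChart
  set c := hi.codChart
  have he : ContMDiffOn (𝓡 n) (𝓡 n) ∞ e.symm e.target :=
    contMDiffOn_symm_of_mem_maximalAtlas hi.domChart_mem_maximalAtlas
  have hc : ContMDiffOn (𝓡 l) (𝓡 l) ∞ c c.source :=
    contMDiffOn_of_mem_maximalAtlas hi.codChart_mem_maximalAtlas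
  -- In the normal form of an immersion, `τ` reads `u ↦ (u, 0)` up to the linear isomorphism
  -- `hi.equiv`; the first component of its inverse undoes this.
  let r : EuclideanSpace ℝ (Fin l) → EuclideanSpace ℝ (Fin n) := fun z => (hi.equiv.symm z).1
  have hr : ContDiff ℝ ∞ r := contDiff_fst.comp hi.equiv.symm.contDiff
  have hτ : ∀ x ∈ e.source, r (c (τ x)) = e x := fun x hx => by
    have h0 : e x ∈ (hi.domChart.extend (𝓡 n)).target := by simpa using e.map_source hx
    have h1 := hi.writtenInCharts h0
    have h2 : c (τ x) = hi.equiv (e x, 0) := by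
      have h3 : hi.domChart.symm (e x) = x := e.left_inv hx
      simpa [h3, c] using h1
    simp only [r, h2, ContinuousLinearEquiv.symm_apply_apply]
  refine ⟨fun z => e.symm (r (c z)), c.source ∩ (r ∘ c) ⁻¹' e.target,
    (hr.continuous.comp_continuousOn c.continuousOn).isOpen_inter_preimage c.open_source
      e.open_target, ⟨hi.mem_codChart_source, ?_⟩, ?_, ?_⟩
  · rw [mem_preimage, Function.comp_apply, hτ x₀ hi.mem_domChart_source]
    exact e.map_source hi.mem_domChart_source
  · exact he.comp (hr.contMDiff.comp_contMDiffOn (hc.mono inter_subset_left)) inter_subset_right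
  · filter_upwards [e.open_source.mem_nhds hi.mem_domChart_source] with x hx
    rw [hτ x hx, e.left_inv hx]

end LocalCoordinates

namespace LiftedTheory

variable {n m d : ℕ} {S X Y F G : Type*}
  [TopologicalSpace S] [ChartedSpace (EuclideanSpace ℝ (Fin n)) S]
  [TopologicalSpace X] [ChartedSpace (EuclideanSpace ℝ (Fin (n + 1))) X]
  [TopologicalSpace Y] [ChartedSpace (EuclideanSpace ℝ (Fin m)) Y]
  [TopologicalSpace F] [ChartedSpace (EuclideanSpace ℝ (Fin d)) F]
  [Group G] [DiffeologicalSpace G]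
  (D : LiftedTheory n m d S X Y F G)

/-- Smooth fibre coordinates `Ψ` near a point of the total space, together with the smooth
parametrisation `Φ` of the total space by the base and the fibre coordinates. -/
theorem exists_fibre_coordinates [IsManifold (𝓡 d) ∞ F] (y₀ : Y) :
    ∃ (Ψ : Y → EuclideanSpace ℝ (Fin d)) (Φ : X × EuclideanSpace ℝ (Fin d) → Y) (U : Set Y)
      (O : Set (X × EuclideanSpace ℝ (Fin d))), IsOpen U ∧ IsOpen O ∧ y₀ ∈ U ∧
      ContMDiffOn (𝓡 m) (𝓡 d) ∞ Ψ U ∧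
      ContMDiffOn ((𝓡 (n + 1)).prod (𝓡 d)) (𝓡 m) ∞ Φ O ∧
      (∀ y ∈ U, (D.proj y, Ψ y) ∈ O ∧ Φ (D.proj y, Ψ y) = y) ∧ ∀ q ∈ O, D.proj (Φ q) = q.1 := by
  obtain ⟨e, hy₀, he, hes⟩ := D.locally_trivial (D.proj y₀)
  -- Fibre coordinates are the fibre component of a trivialisation, read in a chart of the typical
  -- fibre around the component of `y₀`.
  let c := chartAt (EuclideanSpace ℝ (Fin d)) (e y₀).2
  have hc : ContMDiffOn (𝓡 d) (𝓡 d) ∞ c c.source := contMDiffOn_chart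
  have hcs : ContMDiffOn (𝓡 d) (𝓡 d) ∞ c.symm c.target := contMDiffOn_chart_symm
  have hmt : ∀ q : X × EuclideanSpace ℝ (Fin d), q ∈ e.baseSet ×ˢ c.target →
      (q.1, c.symm q.2) ∈ e.target := fun q hq => e.mem_target.2 hq.1
  refine ⟨fun y => c (e y).2, fun q => e.toOpenPartialHomeomorph.symm (q.1, c.symm q.2),
    e.source ∩ (fun y => (e y).2) ⁻¹' c.source, e.baseSet ×ˢ c.target, ?_, ?_, ?_, ?_, ?_, ?_, ?_⟩
  · have h : ContinuousOn (fun y => (e y).2) e.source :=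
      continuous_snd.comp_continuousOn e.toOpenPartialHomeomorph.continuousOn
    exact h.isOpen_inter_preimage e.open_source c.open_source
  · exact e.open_baseSet.prod c.open_target
  · exact ⟨e.mem_source.2 hy₀, mem_chart_source _ _⟩
  · exact hc.comp (contMDiff_snd.comp_contMDiffOn (he.mono inter_subset_left)) inter_subset_right
  · exact hes.comp (contMDiff_fst.contMDiffOn.prodMk
      (hcs.comp contMDiff_snd.contMDiffOn fun q hq => hq.2)) hmt
  · rintro y ⟨h1, h2⟩
    refine ⟨⟨e.mem_source.1 h1, c.map_source h2⟩, ?_⟩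
    have h3 : (D.proj y, c.symm (c (e y).2)) = e y := by
      rw [c.left_inv h2, e.mk_proj_snd h1]
    dsimp only
    rw [h3]
    exact e.left_inv h1
  · exact fun q hq => e.proj_symm_apply (hmt q hq)

end LiftedTheory

/-! ### Coordinates adapted to a section and their differentials -/

namespace LiftedTheory

variable {n m d : ℕ} {S X Y F G : Type*}
  [TopologicalSpace S] [ChartedSpace (EuclideanSpace ℝ (Fin n)) S]
  [TopologicalSpace X] [ChartedSpace (EuclideanSpace ℝ (Fin (n + 1))) X]
  [TopologicalSpace Y] [ChartedSpace (EuclideanSpace ℝ (Fin m)) Y]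
  [TopologicalSpace F] [ChartedSpace (EuclideanSpace ℝ (Fin d)) F]
  [Group G] [DiffeologicalSpace G]
  {D : LiftedTheory n m d S X Y F G}
  [IsManifold (𝓡 n) ∞ S] [IsManifold (𝓡 (n + 1)) ∞ X] [IsManifold (𝓡 m) ∞ Y]

/-- Local coordinates of the configuration bundle adapted to a section `φ` over the Cauchy surface:
a local retraction `g` of the base to the surface, and fibre coordinates `Ψ` with the corresponding
parametrisation `Φ`, defined along `φ` over the open subset `N` of the surface. -/
structure AdaptedCoordinates (φ : D.Config) where
  g : X → S
  Ψ : Y → EuclideanSpace ℝ (Fin d)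
  Φ : X × EuclideanSpace ℝ (Fin d) → Y
  W : Set X
  U : Set Y
  O : Set (X × EuclideanSpace ℝ (Fin d))
  N : Set S
  isOpen_W : IsOpen W
  isOpen_U : IsOpen U
  isOpen_O : IsOpen O
  isOpen_N : IsOpen N
  smooth_g : ContMDiffOn (𝓡 (n + 1)) (𝓡 n) ∞ g W
  smooth_Ψ : ContMDiffOn (𝓡 m) (𝓡 d) ∞ Ψ U
  smooth_Φ : ContMDiffOn ((𝓡 (n + 1)).prod (𝓡 d)) (𝓡 m) ∞ Φ O
  mem_O : ∀ y ∈ U, (D.proj y, Ψ y) ∈ O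
  Φ_Ψ : ∀ y ∈ U, Φ (D.proj y, Ψ y) = y
  proj_Φ : ∀ q ∈ O, D.proj (Φ q) = q.1
  mem_W : ∀ x ∈ N, D.proj (φ.val x) ∈ W
  mem_U : ∀ x ∈ N, φ.val x ∈ U
  g_proj : ∀ x ∈ N, g (D.proj (φ.val x)) = x

theorem exists_adaptedCoordinates [IsManifold (𝓡 d) ∞ F] (φ : D.Config) (x₀ : S) :
    ∃ C : AdaptedCoordinates φ, x₀ ∈ C.N := by
  obtain ⟨g, W, hW, hxW, hg, hgτ⟩ := exists_local_leftInverse D.isSmoothEmbedding x₀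
  obtain ⟨Ψ, Φ, U, O, hU, hO, hxU, hΨ, hΦ, h1, h2⟩ := D.exists_fibre_coordinates (φ.val x₀)
  have h3 : ∀ᶠ x in 𝓝 x₀, D.proj (φ.val x) ∈ W ∧ φ.val x ∈ U ∧ g (D.proj (φ.val x)) = x := by
    simp_rw [φ.proj_val]
    have h4 : ∀ᶠ x in 𝓝 x₀, D.τ x ∈ W :=
      D.isSmoothEmbedding.contMDiff.continuous.continuousAt (hW.mem_nhds hxW)
    have h5 : ∀ᶠ x in 𝓝 x₀, φ.val x ∈ U :=
      φ.smooth.continuous.continuousAt (hU.mem_nhds hxU)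
    exact h4.and (h5.and hgτ)
  obtain ⟨N, hN, hNo, hxN⟩ := eventually_nhds_iff.1 h3
  exact ⟨⟨g, Ψ, Φ, W, U, O, N, hW, hU, hO, hNo, hg, hΨ, hΦ, fun y hy => (h1 y hy).1,
    fun y hy => (h1 y hy).2, h2, fun x hx => (hN x hx).1, fun x hx => (hN x hx).2.1,
    fun x hx => (hN x hx).2.2⟩, hxN⟩

namespace AdaptedCoordinates

variable {φ : D.Config} (C : AdaptedCoordinates φ)

/-- The retraction of the total space to the Cauchy surface. -/
def ret (y : Y) : S := C.g (D.proj y)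

/-- The fibre coordinates relative to the section `φ`. -/
def height (y : Y) : EuclideanSpace ℝ (Fin d) := C.Ψ y - C.Ψ (φ.val (C.ret y))

/-- The differential of the retraction along `φ`. -/
def Q (x : S) : EuclideanSpace ℝ (Fin m) →L[ℝ] EuclideanSpace ℝ (Fin n) :=
  mfderiv (𝓡 m) (𝓡 n) C.ret (φ.val x)

/-- The differential of the relative fibre coordinates along `φ`. -/
def θ (x : S) : EuclideanSpace ℝ (Fin m) →L[ℝ] EuclideanSpace ℝ (Fin d) :=
  mfderiv (𝓡 m) (𝓡 d) C.height (φ.val x)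

/-- The differential of the parametrisation of the fibres along `φ`. -/
def K (x : S) : EuclideanSpace ℝ (Fin d) →L[ℝ] EuclideanSpace ℝ (Fin m) :=
  mfderiv (𝓡 d) (𝓡 m) (fun t => C.Φ (D.proj (φ.val x), t)) (C.Ψ (φ.val x))

variable {C} {x : S}

theorem contMDiffAt_Ψ (hx : x ∈ C.N) : ContMDiffAt (𝓡 m) (𝓡 d) ∞ C.Ψ (φ.val x) :=
  C.smooth_Ψ.contMDiffAt (C.isOpen_U.mem_nhds (C.mem_U x hx))

theorem contMDiffAt_Φ (hx : x ∈ C.N) : ContMDiffAt ((𝓡 (n + 1)).prod (𝓡 d)) (𝓡 m) ∞ C.Φ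
    (D.proj (φ.val x), C.Ψ (φ.val x)) :=
  C.smooth_Φ.contMDiffAt (C.isOpen_O.mem_nhds (C.mem_O _ (C.mem_U x hx)))

theorem contMDiffAt_g (hx : x ∈ C.N) :
    ContMDiffAt (𝓡 (n + 1)) (𝓡 n) ∞ C.g (D.proj (φ.val x)) :=
  C.smooth_g.contMDiffAt (C.isOpen_W.mem_nhds (C.mem_W x hx))

theorem contMDiffAt_ret (hx : x ∈ C.N) : ContMDiffAt (𝓡 m) (𝓡 n) ∞ C.ret (φ.val x) :=
  (contMDiffAt_g hx).comp _ (D.contMDiff_proj _)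

theorem ret_val (hx : x ∈ C.N) : C.ret (φ.val x) = x := C.g_proj x hx

theorem contMDiffAt_Ψ_ret (hx : x ∈ C.N) :
    ContMDiffAt (𝓡 m) (𝓡 d) ∞ (fun y => C.Ψ (φ.val (C.ret y))) (φ.val x) := by
  have h : ContMDiffAt (𝓡 m) (𝓡 d) ∞ C.Ψ (φ.val (C.ret (φ.val x))) := by
    rw [ret_val hx]
    exact contMDiffAt_Ψ hx
  exact h.comp (φ.val x) ((φ.smooth _).comp _ (contMDiffAt_ret hx))

theorem contMDiffAt_height (hx : x ∈ C.N) :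
    ContMDiffAt (𝓡 m) (𝓡 d) ∞ C.height (φ.val x) :=
  (contMDiffAt_Ψ hx).sub (contMDiffAt_Ψ_ret hx)

/-- The retraction undoes `φ`. The lemmas up to `K_θ` separate the two kinds of vectors along the
section: on tangent ones `Q` inverts `Tφ` and `θ` vanishes, while on vertical ones `Q` vanishes and
`θ` has the left inverse `K`. -/
theorem Q_tangent (hx : x ∈ C.N) (w : EuclideanSpace ℝ (Fin n)) :
    C.Q x (mfderiv (𝓡 n) (𝓡 m) φ.val x w) = w := by
  have h1 := mfderiv_comp_apply x ((contMDiffAt_ret hx).mdifferentiableAt (by simp))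
    (φ.smooth.mdifferentiableAt (by simp)) w
  have h2 : C.ret ∘ φ.val =ᶠ[𝓝 x] id := by
    filter_upwards [C.isOpen_N.mem_nhds hx] with z hz using ret_val hz
  have h3 := congrArg (fun A : EuclideanSpace ℝ (Fin n) →L[ℝ] EuclideanSpace ℝ (Fin n) => A w)
    ((h2.mfderiv_eq (I := 𝓡 n) (I' := 𝓡 n)).trans mfderiv_id)
  exact h1.symm.trans h3

theorem θ_tangent (hx : x ∈ C.N) (w : EuclideanSpace ℝ (Fin n)) :
    C.θ x (mfderiv (𝓡 n) (𝓡 m) φ.val x w) = 0 := by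
  have h1 := mfderiv_comp_apply x ((contMDiffAt_height hx).mdifferentiableAt (by simp))
    (φ.smooth.mdifferentiableAt (by simp)) w
  have h2 : C.height ∘ φ.val =ᶠ[𝓝 x] fun _ => 0 := by
    filter_upwards [C.isOpen_N.mem_nhds hx] with z hz
    rw [Function.comp_apply, height, ret_val hz, sub_self]
  have h3 := congrArg (fun A : EuclideanSpace ℝ (Fin n) →L[ℝ] EuclideanSpace ℝ (Fin d) => A w)
    ((h2.mfderiv_eq (I := 𝓡 n) (I' := 𝓡 d)).trans mfderiv_const)
  exact h1.symm.trans h3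

theorem Q_vert (hx : x ∈ C.N) {v : EuclideanSpace ℝ (Fin m)} (hv : v ∈ D.vert (φ.val x)) :
    C.Q x v = 0 := by
  have h1 := mfderiv_comp_apply (φ.val x) ((contMDiffAt_g hx).mdifferentiableAt (by simp))
    (D.contMDiff_proj.mdifferentiableAt (by simp)) v
  have h2 : mfderiv (𝓡 m) (𝓡 (n + 1)) D.proj (φ.val x) v = 0 := hv
  rw [h2, map_zero] at h1
  exact h1

/-- The correction subtracted in `height` factors through the retraction, whose differential kills
vertical vectors. -/
theorem θ_vert (hx : x ∈ C.N) {v : EuclideanSpace ℝ (Fin m)} (hv : v ∈ D.vert (φ.val x)) :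
    C.θ x v = mfderiv (𝓡 m) (𝓡 d) C.Ψ (φ.val x) v := by
  have h : ContMDiffAt (𝓡 n) (𝓡 d) ∞ (C.Ψ ∘ φ.val) (C.ret (φ.val x)) := by
    rw [ret_val hx]
    exact (contMDiffAt_Ψ hx).comp _ (φ.smooth x)
  have h1 := mfderiv_comp_apply (φ.val x) (h.mdifferentiableAt (by simp))
    ((contMDiffAt_ret hx).mdifferentiableAt (by simp)) v
  have h2 : mfderiv (𝓡 m) (𝓡 n) C.ret (φ.val x) v = 0 := Q_vert hx hv
  rw [h2, map_zero] at h1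
  have h3 := (((contMDiffAt_Ψ hx).mdifferentiableAt (by simp)).hasMFDerivAt.sub
    ((contMDiffAt_Ψ_ret hx).mdifferentiableAt (by simp)).hasMFDerivAt).mfderiv
  have h4 := congrArg (fun A : EuclideanSpace ℝ (Fin m) →L[ℝ] EuclideanSpace ℝ (Fin d) => A v) h3
  refine h4.trans ?_
  refine (congrArg (fun u => (mfderiv (𝓡 m) (𝓡 d) C.Ψ (φ.val x) v : EuclideanSpace ℝ (Fin d)) - u)
    h1).trans (sub_zero _)

/-- Expressing the derivative along the fibre as the full derivative of `Φ` in the direction `(0,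
c)` makes it comparable with the chain rule for `Φ ∘ (proj, Ψ)`. -/
theorem K_apply (hx : x ∈ C.N) (c : EuclideanSpace ℝ (Fin d)) :
    C.K x c = mfderiv ((𝓡 (n + 1)).prod (𝓡 d)) (𝓡 m) C.Φ (D.proj (φ.val x), C.Ψ (φ.val x))
      ((0 : EuclideanSpace ℝ (Fin (n + 1))), c) := by
  have h1 : HasMFDerivAt (𝓡 d) ((𝓡 (n + 1)).prod (𝓡 d))
      (fun t : EuclideanSpace ℝ (Fin d) => (D.proj (φ.val x), t)) (C.Ψ (φ.val x)) _ :=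
    (hasMFDerivAt_const _ _).prodMk (hasMFDerivAt_id _)
  have h2 := mfderiv_comp_apply (C.Ψ (φ.val x)) ((contMDiffAt_Φ hx).mdifferentiableAt (by simp))
    h1.mdifferentiableAt c
  rw [h1.mfderiv] at h2
  exact h2

theorem K_vert (hx : x ∈ C.N) (c : EuclideanSpace ℝ (Fin d)) : C.K x c ∈ D.vert (φ.val x) := by
  have hΦ := C.Φ_Ψ _ (C.mem_U x hx)
  have h1 : ContMDiffAt (𝓡 d) (𝓡 m) ∞ (fun t => C.Φ (D.proj (φ.val x), t)) (C.Ψ (φ.val x)) :=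
    ContMDiffAt.comp _ (contMDiffAt_Φ hx) (contMDiffAt_const.prodMk contMDiffAt_id)
  have h2 := mfderiv_comp_apply_of_eq (C.Ψ (φ.val x))
    (D.contMDiff_proj.mdifferentiableAt (by simp)) (h1.mdifferentiableAt (by simp)) hΦ c
  have h3 : (D.proj ∘ fun t => C.Φ (D.proj (φ.val x), t)) =ᶠ[𝓝 (C.Ψ (φ.val x))]
      fun _ => D.proj (φ.val x) := by
    have h4 : ContinuousAt (fun t => (D.proj (φ.val x), t)) (C.Ψ (φ.val x)) := by fun_prop
    filter_upwards [h4 (C.isOpen_O.mem_nhds (C.mem_O _ (C.mem_U x hx)))] with t ht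
    exact C.proj_Φ _ ht
  have h4 := congrArg (fun A : EuclideanSpace ℝ (Fin d) →L[ℝ] EuclideanSpace ℝ (Fin (n + 1)) => A c)
    ((h3.mfderiv_eq (I := 𝓡 d) (I' := 𝓡 (n + 1))).trans mfderiv_const)
  exact h2.symm.trans h4

/-- Differentiate `Φ (proj y, Ψ y) = y`: for vertical `v` the base component of the inner derivative
is zero. -/
theorem K_θ (hx : x ∈ C.N) {v : EuclideanSpace ℝ (Fin m)} (hv : v ∈ D.vert (φ.val x)) :
    C.K x (C.θ x v) = v := by
  have h1 : HasMFDerivAt (𝓡 m) ((𝓡 (n + 1)).prod (𝓡 d)) (fun y => (D.proj y, C.Ψ y)) (φ.val x) _ :=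
    (D.contMDiff_proj.mdifferentiableAt (by simp)).hasMFDerivAt.prodMk
      ((contMDiffAt_Ψ hx).mdifferentiableAt (by simp)).hasMFDerivAt
  have h2 := mfderiv_comp_apply (φ.val x) ((contMDiffAt_Φ hx).mdifferentiableAt (by simp))
    h1.mdifferentiableAt v
  rw [h1.mfderiv] at h2
  have h3 : C.Φ ∘ (fun y => (D.proj y, C.Ψ y)) =ᶠ[𝓝 (φ.val x)] id := by
    filter_upwards [C.isOpen_U.mem_nhds (C.mem_U x hx)] with y hy using C.Φ_Ψ y hy
  have h4 := congrArg (fun A : EuclideanSpace ℝ (Fin m) →L[ℝ] EuclideanSpace ℝ (Fin m) => A v)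
    ((h3.mfderiv_eq (I := 𝓡 m) (I' := 𝓡 m)).trans mfderiv_id)
  have h5 : mfderiv (𝓡 m) (𝓡 (n + 1)) D.proj (φ.val x) v = 0 := hv
  rw [K_apply hx, θ_vert hx hv]
  refine Eq.trans ?_ (h2.symm.trans h4)
  exact congrArg (fun u : EuclideanSpace ℝ (Fin (n + 1)) =>
    (mfderiv ((𝓡 (n + 1)).prod (𝓡 d)) (𝓡 m) C.Φ (D.proj (φ.val x), C.Ψ (φ.val x))
      (u, mfderiv (𝓡 m) (𝓡 d) C.Ψ (φ.val x) v) : EuclideanSpace ℝ (Fin m))) h5.symm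

end AdaptedCoordinates

end LiftedTheory

/-! ### Local sections of `Z` with prescribed momentum -/

namespace LiftedTheory

variable {n m d : ℕ} {S X Y F G : Type*}
  [TopologicalSpace S] [ChartedSpace (EuclideanSpace ℝ (Fin n)) S]
  [TopologicalSpace X] [ChartedSpace (EuclideanSpace ℝ (Fin (n + 1))) X]
  [TopologicalSpace Y] [ChartedSpace (EuclideanSpace ℝ (Fin m)) Y]
  [TopologicalSpace F] [ChartedSpace (EuclideanSpace ℝ (Fin d)) F]
  [Group G] [DiffeologicalSpace G]
  {D : LiftedTheory n m d S X Y F G}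
  [IsManifold (𝓡 n) ∞ S] [IsManifold (𝓡 (n + 1)) ∞ X] [IsManifold (𝓡 m) ∞ Y]

namespace AdaptedCoordinates

variable {φ : D.Config} (C : AdaptedCoordinates φ)

/-- The differentials of the relative fibre coordinates along `φ`, component by component. -/
def coframe (a : Fin d) (x : S) : EuclideanSpace ℝ (Fin m) →L[ℝ] ℝ :=
  mfderiv (𝓡 m) 𝓘(ℝ, ℝ) (fun y => C.height y a) (φ.val x)

/-- The vertical frame along `φ`, multiplied by a cut-off function. -/
def frame {χ : S → ℝ} (hχ : ContMDiff (𝓡 n) 𝓘(ℝ, ℝ) ∞ χ) (hs : tsupport χ ⊆ C.N) (a : Fin d) :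
    Tan φ where
  -- Smoothness of a momentum is tested only on vertical fields over all of `S`, so the local frame
  -- has to be extended by zero. Outside `C.N`, where verticality of `C.K x` is not known, the
  -- cut-off vanishes.
  val x := ⟨χ x • C.K x (EuclideanSpace.single a 1), by
    by_cases hx : x ∈ C.N
    · exact (D.vert (φ.val x)).smul_mem _ (K_vert hx _)
    · rw [image_eq_zero_of_notMem_tsupport fun h => hx (hs h), zero_smul]
      exact (D.vert (φ.val x)).zero_mem⟩
  smooth x := by
    by_cases hx : x ∈ C.N
    · refine contMDiffAt_field_smul (b := φ.val) (V := fun x => C.K x (EuclideanSpace.single a 1))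
        (hχ x) ?_
      refine contMDiffAt_field_mfderiv (f := fun x t => C.Φ (D.proj (φ.val x), t))
        (g := fun x => C.Ψ (φ.val x)) ?_ ((contMDiffAt_Ψ hx).comp x (φ.smooth x)) ?_ _
      · exact ContMDiffAt.comp (x, C.Ψ (φ.val x)) (g := C.Φ)
          (f := fun q : S × EuclideanSpace ℝ (Fin d) => (D.proj (φ.val q.1), q.2))
          (contMDiffAt_Φ hx)
          (((D.contMDiff_proj.comp (φ.smooth.comp contMDiff_fst)).prodMk contMDiff_snd) _)
      · filter_upwards [C.isOpen_N.mem_nhds hx] with z hz using C.Φ_Ψ _ (C.mem_U z hz)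
    · refine (contMDiffAt_field_zero (φ.smooth x)).congr_of_eventuallyEq ?_
      filter_upwards [(isClosed_tsupport χ).isOpen_compl.mem_nhds fun h => hx (hs h)] with z hz
      have h0 : χ z • C.K z (EuclideanSpace.single a 1) = 0 := by
        rw [image_eq_zero_of_notMem_tsupport hz, zero_smul]
      exact congrArg (fun u : EuclideanSpace ℝ (Fin m) =>
        (⟨φ.val z, u⟩ : TangentBundle (𝓡 m) Y)) h0

variable {C} {x : S}

theorem coframe_apply (hx : x ∈ C.N) (a : Fin d) (v : EuclideanSpace ℝ (Fin m)) :
    C.coframe a x v = C.θ x v a := by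
  have h1 := mfderiv_comp_apply (φ.val x)
    ((EuclideanSpace.proj a : EuclideanSpace ℝ (Fin d) →L[ℝ] ℝ).mdifferentiableAt)
    ((contMDiffAt_height hx).mdifferentiableAt (by simp)) v
  rw [ContinuousLinearMap.mfderiv_eq] at h1
  exact h1

/-- Where the cut-off is `1` this is `K (θ v) = v`, expanded in the standard basis of the fibre
coordinates. -/
theorem sum_coframe_frame {χ : S → ℝ} (hχ : ContMDiff (𝓡 n) 𝓘(ℝ, ℝ) ∞ χ)
    (hs : tsupport χ ⊆ C.N) (hx : x ∈ C.N) (h1 : χ x = 1) (v : D.vert (φ.val x)) :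
    ∑ a, C.coframe a x v.1 • (C.frame hχ hs a).val x = v := by
  refine Subtype.ext ?_
  have h2 := K_θ hx v.2
  have h3 : C.θ x v.1 = ∑ a, C.coframe a x v.1 • EuclideanSpace.single a (1 : ℝ) := by
    ext b
    simpa [Pi.single_apply] using (coframe_apply hx b v.1).symm
  rw [h3, map_sum] at h2
  refine Eq.trans ?_ h2
  rw [Submodule.coe_sum]
  refine Finset.sum_congr rfl fun a _ => ?_
  refine Eq.trans ?_ (map_smul (C.K x) _ _).symm
  change C.coframe a x v.1 • (χ x • C.K x (EuclideanSpace.single a 1)) = _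
  rw [h1, one_smul]

theorem contMDiffAt_coframe (hx : x ∈ C.N) (a : Fin d) :
    ContMDiffAt (𝓡 n) 𝓘(ℝ, EuclideanSpace ℝ (Fin m) →L[ℝ] ℝ) ∞
      (inTangentCoordinates (𝓡 m) 𝓘(ℝ, ℝ) φ.val (fun x => C.height (φ.val x) a)
        (fun x => C.coframe a x) x) x := by
  have h : ContMDiffAt (𝓡 m) 𝓘(ℝ, ℝ) ∞ (fun y => C.height y a) (φ.val x) :=
    (EuclideanSpace.proj a : EuclideanSpace ℝ (Fin d) →L[ℝ] ℝ).contMDiff.contMDiffAt.comp _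
      (contMDiffAt_height hx)
  exact ContMDiffAt.mfderiv (m := ∞) (fun _ y => C.height y a) φ.val
    (ContMDiffAt.comp (x, φ.val x) (g := fun y => C.height y a) (f := Prod.snd) h contMDiffAt_snd)
    (φ.smooth x) (by simp)

theorem contMDiffAt_Q (hx : x ∈ C.N) :
    ContMDiffAt (𝓡 n) 𝓘(ℝ, EuclideanSpace ℝ (Fin m) →L[ℝ] EuclideanSpace ℝ (Fin n)) ∞
      (inTangentCoordinates (𝓡 m) (𝓡 n) φ.val id (fun x => C.Q x) x) x := by
  have h := ContMDiffAt.mfderiv (m := ∞) (fun _ : S => C.ret) φ.val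
    (ContMDiffAt.comp (x, φ.val x) (g := C.ret) (f := Prod.snd) (contMDiffAt_ret hx)
      contMDiffAt_snd) (φ.smooth x) (by simp)
  refine h.congr_of_eventuallyEq (inTangentCoordinates_congr ?_)
  filter_upwards [C.isOpen_N.mem_nhds hx] with z hz using (ret_val hz).symm

variable (C)

/-- The value of a momentum on the vertical frame. -/
def frameForm {χ : S → ℝ} (hχ : ContMDiff (𝓡 n) 𝓘(ℝ, ℝ) ∞ χ) (hs : tsupport χ ⊆ C.N) (ϖ : Cot φ)
    (a : Fin d) (x : S) : EuclideanSpace ℝ (Fin n) [⋀^Fin n]→L[ℝ] ℝ :=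
  ϖ.val x ((C.frame hχ hs a).val x)

/-- A local section of the multisymplectic bundle with given momentum. -/
def localSection {χ : S → ℝ} (hχ : ContMDiff (𝓡 n) 𝓘(ℝ, ℝ) ∞ χ) (hs : tsupport χ ⊆ C.N)
    (ϖ : Cot φ) (x : S) : EuclideanSpace ℝ (Fin m) [⋀^Fin (n + 1)]→L[ℝ] ℝ :=
  ∑ a, wedge (C.coframe a x) ((C.frameForm hχ hs ϖ a x).compContinuousLinearMap (C.Q x))

variable {C} {χ : S → ℝ} (hχ : ContMDiff (𝓡 n) 𝓘(ℝ, ℝ) ∞ χ) (hs : tsupport χ ⊆ C.N) (ϖ : Cot φ)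

theorem contMDiffAt_localSection (hx : x ∈ C.N) :
    ContMDiffAt (𝓡 n) (lamModel (𝓡 m) (n + 1)) ∞
      (fun x => (Lam.mk (φ.val x) (C.localSection hχ hs ϖ x) : Lam (𝓡 m) Y (n + 1))) x := by
  refine contMDiffAt_lam_sum (I := 𝓡 m) (b := φ.val) Finset.univ (s := fun a x =>
    wedge (C.coframe a x) ((C.frameForm hχ hs ϖ a x).compContinuousLinearMap (C.Q x)))
    (φ.smooth x) fun a _ => ?_
  exact contMDiffAt_wedge (I := 𝓡 m) (b := φ.val) (contMDiffAt_coframe hx a)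
    (contMDiffAt_pullForm (s := fun x => Lam.mk x (ϖ.val x ((C.frame hχ hs a).val x)))
      (ϖ.smooth (C.frame hχ hs a) x) (φ.smooth x) (contMDiffAt_Q hx))

theorem localSection_apply (x : S) (u : Fin (n + 1) → EuclideanSpace ℝ (Fin m)) :
    C.localSection hχ hs ϖ x u = ∑ a, ∑ i : Fin (n + 1), (-1) ^ (i : ℕ) •
      (C.coframe a x (u i) *
        C.frameForm hχ hs ϖ a x (fun l => C.Q x (i.removeNth u l))) := by
  refine (ContinuousAlternatingMap.sum_apply (M := EuclideanSpace ℝ (Fin m)) _ _).trans ?_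
  exact Finset.sum_congr rfl fun a _ => wedge_apply _ _ _

/-- Each term feeds exactly one argument to the coframe. Of two vertical arguments at least one
therefore goes through `Q`, which kills it. -/
theorem localSection_eq_zero (hx : x ∈ C.N) {u : Fin (n + 1) → EuclideanSpace ℝ (Fin m)}
    {i j : Fin (n + 1)} (hij : i ≠ j) (hi : u i ∈ D.vert (φ.val x))
    (hj : u j ∈ D.vert (φ.val x)) : C.localSection hχ hs ϖ x u = 0 := by
  rw [localSection_apply]
  refine Finset.sum_eq_zero fun a _ => Finset.sum_eq_zero fun l _ => ?_
  have key : ∀ p : Fin (n + 1), p ≠ l → u p ∈ D.vert (φ.val x) →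
      C.frameForm hχ hs ϖ a x (fun b => C.Q x (l.removeNth u b)) = 0 := by
    intro p hp hv
    obtain ⟨q, rfl⟩ := Fin.exists_succAbove_eq hp
    exact ContinuousAlternatingMap.map_coord_zero _ q (Q_vert hx hv)
  by_cases h : i = l
  · rw [key j (by rintro rfl; exact hij h) hj, mul_zero, smul_zero]
  · rw [key i h hi, mul_zero, smul_zero]

theorem localSection_mem (hx : x ∈ C.N) :
    Lam.mk (φ.val x) (C.localSection hχ hs ϖ x) ∈ D.Z :=
  fun _ _ _ hij hi hj => localSection_eq_zero hχ hs ϖ hx hij hi hj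

/-- When `θ` kills the remaining arguments, only the term with `v` in the coframe survives; its
index is `0`, so its sign is `+1`. -/
theorem localSection_cons (hx : x ∈ C.N) (v : EuclideanSpace ℝ (Fin m))
    {t : Fin n → EuclideanSpace ℝ (Fin m)} {w : Fin n → EuclideanSpace ℝ (Fin n)}
    (hθ : ∀ i, C.θ x (t i) = 0) (hQ : ∀ i, C.Q x (t i) = w i) :
    C.localSection hχ hs ϖ x (Fin.cons v t) =
      ∑ a, C.coframe a x v * C.frameForm hχ hs ϖ a x w := by
  rw [localSection_apply]
  refine Finset.sum_congr rfl fun a _ => ?_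
  rw [Fin.sum_univ_succ, Finset.sum_eq_zero, add_zero]
  · simp [hQ]
  · intro i _
    rw [Fin.cons_succ, coframe_apply hx, hθ]
    simp

/-- Apply `localSection_cons` to vectors tangent to the section: the result is `∑ θ^a(v) ϖ(e_a)`,
which is `ϖ(v)` by duality of frame and coframe. -/
theorem pullback_localSection (hx : x ∈ C.N) (h1 : χ x = 1) (v : D.vert (φ.val x)) :
    pullback (I := 𝓡 n) φ.val x (interior (v : TangentSpace (𝓡 m) (φ.val x))
      (C.localSection hχ hs ϖ x)) = ϖ.val x v := by
  have h2 : ϖ.val x v = ∑ a, C.coframe a x v.1 • C.frameForm hχ hs ϖ a x := by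
    conv_lhs => rw [← sum_coframe_frame hχ hs hx h1 v, map_sum]
    exact Finset.sum_congr rfl fun a _ => map_smul _ _ _
  ext w
  refine (localSection_cons hχ hs ϖ hx v.1 (fun i => θ_tangent hx (w i))
    fun i => Q_tangent hx (w i)).trans ?_
  rw [h2]
  exact (ContinuousAlternatingMap.sum_apply (s := Finset.univ)
    (fun a => C.coframe a x v.1 • C.frameForm hχ hs ϖ a x) w).symm

end AdaptedCoordinates

end LiftedTheory

/-! ### Gluing, and surjectivity of `R_τ` -/

namespace LiftedTheory

variable {n m d : ℕ} {S X Y F G : Type*}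
  [TopologicalSpace S] [ChartedSpace (EuclideanSpace ℝ (Fin n)) S]
  [TopologicalSpace X] [ChartedSpace (EuclideanSpace ℝ (Fin (n + 1))) X]
  [TopologicalSpace Y] [ChartedSpace (EuclideanSpace ℝ (Fin m)) Y]
  [TopologicalSpace F] [ChartedSpace (EuclideanSpace ℝ (Fin d)) F]
  [Group G] [DiffeologicalSpace G]
  {D : LiftedTheory n m d S X Y F G}
  [IsManifold (𝓡 n) ∞ S] [IsManifold (𝓡 (n + 1)) ∞ X] [IsManifold (𝓡 m) ∞ Y]

theorem Cot.ext_val {φ : D.Config} {ϖ ϖ' : Cot φ} (h : ∀ x v, ϖ.val x v = ϖ'.val x v) : ϖ = ϖ' := by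
  have h1 : ϖ.val = ϖ'.val := funext fun x => LinearMap.ext (h x)
  cases ϖ
  cases ϖ'
  cases h1
  rfl

/-- The elements of the fibre of the multisymplectic bundle with a given momentum. -/
def momentumFibre {φ : D.Config} (ϖ : Cot φ) (x : S) :
    Set (EuclideanSpace ℝ (Fin m) [⋀^Fin (n + 1)]→L[ℝ] ℝ) :=
  {α | Lam.mk (φ.val x) α ∈ D.Z ∧ ∀ v : D.vert (φ.val x), pullback (I := 𝓡 n) φ.val x
    (interior (v : TangentSpace (𝓡 m) (φ.val x)) α) = ϖ.val x v}

/-- Membership in `Z` is a linear condition and prescribing the momentum an affine one. Convexity is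
what allows gluing with a partition of unity. -/
theorem convex_momentumFibre {φ : D.Config} (ϖ : Cot φ) (x : S) :
    Convex ℝ (momentumFibre ϖ x) := by
  rintro α ⟨hα1, hα2⟩ β ⟨hβ1, hβ2⟩ a b _ _ hab
  refine ⟨fun u i j hij hi hj => ?_, fun v => ?_⟩
  · have h1 : α u = 0 := hα1 u i j hij hi hj
    have h2 : β u = 0 := hβ1 u i j hij hi hj
    change a * α u + b * β u = 0
    rw [h1, h2, mul_zero, mul_zero, add_zero]
  · have h : pullback (I := 𝓡 n) φ.val x
        (interior (v : TangentSpace (𝓡 m) (φ.val x)) (a • α + b • β)) =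
        a • pullback (I := 𝓡 n) φ.val x (interior (v : TangentSpace (𝓡 m) (φ.val x)) α) +
          b • pullback (I := 𝓡 n) φ.val x (interior (v : TangentSpace (𝓡 m) (φ.val x)) β) := rfl
    rw [h, hα2, hβ2, ← add_smul, hab, one_smul]

/-- The cut-off is a bump function equal to `1` near `x₀` with support in the coordinate domain; the
local section has the right momentum where it equals `1`. -/
theorem exists_local_section [T2Space S] [IsManifold (𝓡 d) ∞ F] {φ : D.Config} (ϖ : Cot φ)
    (x₀ : S) : ∃ U ∈ 𝓝 x₀, ∃ s : S → EuclideanSpace ℝ (Fin m) [⋀^Fin (n + 1)]→L[ℝ] ℝ,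
      (∀ x ∈ U, ContMDiffAt (𝓡 n) (lamModel (𝓡 m) (n + 1)) ∞
        (fun x => (Lam.mk (φ.val x) (s x) : Lam (𝓡 m) Y (n + 1))) x) ∧
      ∀ x ∈ U, s x ∈ momentumFibre ϖ x := by
  obtain ⟨C, hC⟩ := exists_adaptedCoordinates φ x₀
  obtain ⟨χ, -, hχ⟩ := (SmoothBumpFunction.nhds_basis_tsupport (I := 𝓡 n) x₀).mem_iff.1
    (C.isOpen_N.mem_nhds hC)
  exact ⟨C.N ∩ {x | χ x = 1}, inter_mem (C.isOpen_N.mem_nhds hC) χ.eventuallyEq_one,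
    C.localSection χ.contMDiff hχ ϖ,
    fun x hx => AdaptedCoordinates.contMDiffAt_localSection χ.contMDiff hχ ϖ hx.1,
    fun x hx => ⟨AdaptedCoordinates.localSection_mem χ.contMDiff hχ ϖ hx.1,
      AdaptedCoordinates.pullback_localSection χ.contMDiff hχ ϖ hx.1 hx.2⟩⟩

theorem contMDiffAt_lam_smul {b : S → Y} {k : ℕ}
    {s : S → EuclideanSpace ℝ (Fin m) [⋀^Fin k]→L[ℝ] ℝ} {ρ : S → ℝ} {x : S}
    (hρ : ContMDiffAt (𝓡 n) 𝓘(ℝ, ℝ) ∞ ρ x)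
    (hs : ContMDiffAt (𝓡 n) (lamModel (𝓡 m) k) ∞
      (fun x => (Lam.mk (b x) (s x) : Lam (𝓡 m) Y k)) x) :
    ContMDiffAt (𝓡 n) (lamModel (𝓡 m) k) ∞
      (fun x => (Lam.mk (b x) (ρ x • s x) : Lam (𝓡 m) Y k)) x := by
  have h := contMDiffAt_lam.1 hs
  exact contMDiffAt_lam.2 ⟨h.1, hρ.smul h.2⟩

/-- Local sections with given momentum can be glued with a partition of unity. -/
theorem exists_section [CompactSpace S] [T2Space S] [IsManifold (𝓡 d) ∞ F] {φ : D.Config}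
    (ϖ : Cot φ) : ∃ s : S → EuclideanSpace ℝ (Fin m) [⋀^Fin (n + 1)]→L[ℝ] ℝ,
      (∀ x, ContMDiffAt (𝓡 n) (lamModel (𝓡 m) (n + 1)) ∞
        (fun x => (Lam.mk (φ.val x) (s x) : Lam (𝓡 m) Y (n + 1))) x) ∧
      ∀ x, s x ∈ momentumFibre ϖ x := by
  choose U hU s hs hsm using exists_local_section ϖ
  -- The sets `U i` are neighbourhoods that need not be open, hence the interiors.
  obtain ⟨ρ, hρ⟩ := SmoothPartitionOfUnity.exists_isSubordinate (𝓡 n) isClosed_univ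
    (fun i => _root_.interior (U i)) (fun _ => isOpen_interior)
    fun x _ => mem_iUnion.2 ⟨x, mem_interior_iff_mem_nhds.2 (hU x)⟩
  have hfin := ρ.locallyFinite.finite_nonempty_of_compact
  refine ⟨fun x => ∑ i ∈ hfin.toFinset, ρ i x • s i x, fun x => ?_, fun x => ?_⟩
  · refine contMDiffAt_lam_sum (I := 𝓡 m) (b := φ.val) _ (s := fun i x => ρ i x • s i x)
      (φ.smooth x) fun i _ => ?_
    by_cases hx : x ∈ tsupport (ρ i)
    · exact contMDiffAt_lam_smul ((ρ i).contMDiff x) (hs i x (interior_subset (hρ i hx)))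
    -- Off the support of `ρ i` the summand agrees locally with the zero section along `φ`, whose
    -- smoothness is the case of an empty sum.
    · have h0 := contMDiffAt_lam_sum (I := 𝓡 m) (k := n + 1) (b := φ.val) (∅ : Finset S)
        (s := fun i x => ρ i x • s i x) (φ.smooth x) (by simp)
      refine h0.congr_of_eventuallyEq ?_
      filter_upwards [(isClosed_tsupport (ρ i)).isOpen_compl.mem_nhds hx] with z hz
      have h1 : ρ i z • s i z = 0 := by rw [image_eq_zero_of_notMem_tsupport hz, zero_smul]
      exact congrArg (fun α => (Lam.mk (φ.val z) α : Lam (𝓡 m) Y (n + 1))) h1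
  · have h := (convex_momentumFibre ϖ x).finsum_mem (fun i => ρ.nonneg i x)
      (ρ.sum_eq_one (mem_univ x)) (z := fun i => s i x) fun i hi =>
        hsm i x (interior_subset (hρ i (subset_tsupport _ hi)))
    rwa [finsum_eq_sum_of_support_subset (s := hfin.toFinset) _ fun i hi => ?_] at h
    refine hfin.mem_toFinset.2 ⟨x, fun h0 => hi ?_⟩
    simp only [h0, zero_smul]

/-- Every momentum along a section `φ` over the Cauchy surface comes from a section of the
multisymplectic bundle. -/
theorem reduce_surjective [DiffeologicalGroup G] [CompactSpace S] [T2Space S]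
    [IsManifold (𝓡 d) ∞ F] :
    Function.Surjective (MultiField.reduce : D.MultiField → D.Phase) := by
  rintro ⟨φ, ϖ⟩
  obtain ⟨s, h1, h2⟩ := exists_section ϖ
  refine ⟨⟨fun x => Lam.mk (φ.val x) (s x), h1, fun x => (h2 x).1, φ.proj_val⟩, ?_⟩
  exact congrArg (Sigma.mk φ) (Cot.ext_val fun x v => (h2 x).2 v)

end LiftedTheory

/-! ### Pull-backs of interior products -/

section PullbackCalculus

variable {E : Type*} [NormedAddCommGroup E] [NormedSpace ℝ E]
  {H : Type*} [TopologicalSpace H] {I : ModelWithCorners ℝ E H}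
  {M : Type*} [TopologicalSpace M] [ChartedSpace H M]
  {E' : Type*} [NormedAddCommGroup E'] [NormedSpace ℝ E']
  {H' : Type*} [TopologicalSpace H'] {I' : ModelWithCorners ℝ E' H'}
  {M' : Type*} [TopologicalSpace M'] [ChartedSpace H' M']
  {E'' : Type*} [NormedAddCommGroup E''] [NormedSpace ℝ E'']
  {H'' : Type*} [TopologicalSpace H''] {I'' : ModelWithCorners ℝ E'' H''}
  {M'' : Type*} [TopologicalSpace M''] [ChartedSpace H'' M'']
  {k : ℕ}

theorem pullback_comp {f : M → M'} {g : M' → M''} {x : M}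
    (hg : MDifferentiableAt I' I'' g (f x)) (hf : MDifferentiableAt I I' f x)
    (α : TangentSpace I'' (g (f x)) [⋀^Fin k]→L[ℝ] ℝ) :
    pullback (I := I) (I' := I') f x (pullback (I := I') g (f x) α) =
      pullback (I := I) (g ∘ f) x α := by
  ext v
  change α _ = α _
  congr 1
  funext i
  exact (mfderiv_comp_apply x hg hf (v i)).symm

/-- The pull-back of the interior product with a tangent vector of a submanifold of dimension `n`
vanishes on forms of degree `n + 1`. -/
theorem pullback_interior_mfderiv [FiniteDimensional ℝ E] (hk : Module.finrank ℝ E < k + 1)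
    (f : M → M') (x : M) (w : TangentSpace I x)
    (α : TangentSpace I' (f x) [⋀^Fin (k + 1)]→L[ℝ] ℝ) :
    pullback (I := I) f x (interior (mfderiv I I' f x w) α) = 0 := by
  ext u
  let β : E [⋀^Fin (k + 1)]→L[ℝ] ℝ :=
    ContinuousAlternatingMap.compContinuousLinearMap (M := E') (M' := E) α (mfderiv I I' f x)
  -- The `k + 1` vectors `w, u` lie in a space of smaller dimension, so they are linearly dependent.
  have h1 : β (Fin.cons w u : Fin (k + 1) → E) = 0 := by
    refine β.toAlternatingMap.map_linearDependent _ fun h => ?_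
    have h2 := h.fintype_card_le_finrank
    rw [Fintype.card_fin] at h2
    omega
  refine Eq.trans ?_ h1
  change α _ = α _
  congr 1
  funext i
  exact Fin.cases rfl (fun i => rfl) i

theorem interior_add_smul {x : M} (c : ℝ) (v w : TangentSpace I x)
    (α : TangentSpace I x [⋀^Fin (k + 1)]→L[ℝ] ℝ) :
    interior (c • v + w) α = c • interior v α + interior w α := by
  refine (map_add (ContinuousAlternatingMap.curryLeft (E := E) α) _ _).trans ?_
  exact congrArg (· + _) (map_smul (ContinuousAlternatingMap.curryLeft (E := E) α) _ _)

/-- This lets `ξ_Y` be replaced by the vertical field `ξ_Y - Tφ ∘ ξ_τ`, which can be paired with a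
momentum. -/
theorem pullback_interior_sub_mfderiv [FiniteDimensional ℝ E] (hk : Module.finrank ℝ E < k + 1)
    (f : M → M') (x : M) (v : TangentSpace I' (f x)) (w : TangentSpace I x)
    (α : TangentSpace I' (f x) [⋀^Fin (k + 1)]→L[ℝ] ℝ) :
    pullback (I := I) f x (interior (v - mfderiv I I' f x w) α) =
      pullback (I := I) f x (interior v α) := by
  have h1 := interior_add_smul (-1 : ℝ) (mfderiv I I' f x w) v α
  rw [neg_one_smul, neg_add_eq_sub] at h1
  rw [h1]
  have h2 := pullback_interior_mfderiv hk f x w α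
  ext u
  have h3 : interior (mfderiv I I' f x w) α (fun i => mfderiv I I' f x (u i)) = 0 :=
    DFunLike.congr_fun h2 u
  change -1 * interior (mfderiv I I' f x w) α (fun i => mfderiv I I' f x (u i)) + _ = _
  rw [h3, mul_zero, zero_add]
  rfl

end PullbackCalculus

/-! ### Generators and the adjoint action -/

section ActionCalculus

open Diffeology

variable {G : Type*} [Group G] [DiffeologicalSpace G] [DiffeologicalGroup G]
  {E : Type*} [NormedAddCommGroup E] [NormedSpace ℝ E]
  {H : Type*} [TopologicalSpace H] {I : ModelWithCorners ℝ E H}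
  {M : Type*} [TopologicalSpace M] [ChartedSpace H M]
  {a : G → M → M}

theorem IsSmoothAction.mfderiv_inv_apply (h : IsSmoothAction I a) (η : G) (y : M) (v : E) :
    (mfderiv I I (a η⁻¹) (a η y) (mfderiv I I (a η) y v : E) : E) = v := by
  have h1 := mfderiv_comp_apply y ((h.contMDiff η⁻¹).mdifferentiableAt (by simp) (x := a η y))
    ((h.contMDiff η).mdifferentiableAt (by simp)) v
  have h2 : a η⁻¹ ∘ a η = id := funext (h.inv_left η)
  rw [h2, mfderiv_id] at h1
  exact h1.symm

/-- The generators of an action are equivariant with respect to the adjoint action. -/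
theorem mfderiv_generator_Ad (h : IsSmoothAction I a) (η : G) (y : M) (ξ : LieAlg G) :
    (mfderiv I I (a η⁻¹) (a η y) (generator h (a η y) ξ) : E) = generator h y (Ad η⁻¹ ξ) := by
  -- The map `a η⁻¹` intertwines the action of `ζ` with that of `η⁻¹ ζ η`, and `Ad η⁻¹` is the
  -- tangent map of this conjugation.
  have h1 := mfderiv_generator h h (MulAut.conj η⁻¹).toMonoidHom
    (fun _ _ hp => DiffeologicalGroup.mul (DiffeologicalGroup.mul isPlot_const hp) isPlot_const)
    (f := a η⁻¹) (fun ζ z => by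
      rw [← h.mul, ← h.mul]
      simp) (m := a η y) ((h.contMDiff η⁻¹).mdifferentiableAt (by simp)) ξ
  refine Eq.trans h1 ?_
  have key : ∀ y', y' = y → (generator h y' (Ad η⁻¹ ξ) : E) = generator h y (Ad η⁻¹ ξ) := by
    rintro _ rfl
    rfl
  exact key _ (h.inv_left η y)

/-- The inclusion of a subgroup commutes with conjugation; the identity is checked on velocities of
plots, which span the Lie algebra. -/
theorem LieAlg.map_subtype_Ad (K : Subgroup G) (η : K) (ξ : LieAlg K) :
    LieAlg.map K.subtype (dSmooth_subtype K) (Ad η ξ) =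
      Ad (η : G) (LieAlg.map K.subtype (dSmooth_subtype K) ξ) := by
  suffices hs : LieAlg.map K.subtype (dSmooth_subtype K) ∘ₗ Ad η =
      Ad (η : G) ∘ₗ LieAlg.map K.subtype (dSmooth_subtype K) from DFunLike.congr_fun hs ξ
  refine LieAlg.hom_ext fun k p v => ?_
  have h1 := congrArg (LieAlg.map K.subtype (dSmooth_subtype K))
    (LieAlg.map_mk (MulAut.conj η).toMonoidHom
      (fun _ _ hp => DiffeologicalGroup.mul (DiffeologicalGroup.mul isPlot_const hp)
        isPlot_const) p v)
  have h2 := congrArg (Ad (η : G)) (LieAlg.map_mk K.subtype (dSmooth_subtype K) p v)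
  refine (h1.trans (LieAlg.map_mk _ _ _ _)).trans (Eq.trans ?_ h2.symm)
  exact (LieAlg.map_mk (MulAut.conj (η : G)).toMonoidHom _ (p.map K.subtype _) v).symm

end ActionCalculus

/-- By the chain rule, the determinants of the differentials of two inverse maps at corresponding
points have product `1`. -/
theorem OrientationPreserving.inverse {n : ℕ} {S : Type*} [TopologicalSpace S]
    [ChartedSpace (EuclideanSpace ℝ (Fin n)) S] {f g : S → S}
    (ho : OrientationPreserving n f) (hf : ContMDiff (𝓡 n) (𝓡 n) ∞ f)
    (hg : ContMDiff (𝓡 n) (𝓡 n) ∞ g) (hgf : Function.LeftInverse g f)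
    (hfg : Function.RightInverse g f) : OrientationPreserving n g := by
  intro x
  have h1 := mfderiv_comp (g x) (hg.mdifferentiableAt (by simp) (x := f (g x)))
    (hf.mdifferentiableAt (by simp))
  rw [hgf.comp_eq_id, mfderiv_id, hfg x] at h1
  have h2 := congrArg (fun A : EuclideanSpace ℝ (Fin n) →L[ℝ] EuclideanSpace ℝ (Fin n) => A.det) h1
  have h3 : ∀ A B : EuclideanSpace ℝ (Fin n) →L[ℝ] EuclideanSpace ℝ (Fin n),
      (A.comp B).det = A.det * B.det := fun A B => by
    simp [ContinuousLinearMap.det, LinearMap.det_comp]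
  have h4 : (ContinuousLinearMap.id ℝ (EuclideanSpace ℝ (Fin n))).det = 1 := by
    simp [ContinuousLinearMap.det]
  have h5 := h4.symm.trans (h2.trans (h3 _ _))
  have h6 := ho (g x)
  exact (pos_iff_pos_of_mul_pos (h5 ▸ one_pos)).2 h6

/-! ### The covariant momentum map of a lifted action -/

namespace LiftedTheory

variable {n m d : ℕ} {S X Y F G : Type*}
  [TopologicalSpace S] [ChartedSpace (EuclideanSpace ℝ (Fin n)) S]
  [TopologicalSpace X] [ChartedSpace (EuclideanSpace ℝ (Fin (n + 1))) X]
  [TopologicalSpace Y] [ChartedSpace (EuclideanSpace ℝ (Fin m)) Y]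
  [TopologicalSpace F] [ChartedSpace (EuclideanSpace ℝ (Fin d)) F]
  [Group G] [DiffeologicalSpace G]
  {D : LiftedTheory n m d S X Y F G}
  [IsManifold (𝓡 n) ∞ S] [IsManifold (𝓡 (n + 1)) ∞ X] [IsManifold (𝓡 m) ∞ Y]
  [DiffeologicalGroup G]

theorem mdifferentiableAt_lam_proj (z : Lam (𝓡 m) Y (n + 1)) :
    MDifferentiableAt (lamModel (𝓡 m) (n + 1)) (𝓡 m)
      (fun w : Lam (𝓡 m) Y (n + 1) => w.proj) z :=
  (Bundle.contMDiff_proj (n := ∞) _ z).mdifferentiableAt (by simp)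

/-- The covariant momentum map of a lifted action, in terms of the generators on `Y`. -/
theorem J_eq (z : Lam (𝓡 m) Y (n + 1)) (ξ : LieAlg G) :
    D.J z ξ = pullback (I := lamModel (𝓡 m) (n + 1)) (I' := 𝓡 m)
      (fun w : Lam (𝓡 m) Y (n + 1) => w.proj) z (interior (D.genY ξ z.proj) z.form) := by
  have h1 := mfderiv_generator D.isSmoothAction_actZ D.isSmoothAction_actY (MonoidHom.id G)
    (fun _ _ hp => hp) (f := fun w : Lam (𝓡 m) Y (n + 1) => w.proj) (fun _ _ => rfl)
    (mdifferentiableAt_lam_proj z) ξ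
  replace h1 := h1.trans (congrArg _ (LieAlg.map_id _ _))
  ext u
  change z.form _ = z.form _
  congr 1
  funext i
  exact Fin.cases h1 (fun i => rfl) i

/-- `J` is pulled back from `Y`, and `σ` followed by the projection is `φ`; this is the integrand
formula for the energy-momentum map. -/
theorem pullback_J (σ : D.MultiField) (ξ : LieAlg G) (x : S) :
    pullback (I := 𝓡 n) σ.val x (D.J (σ.val x) ξ) = pullback (I := 𝓡 n) σ.base.val x
      (interior (D.genY ξ (σ.base.val x)) (σ.val x).form) := by
  rw [J_eq]
  exact pullback_comp (mdifferentiableAt_lam_proj _) (σ.smooth.mdifferentiableAt (by simp)) _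

/-- The lifted action on the interior product with a vector. -/
theorem interior_actZ_apply (η : G) (z : Lam (𝓡 m) Y (n + 1)) (v : EuclideanSpace ℝ (Fin m))
    (u : Fin n → EuclideanSpace ℝ (Fin m)) :
    interior (I := 𝓡 m) (x := (D.actZ η z).proj) v (D.actZ η z).form
      (fun i => (mfderiv (𝓡 m) (𝓡 m) (D.actY η) z.proj (u i) : EuclideanSpace ℝ (Fin m))) =
    interior (I := 𝓡 m) (x := z.proj)
      (mfderiv (𝓡 m) (𝓡 m) (D.actY η⁻¹) (D.actY η z.proj) v : EuclideanSpace ℝ (Fin m))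
      z.form u := by
  change z.form _ = z.form _
  congr 1
  funext i
  exact Fin.cases rfl (fun i => D.isSmoothAction_actY.mfderiv_inv_apply η z.proj (u i)) i

/-- The covariant momentum map is equivariant. -/
theorem J_Ad (η : G) (ξ : LieAlg G) (z : Lam (𝓡 m) Y (n + 1)) :
    D.J z (Ad η⁻¹ ξ) =
      pullback (I := lamModel (𝓡 m) (n + 1)) (D.actZ η) z (D.J (D.actZ η z) ξ) := by
  have hZ : MDifferentiableAt (lamModel (𝓡 m) (n + 1)) (lamModel (𝓡 m) (n + 1)) (D.actZ η) z :=
    (D.isSmoothAction_actZ.contMDiff η).mdifferentiableAt (by simp)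
  rw [J_eq, J_eq]
  refine Eq.trans ?_ (pullback_comp (mdifferentiableAt_lam_proj (D.actZ η z)) hZ _).symm
  ext u
  -- The projection after `actZ η` is definitionally `actY η` after the projection, so the
  -- derivative is computed from the second composite.
  have h1 := mfderiv_comp_apply z
    ((D.isSmoothAction_actY.contMDiff η).mdifferentiableAt (by simp) (x := z.proj))
    (mdifferentiableAt_lam_proj z)
  have h2 : (mfderiv (𝓡 m) (𝓡 m) (D.actY η⁻¹) (D.actY η z.proj) (D.genY ξ (D.actY η z.proj)) :
      EuclideanSpace ℝ (Fin m)) = D.genY (Ad η⁻¹ ξ) z.proj :=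
    mfderiv_generator_Ad D.isSmoothAction_actY η z.proj ξ
  have h3 := interior_actZ_apply (D := D) η z (D.genY ξ (D.actY η z.proj))
    (fun i => mfderiv (lamModel (𝓡 m) (n + 1)) (𝓡 m) (fun w : Lam (𝓡 m) Y (n + 1) => w.proj) z
      (u i))
  rw [h2] at h3
  refine h3.symm.trans ?_
  exact congrArg (interior (I := 𝓡 m) (x := (D.actZ η z).proj) (D.genY ξ (D.actY η z.proj))
    (D.actZ η z).form) (funext fun i => (h1 (u i)).symm)

end LiftedTheory

/-! ### Induced actions and momentum maps on sections and on phase space -/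

namespace LiftedTheory

variable {n m d : ℕ} {S X Y F G : Type*}
  [TopologicalSpace S] [ChartedSpace (EuclideanSpace ℝ (Fin n)) S]
  [TopologicalSpace X] [ChartedSpace (EuclideanSpace ℝ (Fin (n + 1))) X]
  [TopologicalSpace Y] [ChartedSpace (EuclideanSpace ℝ (Fin m)) Y]
  [TopologicalSpace F] [ChartedSpace (EuclideanSpace ℝ (Fin d)) F]
  [Group G] [DiffeologicalSpace G]
  {D : LiftedTheory n m d S X Y F G}
  [IsManifold (𝓡 n) ∞ S] [IsManifold (𝓡 (n + 1)) ∞ X] [IsManifold (𝓡 m) ∞ Y]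
  [DiffeologicalGroup G]

theorem isSmooth_pullback_interior_genY (σ : D.MultiField) (ξ : LieAlg G) :
    Form.IsSmooth (I := 𝓡 n) (fun x => pullback (I := 𝓡 n) σ.base.val x
      (interior (D.genY ξ (σ.base.val x)) (σ.val x).form)) :=
  contMDiff_pullback_interior σ (contMDiff_generator D.isSmoothAction_actY σ.base.smooth ξ)

theorem isSmooth_pullback_J (σ : D.MultiField) (ξ : LieAlg G) :
    Form.IsSmooth (I := 𝓡 n) (fun x => pullback (I := 𝓡 n) σ.val x (D.J (σ.val x) ξ)) := by
  simp_rw [pullback_J]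
  exact isSmooth_pullback_interior_genY σ ξ

theorem OrientationPreserving.actS_inv {η : D.stab} (h : OrientationPreserving n (D.actS η)) :
    OrientationPreserving n (D.actS η⁻¹) :=
  h.inverse (D.isSmoothAction_actS.contMDiff η) (D.isSmoothAction_actS.contMDiff η⁻¹)
    (D.isSmoothAction_actS.inv_left η) (D.isSmoothAction_actS.inv_right η)

theorem incl_Ad (η : D.stab) (ξ : LieAlg D.stab) : D.incl (Ad η ξ) = Ad (η : G) (D.incl ξ) :=
  LieAlg.map_subtype_Ad D.stab η ξ

/-! ### The action on momenta -/

/-- The tangent map of `η_Y⁻¹` on vertical vectors along `η_Y ∘ φ ∘ η_τ⁻¹`. -/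
def vertInv (η : D.stab) (φ : D.Config) (x : S) (v : D.vert ((actConfig η φ).val x)) :
    D.vert (φ.val (D.actS η⁻¹ x)) :=
  ⟨(mfderiv (𝓡 m) (𝓡 m) (D.actY (η : G)⁻¹) (D.actY η (φ.val (D.actS η⁻¹ x))) v.1 :
    EuclideanSpace ℝ (Fin m)), by
    have h := D.mfderiv_actY_mem_vert (η : G)⁻¹ v.2
    have key : ∀ y, y = φ.val (D.actS η⁻¹ x) → ∀ w : EuclideanSpace ℝ (Fin m), w ∈ D.vert y →
        w ∈ D.vert (φ.val (D.actS η⁻¹ x)) := by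
      rintro _ rfl w hw
      exact hw
    exact key _ (D.isSmoothAction_actY.inv_left (η : G) _) _ h⟩

/-- The transformation of momenta by `η ∈ 𝒢_τ`. -/
def cotVal (η : D.stab) {φ : D.Config} (ϖ : Cot φ) (x : S) (v : D.vert ((actConfig η φ).val x)) :
    TangentSpace (𝓡 n) x [⋀^Fin n]→L[ℝ] ℝ :=
  pullback (I := 𝓡 n) (D.actS η⁻¹) x (ϖ.val (D.actS η⁻¹ x) (vertInv η φ x v))

/-- The right side involves `σ` only through its momentum, so the action descends along `R_τ`. The
factor `Tη_Y` in the derivative of the transformed section cancels the `Tη_Y⁻¹` of the lifted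
action, except in the slot of `v`. -/
theorem momentum_actMulti (η : D.stab) (σ : D.MultiField) (x : S)
    (v : D.vert ((actConfig η σ.base).val x)) :
    (actMulti η σ).momentum.val x v = cotVal η σ.momentum x v := by
  have hS : MDifferentiableAt (𝓡 n) (𝓡 n) (D.actS η⁻¹) x :=
    (D.isSmoothAction_actS.contMDiff η⁻¹).mdifferentiableAt (by simp)
  have hφ : MDifferentiableAt (𝓡 n) (𝓡 m) σ.base.val (D.actS η⁻¹ x) :=
    σ.base.smooth.mdifferentiableAt (by simp)
  have hY : MDifferentiableAt (𝓡 m) (𝓡 m) (D.actY η) (σ.base.val (D.actS η⁻¹ x)) :=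
    (D.isSmoothAction_actY.contMDiff η).mdifferentiableAt (by simp)
  ext u
  have h1 := mfderiv_comp_apply x hY (hφ.comp x hS)
  have h2 := mfderiv_comp_apply x hφ hS
  have h3 := interior_actZ_apply (D := D) (η : G) (σ.val (D.actS η⁻¹ x)) v.1
    (fun i => mfderiv (𝓡 n) (𝓡 m) σ.base.val (D.actS η⁻¹ x)
      (mfderiv (𝓡 n) (𝓡 n) (D.actS η⁻¹) x (u i)))
  refine Eq.trans ?_ h3
  refine congrArg (interior (I := 𝓡 m) (x := (D.actZ η (σ.val (D.actS η⁻¹ x))).proj) v.1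
    (D.actZ η (σ.val (D.actS η⁻¹ x))).form) (funext fun i => (h1 (u i)).trans ?_)
  exact congrArg (fun w : EuclideanSpace ℝ (Fin m) => (mfderiv (𝓡 m) (𝓡 m) (D.actY η)
    (σ.base.val (D.actS η⁻¹ x)) w : EuclideanSpace ℝ (Fin m))) (h2 (u i))

/-- The transformed momentum, when it is known to be smooth, determines a point of phase space. -/
def IsPushforward (η : D.stab) (p q : D.Phase) : Prop :=
  ∃ ϖ' : Cot (actConfig η p.1), q = ⟨actConfig η p.1, ϖ'⟩ ∧ ∀ x v, ϖ'.val x v = cotVal η p.2 x v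

/-- Treating the push-forward as a single-valued relation avoids a direct proof that `cotVal` is
smooth: smoothness comes with the momentum of `actMulti η σ`. -/
theorem IsPushforward.unique {η : D.stab} {p q q' : D.Phase} (h : IsPushforward η p q)
    (h' : IsPushforward η p q') : q = q' := by
  obtain ⟨ϖ, rfl, h1⟩ := h
  obtain ⟨ϖ', rfl, h2⟩ := h'
  rw [Cot.ext_val fun x v => (h1 x v).trans (h2 x v).symm]

theorem isPushforward_reduce (η : D.stab) (σ : D.MultiField) :
    IsPushforward η σ.reduce (actMulti η σ).reduce :=
  ⟨(actMulti η σ).momentum, rfl, momentum_actMulti η σ⟩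

theorem MultiField.ext_val {σ σ' : D.MultiField} (h : ∀ x, σ.val x = σ'.val x) : σ = σ' := by
  have h1 : σ.val = σ'.val := funext h
  cases σ
  cases σ'
  cases h1
  rfl

theorem actMulti_one (σ : D.MultiField) : actMulti 1 σ = σ := MultiField.ext_val fun x => by
  change D.actZ 1 (σ.val (D.actS 1⁻¹ x)) = σ.val x
  rw [D.isSmoothAction_actZ.one, inv_one, D.isSmoothAction_actS.one]

theorem actMulti_mul (η ζ : D.stab) (σ : D.MultiField) :
    actMulti (η * ζ) σ = actMulti η (actMulti ζ σ) := MultiField.ext_val fun x => by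
  change D.actZ (η * ζ : G) (σ.val (D.actS (η * ζ)⁻¹ x)) =
    D.actZ η (D.actZ ζ (σ.val (D.actS ζ⁻¹ (D.actS η⁻¹ x))))
  rw [D.isSmoothAction_actZ.mul, mul_inv_rev, D.isSmoothAction_actS.mul]

variable [CompactSpace S] [T2Space S]

theorem energyMomentum_eq (σ : D.MultiField) (ξ : LieAlg G) :
    energyMomentum σ ξ = formIntegral (fun x => pullback (I := 𝓡 n) σ.base.val x
      (interior (D.genY ξ (σ.base.val x)) (σ.val x).form)) := by
  unfold energyMomentum
  simp_rw [pullback_J]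

theorem energyMomentum_add_smul (σ : D.MultiField) (c : ℝ) (ξ ζ : LieAlg G) :
    energyMomentum σ (c • ξ + ζ) = c * energyMomentum σ ξ + energyMomentum σ ζ := by
  refine Eq.trans ?_ (formIntegral_add_smul c (isSmooth_pullback_J σ ξ) (isSmooth_pullback_J σ ζ))
  refine congrArg formIntegral (funext fun x => ?_)
  rw [map_add, map_smul]
  rfl

theorem isLinearMap_energyMomentum (σ : D.MultiField) : IsLinearMap ℝ (energyMomentum σ) := by
  have h0 : energyMomentum σ 0 = 0 := by
    have h := energyMomentum_add_smul σ 1 0 0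
    rw [smul_zero, add_zero, one_mul] at h
    linarith
  refine ⟨fun ξ ζ => ?_, fun c ξ => ?_⟩
  · simpa using energyMomentum_add_smul σ 1 ξ ζ
  · simpa [h0] using energyMomentum_add_smul σ c ξ 0

/-- By `J_Ad`, pulling back the integrand on the left by `η_τ⁻¹` gives the integrand of `η_Z ∘ σ ∘
η_τ⁻¹`; orientation is needed only to leave the integral unchanged. -/
theorem momentumMap_Ad [OrientedAtlas n S] {η : D.stab} (ho : OrientationPreserving n (D.actS η))
    (σ : D.MultiField) (ξ : LieAlg D.stab) :
    momentumMap σ (Ad η⁻¹ ξ) = momentumMap (actMulti η σ) ξ := by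
  unfold momentumMap
  have h0 : D.incl (Ad η⁻¹ ξ) = Ad (η : G)⁻¹ (D.incl ξ) := incl_Ad η⁻¹ ξ
  rw [h0]
  refine (formIntegral_pullback (D.isSmoothAction_actS.contMDiff η⁻¹)
    (D.isSmoothAction_actS.contMDiff η) (OrientationPreserving.actS_inv ho)
    (D.isSmoothAction_actS.inv_right η) (D.isSmoothAction_actS.inv_left η)
    (isSmooth_pullback_J σ (Ad (η : G)⁻¹ (D.incl ξ)))).symm.trans ?_
  refine congrArg formIntegral (funext fun x => ?_)
  have hS : MDifferentiableAt (𝓡 n) (𝓡 n) (D.actS η⁻¹) x :=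
    (D.isSmoothAction_actS.contMDiff η⁻¹).mdifferentiableAt (by simp)
  have hσ : MDifferentiableAt (𝓡 n) (lamModel (𝓡 m) (n + 1)) σ.val (D.actS η⁻¹ x) :=
    σ.smooth.mdifferentiableAt (by simp)
  have hZ : MDifferentiableAt (lamModel (𝓡 m) (n + 1)) (lamModel (𝓡 m) (n + 1)) (D.actZ η)
      (σ.val (D.actS η⁻¹ x)) := (D.isSmoothAction_actZ.contMDiff η).mdifferentiableAt (by simp)
  rw [J_Ad, pullback_comp hZ hσ, pullback_comp (hZ.comp _ hσ) hS]
  rfl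

/-- The two integrands agree pointwise, since the tangential part `Tφ ∘ ξ_τ` contributes nothing for
reasons of degree. -/
theorem momentumMap_eq_pair (σ : D.MultiField) (ξ : LieAlg D.stab) :
    momentumMap σ ξ = σ.momentum.pair (genConfig ξ σ.base) := by
  unfold momentumMap
  rw [energyMomentum_eq]
  refine congrArg formIntegral (funext fun x => ?_)
  exact (pullback_interior_sub_mfderiv (by simp) σ.base.val x (D.genY (D.incl ξ) (σ.base.val x))
    (D.genS ξ x) (σ.val x).form).symm

/-- Inserting `Tη_Y ∘ V ∘ η_τ⁻¹` cancels the inverse differential in `cotVal`. What remains is the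
pull-back of the form `ϖ(V)` by `η_τ⁻¹`, with the same integral. -/
theorem pair_tanMap [OrientedAtlas n S] {η : D.stab} (ho : OrientationPreserving n (D.actS η))
    {φ : D.Config} {ϖ : Cot φ} {ϖ' : Cot (actConfig η φ)}
    (h : ∀ x v, ϖ'.val x v = cotVal η ϖ x v) (V : Tan φ) :
    ϖ'.pair (tanMap η V) = ϖ.pair V := by
  refine Eq.trans ?_ (formIntegral_pullback (D.isSmoothAction_actS.contMDiff η⁻¹)
    (D.isSmoothAction_actS.contMDiff η) (OrientationPreserving.actS_inv ho)
    (D.isSmoothAction_actS.inv_right η) (D.isSmoothAction_actS.inv_left η) (ϖ.smooth V))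
  refine congrArg formIntegral (funext fun x => ?_)
  rw [h, cotVal]
  congr 2
  exact Subtype.ext (D.isSmoothAction_actY.mfderiv_inv_apply (η : G) _ _)

end LiftedTheory

end

end FieldTheory

/-! ### The corollary: descent along `R_τ` -/

theorem corollary7p6 {n m d : ℕ} {S X Y F G : Type*}
    [TopologicalSpace S] [ChartedSpace (EuclideanSpace ℝ (Fin n)) S] [IsManifold (𝓡 n) ∞ S]
    [CompactSpace S] [T2Space S] [OrientedAtlas n S]
    [TopologicalSpace X] [ChartedSpace (EuclideanSpace ℝ (Fin (n + 1))) X]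
    [IsManifold (𝓡 (n + 1)) ∞ X]
    [TopologicalSpace Y] [ChartedSpace (EuclideanSpace ℝ (Fin m)) Y] [IsManifold (𝓡 m) ∞ Y]
    [TopologicalSpace F] [ChartedSpace (EuclideanSpace ℝ (Fin d)) F] [IsManifold (𝓡 d) ∞ F]
    [Group G] [DiffeologicalSpace G] [DiffeologicalGroup G]
    (D : LiftedTheory n m d S X Y F G) :
    -- (i) the energy-momentum map takes values in the dual of the Lie algebra, with the formula
    (∀ σ : D.MultiField, IsLinearMap ℝ (energyMomentum σ) ∧
      ∀ ξ : LieAlg G, energyMomentum σ ξ = formIntegral (fun x =>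
        pullback (I := 𝓡 n) σ.base.val x
          (interior (D.genY ξ (σ.base.val x)) (σ.val x).form))) ∧
    -- the covariant momentum map is equivariant
    (∀ (η : G) (ξ : LieAlg G), ∀ z ∈ D.Z,
      D.J z (Ad η⁻¹ ξ) =
        pullback (I := lamModel (𝓡 m) (n + 1)) (D.actZ η) z (D.J (D.actZ η z) ξ)) ∧
    -- the momentum map on the space of sections of `Z` is equivariant
    (∀ (η : D.stab) (σ : D.MultiField) (ξ : LieAlg D.stab), OrientationPreserving n (D.actS η) →
      momentumMap σ (Ad η⁻¹ ξ) = momentumMap (actMulti η σ) ξ) ∧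
    -- the action and the momentum map pass to the quotient by `R_τ`, in a unique way
    (∃! f : D.stab → D.Phase → D.Phase, ∀ η (σ : D.MultiField),
      f η σ.reduce = (actMulti η σ).reduce) ∧
    (∃! 𝒥 : D.Phase → LieAlg D.stab → ℝ, ∀ (σ : D.MultiField) (ξ : LieAlg D.stab),
      𝒥 σ.reduce ξ = momentumMap σ ξ) ∧
    ∀ (f : D.stab → D.Phase → D.Phase) (𝒥 : D.Phase → LieAlg D.stab → ℝ),
      (∀ η (σ : D.MultiField), f η σ.reduce = (actMulti η σ).reduce) →
      (∀ (σ : D.MultiField) (ξ : LieAlg D.stab), 𝒥 σ.reduce ξ = momentumMap σ ξ) →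
      -- (ii) the induced maps form an action, which is the cotangent action
      ((∀ p, f 1 p = p) ∧ (∀ η ζ p, f (η * ζ) p = f η (f ζ p)) ∧
        ∀ (η : D.stab) (φ : D.Config) (ϖ : Cot φ), ∃ ϖ' : Cot (actConfig η φ),
          f η ⟨φ, ϖ⟩ = ⟨actConfig η φ, ϖ'⟩ ∧
          (OrientationPreserving n (D.actS η) →
            ∀ V : Tan φ, ϖ'.pair (tanMap η V) = ϖ.pair V)) ∧
      -- (iii) the induced momentum map is the standard one, and it is equivariant
      (∀ (φ : D.Config) (ϖ : Cot φ) (ξ : LieAlg D.stab),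
        𝒥 ⟨φ, ϖ⟩ ξ = ϖ.pair (genConfig ξ φ)) ∧
      (∀ (η : D.stab) (p : D.Phase) (ξ : LieAlg D.stab), OrientationPreserving n (D.actS η) →
        𝒥 p (Ad η⁻¹ ξ) = 𝒥 (f η p) ξ) := by
  have hs : Function.Surjective (MultiField.reduce : D.MultiField → D.Phase) := reduce_surjective
  -- Independence of the lift: both reductions are push-forwards of the same phase point. With
  -- surjectivity, any choice of lifts, here `surjInv`, defines the induced action.
  have hu : ∀ (η : D.stab) (σ σ' : D.MultiField), σ.reduce = σ'.reduce →
      (actMulti η σ).reduce = (actMulti η σ').reduce := fun η σ σ' h =>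
    (isPushforward_reduce η σ).unique (h ▸ isPushforward_reduce η σ')
  refine ⟨fun σ => ⟨isLinearMap_energyMomentum σ, energyMomentum_eq σ⟩,
    fun η ξ z _ => J_Ad η ξ z, fun η σ ξ ho => momentumMap_Ad ho σ ξ,
    ⟨fun η p => (actMulti η (Function.surjInv hs p)).reduce,
      fun η σ => hu η _ _ (Function.surjInv_eq hs _), fun f hf => ?_⟩,
    ⟨fun p ξ => p.2.pair (genConfig ξ p.1), fun σ ξ => (momentumMap_eq_pair σ ξ).symm,
      fun 𝒥 h => ?_⟩, fun f 𝒥 hf h => ⟨⟨fun p => ?_, fun η ζ p => ?_, fun η φ ϖ => ?_⟩,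
      fun φ ϖ ξ => ?_, fun η p ξ ho => ?_⟩⟩
  · funext η p
    conv_lhs => rw [← Function.surjInv_eq hs p]
    exact hf η _
  · funext p ξ
    obtain ⟨σ, rfl⟩ := hs p
    exact (h σ ξ).trans (momentumMap_eq_pair σ ξ)
  · obtain ⟨σ, rfl⟩ := hs p
    rw [hf, actMulti_one]
  · obtain ⟨σ, rfl⟩ := hs p
    rw [hf, hf, hf, actMulti_mul]
  · obtain ⟨σ, hσ⟩ := hs ⟨φ, ϖ⟩
    have h1 := isPushforward_reduce η σ
    rw [← hf, hσ] at h1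
    obtain ⟨ϖ', h2, h3⟩ := h1
    exact ⟨ϖ', h2, fun ho V => pair_tanMap ho h3 V⟩
  · obtain ⟨σ, hσ⟩ := hs ⟨φ, ϖ⟩
    have h1 := (h σ ξ).trans (momentumMap_eq_pair σ ξ)
    -- The type of the momentum depends on its base section, so the identity is transported along
    -- the equality of whole phase points.
    have h2 : ∀ p : D.Phase, σ.reduce = p → 𝒥 p ξ = p.2.pair (genConfig ξ p.1) := by
      rintro _ rfl
      exact h1
    exact h2 _ hσ
  · obtain ⟨σ, rfl⟩ := hs p
    rw [hf, h, h, momentumMap_Ad ho]
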